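/- Let $p$ be a prime and let $C_p$ be a cyclic group of order $p$. A $C_p$-Tambara functor is a product-preserving functor $T$ from the category of finite $C_p$-sets and isomorphism classes of bispans $X \leftarrow A \to B \to Y$ to sets, such that each of the commutative semirings $T(X)$ is a ring; write $\mathrm{res}\colon T(C_p/C_p)\to T(C_p/e)$ and $\mathrm{tr},\mathrm{nm}\colon T(C_p/e)\to T(C_p/C_p)$ for its restriction, transfer and norm along $C_p/e\to C_p/C_p$. An ideal $I$ of $T$ is a family of ideals $I(C_p/H)\subseteq T(C_p/H)$, $H\le C_p$, closed under restriction, transfer, norm and conjugation; the product $IJ$ is the ideal generated by the levelwise products $I(C_p/H)J(C_p/H)$; an ideal $P\neq T$ is prime if $IJ\subseteq P$ implies $I\subseteq P$ or $J\subseteq P$ for all ideals $I,J$ of $T$; and $T$ is a domain if its zero ideal is prime. Let $\Phi^{C_p}T = T(C_p/C_p)/\tau$, where $\tau$ is the image of $\mathrm{tr}$, which is an ideal. **Proposition.** Let $T$ be a nonzero $C_p$-Tambara functor. (a) If the map $T(C_p/e)\to\Phi^{C_p}T$ induced by $\mathrm{nm}$ is injective, $\Phi^{C_p}T$ is an integral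 domain, and $T(C_p/C_p)$ has no $p$-torsion, then $T$ is a domain. (b) If the map $T(C_p/e)\to\Phi^{C_p}T$ induced by $\mathrm{nm}$ is not injective and $\mathrm{res}\colon T(C_p/C_p)\to T(C_p/e)$ is not injective, then $T$ is not a domain. For a finite $C_p$-set $X$, the free $C_p$-Tambara functor $\underline{A}[X]$ on $X$ is the one that carries an element of $\underline{A}[X](X)$ inducing bijections $\mathrm{Hom}(\underline{A}[X],S)\cong S(X)$, natural in the $C_p$-Tambara functor $S$; the Burnside Tambara functor $\underline{A}=\underline{A}[\varnothing]$ is the initial $C_p$-Tambara functor. **Corollary.** The $C_p$-Tambara functors $\underline{A}$, $\underline{A}[C_p/C_p]$ and $\underline{A}[C_p/e]$ exist; $\underline{A}$ and $\underline{A}[C_p/C_p]$ are domains, and $\underline{A}[C_p/e]$ is not a domain. -/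

import Mathlib

universe u

/-- A finite `G`-set. -/
structure FinGSet (G : Type) [Group G] where
  carrier : Type
  [act : MulAction G carrier]
  [fin : Finite carrier]

namespace FinGSet

variable {G : Type} [Group G]

instance : CoeSort (FinGSet G) Type := ⟨FinGSet.carrier⟩

instance (X : FinGSet G) : MulAction G X := X.act

instance (X : FinGSet G) : Finite X := X.fin

/-- The empty `G`-set. -/
def empty (G : Type) [Group G] : FinGSet G :=
  letI : MulAction G Empty :=
    { smul := fun _ x => x, one_smul := fun x => x.elim, mul_smul := fun _ _ x => x.elim }
  ⟨Empty⟩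

instance : IsEmpty (empty G) := inferInstanceAs (IsEmpty Empty)

/-- The disjoint union of two finite `G`-sets. -/
def sum (X Y : FinGSet G) : FinGSet G := ⟨X ⊕ Y⟩

/-- The unique map out of the empty `G`-set. -/
def fromEmpty (X : FinGSet G) : empty G →[G] X where
  toFun x := isEmptyElim x
  map_smul' _ x := isEmptyElim x

/-- The inclusion of the first summand. -/
def inl (X Y : FinGSet G) : X →[G] sum X Y where
  toFun x := (Sum.inl x : X ⊕ Y)
  map_smul' _ _ := rfl

/-- The inclusion of the second summand. -/
def inr (X Y : FinGSet G) : Y →[G] sum X Y where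
  toFun y := (Sum.inr y : X ⊕ Y)
  map_smul' _ _ := rfl

/-- The fold map `X ⨿ X → X`. -/
def fold (X : FinGSet G) : sum X X →[G] X where
  toFun z := Sum.elim (fun x : X => x) (fun x : X => x) z
  map_smul' g z := by
    change X ⊕ X at z
    cases z <;> rfl

/-- The transitive `G`-set `G/H`. -/
def orbit [Finite G] (H : Subgroup G) : FinGSet G := ⟨G ⧸ H⟩

/-- For `H ≤ K`, the equivariant map `q : G/H → G/K` with `q (eH) = eK`. -/
def quot [Finite G] {H K : Subgroup G} (h : H ≤ K) : orbit H →[G] orbit K where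
  toFun := Subgroup.quotientMapOfLE h
  map_smul' g x := by
    change G ⧸ H at x
    induction x using QuotientGroup.induction_on
    rfl

/-- The conjugate subgroup `gKg⁻¹`. -/
abbrev conjSubgroup (g : G) (K : Subgroup G) : Subgroup G := K.map (MulAut.conj g).toMonoidHom

/-- The equivariant bijection `c_g : G/gKg⁻¹ → G/K` sending the identity coset to `gK`. -/
def conjMap [Finite G] (g : G) (K : Subgroup G) : orbit (conjSubgroup g K) →[G] orbit K where
  toFun := Quotient.lift (s := QuotientGroup.leftRel (conjSubgroup g K))
    (fun x : G => ((x * g : G) : G ⧸ K)) (by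
      intro a b hab
      obtain ⟨k, hk, hk'⟩ := QuotientGroup.leftRel_apply.mp hab
      refine QuotientGroup.eq.mpr ?_
      have hk2 : g * k * g⁻¹ = a⁻¹ * b := hk'
      have : (a * g)⁻¹ * (b * g) = k := by
        rw [mul_inv_rev, mul_assoc, ← mul_assoc a⁻¹, ← hk2]
        group
      rw [this]
      exact hk)
  map_smul' h x := by
    change G ⧸ conjSubgroup g K at x
    induction x using QuotientGroup.induction_on with
    | H x => exact congrArg (QuotientGroup.mk (s := K)) (mul_assoc h x g)

theorem quot_surjective [Finite G] {H K : Subgroup G} (h : H ≤ K) :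
    Function.Surjective (quot h) := by
  intro y
  change G ⧸ K at y
  induction y using QuotientGroup.induction_on with
  | H y => exact ⟨(y : G ⧸ H), rfl⟩

end FinGSet

open FinGSet

/-- A bispan (polynomial) `X ← A → B → Y` of finite `G`-sets. -/
structure Bispan {G : Type} [Group G] (X Y : FinGSet G) where
  A : FinGSet G
  B : FinGSet G
  r : A →[G] X
  n : A →[G] B
  t : B →[G] Y

namespace Bispan

variable {G : Type} [Group G] {X Y Z : FinGSet G}

/-- Isomorphism of bispans. The morphisms `X ⟶ Y` of the category `Poly_G` are the bispans
from `X` to `Y` up to this relation. -/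
def Iso (P Q : Bispan X Y) : Prop :=
  ∃ (e : P.A ≃ Q.A) (e' : P.B ≃ Q.B),
    (∀ (g : G) (a : P.A), e (g • a) = g • e a) ∧ (∀ (g : G) (b : P.B), e' (g • b) = g • e' b) ∧
    (∀ a, Q.r (e a) = P.r a) ∧ (∀ a, Q.n (e a) = e' (P.n a)) ∧ (∀ b, Q.t (e' b) = P.t b)

/-- The identity bispan. -/
def id (X : FinGSet G) : Bispan X X := ⟨X, X, .id G, .id G, .id G⟩

/-- The restriction bispan `R_f = [Y ← X = X = X]`. -/
def R (f : X →[G] Y) : Bispan Y X := ⟨X, X, f, .id G, .id G⟩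

/-- The transfer bispan `T_f = [X = X = X → Y]`. -/
def T (f : X →[G] Y) : Bispan X Y := ⟨X, X, .id G, .id G, f⟩

/-- The norm bispan `N_f = [X = X → Y = Y]`. -/
def N (f : X →[G] Y) : Bispan X Y := ⟨X, Y, .id G, f, .id G⟩

/-- For bispans `X ← A → B → Y` and `Y ← C → D → Z`: a point `d` of `D` together with a lift
to `B` (over `Y`) of the fibre of `C → D` over `d`. This is the dependent product along `C → D` of
`B ×_Y C → C`. -/
structure Lift (P : Bispan X Y) (Q : Bispan Y Z) where
  base : Q.B
  sec : {c : Q.A // Q.n c = base} → P.B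
  compat : ∀ c, P.t (sec c) = Q.r c.1

namespace Lift

variable {P : Bispan X Y} {Q : Bispan Y Z}

theorem ext' {e e' : Lift P Q} (h : e.base = e'.base)
    (h' : ∀ c (hc : Q.n c = e.base) (hc' : Q.n c = e'.base), e.sec ⟨c, hc⟩ = e'.sec ⟨c, hc'⟩) :
    e = e' := by
  obtain ⟨d, s, hs⟩ := e
  obtain ⟨d', s', hs'⟩ := e'
  obtain rfl : d = d' := h
  obtain rfl : s = s' := funext fun c => h' c.1 c.2 c.2
  rfl

theorem inv_smul_mem (g : G) {d : Q.B} {c : Q.A} (hc : Q.n c = g • d) : Q.n (g⁻¹ • c) = d := by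
  rw [map_smul, hc, inv_smul_smul]

/-- `G` acts by conjugation: `(g • s) c = g • s (g⁻¹ • c)`. -/
instance : SMul G (Lift P Q) where
  smul g e :=
    { base := g • e.base
      sec := fun c => g • e.sec ⟨g⁻¹ • c.1, inv_smul_mem g c.2⟩
      compat := fun c => by rw [map_smul, e.compat, map_smul, smul_inv_smul] }

theorem smul_base (g : G) (e : Lift P Q) : (g • e).base = g • e.base := rfl

theorem smul_sec (g : G) (e : Lift P Q) (c : Q.A) (hc : Q.n c = (g • e).base) :
    (g • e).sec ⟨c, hc⟩ = g • e.sec ⟨g⁻¹ • c, inv_smul_mem g hc⟩ := rfl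

theorem sec_congr (e : Lift P Q) {c c' : Q.A} (h : c = c') (hc : Q.n c = e.base)
    (hc' : Q.n c' = e.base) : e.sec ⟨c, hc⟩ = e.sec ⟨c', hc'⟩ := by
  subst h
  rfl

instance : MulAction G (Lift P Q) where
  one_smul e := ext' (one_smul G e.base) fun c hc hc' => by
    rw [smul_sec, one_smul]
    exact sec_congr e (by simp) _ _
  mul_smul g h e := ext' (mul_smul g h e.base) fun c hc hc' => by
    rw [smul_sec, smul_sec, smul_sec, mul_smul]
    congr 2
    exact sec_congr e (by simp [mul_smul]) _ _

instance : Finite (Lift P Q) :=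
  Finite.of_injective
    (fun e : Lift P Q => (⟨e.base, e.sec⟩ : (d : Q.B) × ({c : Q.A // Q.n c = d} → P.B)))
    (by
      rintro ⟨d, s, hs⟩ ⟨d', s', hs'⟩ h
      cases h
      rfl)

end Lift

/-- For bispans `X ← A → B → Y` and `Y ← C → D → Z`: a lift, a point `c` of the fibre on
which it is defined, and a point of `A` over the value of the lift at `c`. -/
structure LiftPt (P : Bispan X Y) (Q : Bispan Y Z) where
  lift : Lift P Q
  pt : Q.A
  pt_mem : Q.n pt = lift.base
  elt : P.A
  elt_mem : P.n elt = lift.sec ⟨pt, pt_mem⟩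

namespace LiftPt

variable {P : Bispan X Y} {Q : Bispan Y Z}

theorem ext' {w w' : LiftPt P Q} (h : w.lift = w'.lift) (h' : w.pt = w'.pt)
    (h'' : w.elt = w'.elt) : w = w' := by
  cases w
  cases w'
  cases h
  cases h'
  cases h''
  rfl

instance : SMul G (LiftPt P Q) where
  smul g w :=
    { lift := g • w.lift
      pt := g • w.pt
      pt_mem := (map_smul Q.n g w.pt).trans (congrArg (g • ·) w.pt_mem)
      elt := g • w.elt
      elt_mem := (map_smul P.n g w.elt).trans ((congrArg (g • ·) w.elt_mem).trans
        (congrArg (g • ·) (Lift.sec_congr w.lift (by simp) _ _))) }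

instance : MulAction G (LiftPt P Q) where
  one_smul w := ext' (one_smul G w.lift) (one_smul G w.pt) (one_smul G w.elt)
  mul_smul g h w := ext' (mul_smul g h w.lift) (mul_smul g h w.pt) (mul_smul g h w.elt)

instance : Finite (LiftPt P Q) :=
  Finite.of_injective (fun w : LiftPt P Q => (w.lift, w.pt, w.elt)) fun w w' h => by
    simp only [Prod.mk.injEq] at h
    exact ext' h.1 h.2.1 h.2.2

end LiftPt

/-- Composition of bispans (first `P`, then `Q`). -/
def comp (P : Bispan X Y) (Q : Bispan Y Z) : Bispan X Z where
  A := ⟨LiftPt P Q⟩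
  B := ⟨Lift P Q⟩
  r := { toFun := fun w : LiftPt P Q => P.r w.elt
         map_smul' := fun g (w : LiftPt P Q) => map_smul P.r g w.elt }
  n := { toFun := fun w : LiftPt P Q => w.lift
         map_smul' := fun _ (_ : LiftPt P Q) => rfl }
  t := { toFun := fun e : Lift P Q => Q.t e.base
         map_smul' := fun g (e : Lift P Q) => map_smul Q.t g e.base }

theorem iso_of_isEmpty (P Q : Bispan X Y) [IsEmpty P.A] [IsEmpty P.B] [IsEmpty Q.A] [IsEmpty Q.B] :
    P.Iso Q :=
  ⟨Equiv.equivOfIsEmpty _ _, Equiv.equivOfIsEmpty _ _, fun _ a => isEmptyElim a,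
    fun _ b => isEmptyElim b, fun a => isEmptyElim a, fun a => isEmptyElim a,
    fun b => isEmptyElim b⟩

end Bispan

/-- A `G`-semi-Tambara functor: a product preserving functor from `Poly_G` to sets. Products in
`Poly_G` are disjoint unions, with the restrictions along the two inclusions as projections, and
the empty `G`-set is terminal. -/
structure SemiTambaraFunctor (G : Type) [Group G] where
  obj : FinGSet G → Type u
  map : ∀ {X Y : FinGSet G}, Bispan X Y → obj X → obj Y
  map_iso : ∀ {X Y : FinGSet G} {P Q : Bispan X Y}, P.Iso Q → map P = map Q
  map_id : ∀ (X : FinGSet G) (x : obj X), map (Bispan.id X) x = x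
  map_comp : ∀ {X Y Z : FinGSet G} (P : Bispan X Y) (Q : Bispan Y Z) (x : obj X),
    map (P.comp Q) x = map Q (map P x)
  nonempty_empty : Nonempty (obj (FinGSet.empty G))
  subsingleton_empty : Subsingleton (obj (FinGSet.empty G))
  bijective_sum : ∀ X Y : FinGSet G, Function.Bijective
    fun z : obj (sum X Y) => (map (Bispan.R (inl X Y)) z, map (Bispan.R (inr X Y)) z)

/-- A `G`-Tambara functor: a semi-Tambara functor for which the operations `0`, `1`, `+`, `*` on
each value, given by the bispans `[∅ = ∅ = ∅ → X]`, `[∅ = ∅ → X = X]`,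
`[X ⨿ X = X ⨿ X = X ⨿ X → X]`, `[X ⨿ X = X ⨿ X → X = X]`, make it a commutative ring. The
ring structure is determined by these operations, so the field `ring` is no additional choice. -/
structure TambaraFunctor (G : Type) [Group G] extends SemiTambaraFunctor.{u} G where
  [ring : ∀ X, CommRing (obj X)]
  map_zero : ∀ (X : FinGSet G) (z : obj (FinGSet.empty G)), map (Bispan.T (fromEmpty X)) z = 0
  map_one : ∀ (X : FinGSet G) (z : obj (FinGSet.empty G)), map (Bispan.N (fromEmpty X)) z = 1
  map_add : ∀ (X : FinGSet G) (z : obj (sum X X)), map (Bispan.T (fold X)) z =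
    map (Bispan.R (inl X X)) z + map (Bispan.R (inr X X)) z
  map_mul : ∀ (X : FinGSet G) (z : obj (sum X X)), map (Bispan.N (fold X)) z =
    map (Bispan.R (inl X X)) z * map (Bispan.R (inr X X)) z

namespace TambaraFunctor

variable {G : Type} [Group G]

instance (T : TambaraFunctor.{u} G) (X : FinGSet G) : CommRing (T.obj X) := T.ring X

/-- Restriction along an equivariant map. -/
def res (T : TambaraFunctor.{u} G) {X Y : FinGSet G} (f : X →[G] Y) : T.obj Y → T.obj X :=
  T.map (Bispan.R f)

/-- Transfer along an equivariant map. -/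
def tr (T : TambaraFunctor.{u} G) {X Y : FinGSet G} (f : X →[G] Y) : T.obj X → T.obj Y :=
  T.map (Bispan.T f)

/-- Norm along an equivariant map. -/
def nm (T : TambaraFunctor.{u} G) {X Y : FinGSet G} (f : X →[G] Y) : T.obj X → T.obj Y :=
  T.map (Bispan.N f)

/-- A Tambara functor is nonzero if it has a nonzero value. -/
def IsNonzero (T : TambaraFunctor.{u} G) : Prop := ∃ X, Nontrivial (T.obj X)

/-- Morphisms of Tambara functors: natural transformations. -/
structure Hom (S T : TambaraFunctor.{u} G) where
  app : ∀ X, S.obj X → T.obj X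
  naturality : ∀ {X Y : FinGSet G} (P : Bispan X Y) (x : S.obj X),
    app Y (S.map P x) = T.map P (app X x)

/-- `T` is a Burnside Tambara functor: an initial object of the category of `G`-Tambara functors. -/
def IsBurnside (T : TambaraFunctor.{u} G) : Prop :=
  ∀ S : TambaraFunctor.{u} G, Nonempty (Unique (T.Hom S))

/-- `T` is the free `G`-Tambara functor on the finite `G`-set `X`, with universal element `x`:
evaluation at `x` is a bijection from the morphisms `T → S` to `S(X)`, for every `S`. -/
def IsFreeOn (T : TambaraFunctor.{u} G) (X : FinGSet G) (x : T.obj X) : Prop :=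
  ∀ S : TambaraFunctor.{u} G, Function.Bijective fun φ : T.Hom S => φ.app X x

theorem map_zero_of_surjective (T : TambaraFunctor.{u} G) {X Y : FinGSet G} (P : Bispan X Y)
    (hP : Function.Surjective P.n) : T.map P 0 = 0 := by
  obtain ⟨z⟩ := T.nonempty_empty
  rw [← T.map_zero X z, ← T.map_comp, ← T.map_zero Y z]
  have : IsEmpty ((Bispan.T (fromEmpty X)).comp P).B := ⟨fun e : Bispan.Lift _ P =>
    let ⟨c, hc⟩ := hP e.base
    isEmptyElim (α := FinGSet.empty G) (e.sec ⟨c, hc⟩)⟩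
  have : IsEmpty ((Bispan.T (fromEmpty X)).comp P).A :=
    ⟨fun w => isEmptyElim (((Bispan.T (fromEmpty X)).comp P).n w)⟩
  have : IsEmpty (Bispan.T (fromEmpty Y)).A := inferInstanceAs (IsEmpty (FinGSet.empty G))
  have : IsEmpty (Bispan.T (fromEmpty Y)).B := inferInstanceAs (IsEmpty (FinGSet.empty G))
  rw [T.map_iso (Bispan.iso_of_isEmpty ((Bispan.T (fromEmpty X)).comp P)
    (Bispan.T (fromEmpty Y)))]

variable [Finite G]

/-- An ideal of a Tambara functor: a collection of ideals `I(G/H) ⊆ T(G/H)` closed under transfer,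
norm, restriction and conjugation. The conjugation `T(G/H) → T(G/gHg⁻¹)` is restriction along
the bijection `c_g : G/gHg⁻¹ → G/H`. -/
structure TIdeal (T : TambaraFunctor.{u} G) where
  level : ∀ H : Subgroup G, Ideal (T.obj (orbit H))
  tr_mem : ∀ {K H : Subgroup G} (h : K ≤ H), ∀ x ∈ level K, T.tr (quot h) x ∈ level H
  nm_mem : ∀ {K H : Subgroup G} (h : K ≤ H), ∀ x ∈ level K, T.nm (quot h) x ∈ level H
  res_mem : ∀ {K H : Subgroup G} (h : K ≤ H), ∀ x ∈ level H, T.res (quot h) x ∈ level K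
  conj_mem : ∀ (g : G) (H : Subgroup G), ∀ x ∈ level H,
    T.res (conjMap g H) x ∈ level (conjSubgroup g H)

namespace TIdeal

variable {T : TambaraFunctor.{u} G}

/-- Levelwise containment of ideals. -/
instance : LE (TIdeal T) where
  le I J := ∀ H, I.level H ≤ J.level H

/-- The ideal generated by a levelwise collection of subsets: the intersection of all ideals which
contain it. -/
def generatedBy (S : ∀ H : Subgroup G, Set (T.obj (orbit H))) : TIdeal T where
  level H := ⨅ I : {I : TIdeal T // ∀ H, S H ⊆ I.level H}, I.1.level H
  tr_mem h x hx := by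
    rw [Submodule.mem_iInf] at hx ⊢
    exact fun I => I.1.tr_mem h x (hx I)
  nm_mem h x hx := by
    rw [Submodule.mem_iInf] at hx ⊢
    exact fun I => I.1.nm_mem h x (hx I)
  res_mem h x hx := by
    rw [Submodule.mem_iInf] at hx ⊢
    exact fun I => I.1.res_mem h x (hx I)
  conj_mem g H x hx := by
    rw [Submodule.mem_iInf] at hx ⊢
    exact fun I => I.1.conj_mem g H x (hx I)

/-- The product `IJ`: the ideal generated by the levelwise products `I(G/H)J(G/H)`. -/
instance : Mul (TIdeal T) where
  mul I J := generatedBy fun H => ((I.level H * J.level H : Ideal (T.obj (orbit H))) : Set _)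

/-- The zero ideal. -/
instance : Bot (TIdeal T) where
  bot :=
    { level := fun _ => ⊥
      tr_mem := fun _ x hx => by
        rw [Ideal.mem_bot] at hx ⊢
        rw [hx]
        exact T.map_zero_of_surjective _ Function.surjective_id
      nm_mem := fun h x hx => by
        rw [Ideal.mem_bot] at hx ⊢
        rw [hx]
        exact T.map_zero_of_surjective _ (quot_surjective h)
      res_mem := fun _ x hx => by
        rw [Ideal.mem_bot] at hx ⊢
        rw [hx]
        exact T.map_zero_of_surjective _ Function.surjective_id
      conj_mem := fun _ _ x hx => by
        rw [Ideal.mem_bot] at hx ⊢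
        rw [hx]
        exact T.map_zero_of_surjective _ Function.surjective_id }

/-- An ideal is proper if it is not all of `T`. -/
def IsProper (P : TIdeal T) : Prop := ∃ H, P.level H ≠ ⊤

/-- Prime ideals: proper, and `IJ ⊆ P` implies `I ⊆ P` or `J ⊆ P`. -/
def IsPrime (P : TIdeal T) : Prop :=
  P.IsProper ∧ ∀ I J : TIdeal T, I * J ≤ P → I ≤ P ∨ J ≤ P

end TIdeal

/-- A Tambara functor is a domain if its zero ideal is prime. -/
def IsTambaraDomain (T : TambaraFunctor.{u} G) : Prop := (⊥ : TIdeal T).IsPrime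

/-! In the following, `G` is meant to be the cyclic group of prime order `p`. -/

/-- The restriction `T(G/G) → T(G/e)`. -/
def resTop (T : TambaraFunctor.{u} G) : T.obj (orbit ⊤) → T.obj (orbit ⊥) :=
  T.res (quot (bot_le : (⊥ : Subgroup G) ≤ ⊤))

/-- The transfer `T(G/e) → T(G/G)`. -/
def trTop (T : TambaraFunctor.{u} G) : T.obj (orbit ⊥) → T.obj (orbit ⊤) :=
  T.tr (quot (bot_le : (⊥ : Subgroup G) ≤ ⊤))

/-- The norm `T(G/e) → T(G/G)`. -/
def nmTop (T : TambaraFunctor.{u} G) : T.obj (orbit ⊥) → T.obj (orbit ⊤) :=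
  T.nm (quot (bot_le : (⊥ : Subgroup G) ≤ ⊤))

/-- The ideal `τ` of `T(G/G)` generated by the image of the transfer `T(G/e) → T(G/G)` (this image
is itself an ideal, by Frobenius reciprocity). -/
def transferIdeal (T : TambaraFunctor.{u} G) : Ideal (T.obj (orbit (⊤ : Subgroup G))) :=
  Ideal.span (Set.range T.trTop)

/-- The geometric fixed points `Φ T = T(G/G)/τ`, for `G` of prime order. -/
abbrev GeomFixedPoints (T : TambaraFunctor.{u} G) : Type u :=
  T.obj (orbit (⊤ : Subgroup G)) ⧸ T.transferIdeal

/-- The norm `T(G/e) → Φ T`. -/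
def nmPhi (T : TambaraFunctor.{u} G) (x : T.obj (orbit (⊥ : Subgroup G))) : T.GeomFixedPoints :=
  Ideal.Quotient.mk T.transferIdeal (T.nmTop x)

end TambaraFunctor

/-! ### Invariant subsets and disjoint unions of finite `G`-sets -/

namespace FinGSet

variable {G : Type} [Group G]

/-! Two formulas carry the proof. Restricted along a map `G/e → Y`, the value of a bispan is a sum
over a fibre of products of restrictions of the argument (`res_ptMap_map`). At `G/G`, modulo
transfers, it is a sum over the fixed points of the middle set of products over the orbits in their
fibres, a fixed orbit contributing a restriction and a free orbit a norm from `G/e` (`mk_map`). The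
second formula holds because `G` has no intermediate subgroups: the non-fixed part of the middle set
is free, so its contribution is a transfer. Consequently `nm : T(G/e) → Φ T` is a ring homomorphism,
invariant under conjugation, and it is the only link between the coordinates in `T(G/e)` and in `Φ
T`.

(a) Injectivity of `nm` makes conjugation trivial on `T(G/e)`, so `res (tr c) = p c`. If `x = tr c`
has zero restriction, then `p x = tr (p c) = 0`, hence `x = 0`. So every nonzero ideal contains an
element of `T(G/G)` with nonzero class in `Φ T`: the norm of a nonzero element at `G/e`, or a
nonzero element at `G/G` itself, or the norm of its restriction. Since `Φ T` is a domain, two such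
elements have nonzero product.

(b) The kernel of all restrictions to `G/e` is an ideal (`resKernel`), nonzero when `res` is not
injective. The elements whose restrictions to `G/e` die under `nm` and whose restrictions to `G/G`
die in `Φ T` form an ideal (`phiKernel`), nonzero when `nm` is not injective. Their product is zero:
the first vanishes at `G/e`, and at `G/G` Frobenius reciprocity gives `x * tr c = tr (res x * c) =
0`.

Corollary. The free functor on `X` consists of the families of operations `S(X) → S(Y)` generated by
the identity; it is small because such families are values of formal terms over a skeleton
(`isFreeOn_free`). The two formulas, read as definitions, also produce Tambara functors from ghost
data `φ : R → Q` (`GhostData.functor`), which serve as test objects. If `G` acts trivially on `X`,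
the formulas make `ℤ[X] → T(G/e)` and `ℤ[X ⨿ X] → Φ T` surjective for the free `T`, and mapping to
the ghost functor with `R = Q = ℤ` evaluates polynomials at arbitrary integer points, so the second
map is injective; then (a) applies. On `G/e` the conjugates of the generator are distinct but have
equal norms, and an injective `res` would force `tr 1 = p`, contradicting a ring homomorphism
`T(G/G) → ℤ` that kills transfers; then (b) applies. -/

noncomputable instance (X : FinGSet G) : Fintype X := Fintype.ofFinite X

/-- An invariant subset of a finite `G`-set. -/
def sub (X : FinGSet G) (p : X → Prop) (hp : ∀ (g : G) (x : X), p x → p (g • x)) : FinGSet G :=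
  letI : MulAction G {x : X // p x} :=
    { smul := fun g x => ⟨g • x.1, hp g x.1 x.2⟩
      one_smul := fun x => Subtype.ext (one_smul G x.1)
      mul_smul := fun g h x => Subtype.ext (mul_smul g h x.1) }
  ⟨{x : X // p x}⟩

/-- The inclusion of an invariant subset. -/
def subIncl (X : FinGSet G) (p : X → Prop) (hp : ∀ (g : G) (x : X), p x → p (g • x)) :
    sub X p hp →[G] X where
  toFun x := Subtype.val (p := p) x
  map_smul' _ _ := rfl

/-- The map out of a disjoint union with given restrictions to the summands. -/
def elim {X Y Z : FinGSet G} (f : X →[G] Z) (g : Y →[G] Z) : sum X Y →[G] Z where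
  toFun := Sum.elim f g
  map_smul' a z := by
    change X ⊕ Y at z
    cases z with
    | inl x => exact map_smul f a x
    | inr x => exact map_smul g a x

/-- The disjoint union of two equivariant maps. -/
def sumMap {X Y X' Y' : FinGSet G} (f : X →[G] X') (g : Y →[G] Y') : sum X Y →[G] sum X' Y' :=
  elim ((inl X' Y').comp f) ((inr X' Y').comp g)

end FinGSet

/-! ### Explicit composites of bispans -/

namespace Bispan

theorem Lift.sec_eq {G : Type} [Group G] {X Y Z : FinGSet G} {P : Bispan X Y} {Q : Bispan Y Z}
    {e e' : Lift P Q} (h : e = e') (c : Q.A) (hc : Q.n c = e.base) (hc' : Q.n c = e'.base) :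
    e.sec ⟨c, hc⟩ = e'.sec ⟨c, hc'⟩ := by
  subst h
  rfl

variable {G : Type} [Group G] {X Y Z V W : FinGSet G}

theorem Iso.of_bijective {P Q : Bispan X Y} (α : P.A →[G] Q.A) (β : P.B →[G] Q.B)
    (hα : Function.Bijective α) (hβ : Function.Bijective β) (hr : ∀ a, Q.r (α a) = P.r a)
    (hn : ∀ a, Q.n (α a) = β (P.n a)) (ht : ∀ b, Q.t (β b) = P.t b) : P.Iso Q :=
  ⟨Equiv.ofBijective α hα, Equiv.ofBijective β hβ, map_smul α, map_smul β, hr, hn, ht⟩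

/-- The norm leg of `T g` is an identity, so its fibres are single points and a lift is the same as
a point of `P.B`. -/
theorem comp_T_iso (P : Bispan X Y) (g : Y →[G] Z) :
    Iso ⟨P.A, P.B, P.r, P.n, g.comp P.t⟩ (P.comp (T g)) := by
  refine Iso.of_bijective (Q := P.comp (T g))
    { toFun := fun a => (⟨⟨P.t (P.n a), fun _ => P.n a, fun c => c.2.symm⟩, P.t (P.n a), rfl, a, rfl⟩ :
        LiftPt P (T g))
      map_smul' := fun h a => LiftPt.ext' (Lift.ext' ?_ fun c _ _ => ?_) ?_ rfl }
    { toFun := fun b => (⟨P.t b, fun _ => b, fun c => c.2.symm⟩ : Lift P (T g))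
      map_smul' := fun h b => Lift.ext' (map_smul P.t h b) fun c _ _ => rfl }
    ⟨fun a a' h => congrArg LiftPt.elt h, fun w => ?_⟩ ⟨fun b b' h => ?_, fun e => ?_⟩
    (fun _ => rfl) (fun _ => rfl) (fun _ => rfl)
  · exact (congrArg P.t (map_smul P.n h a)).trans (map_smul P.t _ _)
  · exact map_smul P.n h a
  · exact (congrArg P.t (map_smul P.n h a)).trans (map_smul P.t _ _)
  · obtain ⟨⟨d, s, hs⟩, c, hc, a, ha⟩ := w
    obtain rfl : c = d := hc
    have hc' : P.t (P.n a) = c := by rw [ha]; exact hs ⟨c, rfl⟩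
    refine ⟨a, LiftPt.ext' (Lift.ext' hc' fun c' h h' => ?_) hc' rfl⟩
    obtain rfl : c' = c := h'
    exact ha
  · have h1 : P.t b = P.t b' := congrArg Lift.base h
    exact Lift.sec_eq h (P.t b) rfl h1
  · obtain ⟨d, s, hs⟩ := e
    refine ⟨s ⟨d, rfl⟩, Lift.ext' (hs ⟨d, rfl⟩) fun c' h h' => ?_⟩
    obtain rfl : c' = d := h'
    rfl

/-- Base change. The hypotheses `hB` and `hA` say that both squares between `P'` and `P` are
pullbacks: `P'.B` is the fibre product of `P.B` and `V` over `W`, and `P'.A` that of `P.A` and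
`P'.B` over `P.B`. -/
theorem comp_R_iso (P : Bispan X W) (f : V →[G] W) (P' : Bispan X V)
    (α : P'.A →[G] P.A) (β : P'.B →[G] P.B) (hr : ∀ a, P.r (α a) = P'.r a)
    (hn : ∀ a, P.n (α a) = β (P'.n a)) (ht : ∀ b, P.t (β b) = f (P'.t b))
    (hB : ∀ b v, P.t b = f v → ∃! b', β b' = b ∧ P'.t b' = v)
    (hA : ∀ a b', P.n a = β b' → ∃! a', α a' = a ∧ P'.n a' = b') :
    P'.Iso (P.comp (R f)) := by
  have key : ∀ b b' : P'.B, (⟨P'.t b, fun _ => β b, fun c => (ht b).trans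
        (congrArg f c.2.symm)⟩ : Lift P (R f)) = ⟨P'.t b', fun _ => β b', fun c => (ht b').trans
        (congrArg f c.2.symm)⟩ → b = b' := by
    intro b b' h
    have h1 : P'.t b = P'.t b' := congrArg Lift.base h
    have h2 : β b = β b' := Lift.sec_eq h (P'.t b) rfl h1
    exact (hB (β b) (P'.t b) (ht b)).unique ⟨rfl, rfl⟩ ⟨h2.symm, h1.symm⟩
  refine Iso.of_bijective (Q := P.comp (R f))
    { toFun := fun a => (⟨⟨P'.t (P'.n a), fun _ => β (P'.n a), fun c => (ht _).trans
        (congrArg f c.2.symm)⟩, P'.t (P'.n a), rfl, α a, hn a⟩ : LiftPt P (R f))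
      map_smul' := fun h a => LiftPt.ext' (Lift.ext' ?_ fun c _ _ => ?_) ?_ (map_smul α h a) }
    { toFun := fun b => (⟨P'.t b, fun _ => β b, fun c => (ht b).trans
        (congrArg f c.2.symm)⟩ : Lift P (R f))
      map_smul' := fun h b => Lift.ext' (map_smul P'.t h b) fun c _ _ => map_smul β h b }
    ⟨fun a a' h => ?_, fun w => ?_⟩ ⟨fun b b' h => key b b' h, fun e => ?_⟩
    hr (fun _ => rfl) (fun _ => rfl)
  · exact (congrArg P'.t (map_smul P'.n h a)).trans (map_smul P'.t _ _)
  · exact (congrArg β (map_smul P'.n h a)).trans (map_smul β _ _)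
  · exact (congrArg P'.t (map_smul P'.n h a)).trans (map_smul P'.t _ _)
  · have h1 := key _ _ (congrArg LiftPt.lift h)
    have h2 : α a = α a' := congrArg LiftPt.elt h
    exact (hA (α a) (P'.n a) (hn a)).unique ⟨rfl, rfl⟩ ⟨h2.symm, h1.symm⟩
  · obtain ⟨⟨d, s, hs⟩, c, hc, a, ha⟩ := w
    obtain rfl : c = d := hc
    obtain ⟨b', ⟨hb1, hb2⟩, -⟩ := hB (s ⟨c, rfl⟩) c (hs ⟨c, rfl⟩)
    obtain ⟨a', ⟨ha1, ha2⟩, -⟩ := hA a b' (ha.trans hb1.symm)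
    refine ⟨a', LiftPt.ext' (Lift.ext' ?_ fun c' h h' => ?_) ?_ ha1⟩
    · exact (congrArg P'.t ha2).trans hb2
    · obtain rfl : c' = c := h'
      exact (congrArg β ha2).trans hb1
    · exact (congrArg P'.t ha2).trans hb2
  · obtain ⟨d, s, hs⟩ := e
    obtain ⟨b', ⟨hb1, hb2⟩, -⟩ := hB (s ⟨d, rfl⟩) d (hs ⟨d, rfl⟩)
    refine ⟨b', Lift.ext' hb2 fun c' h h' => ?_⟩
    obtain rfl : c' = d := h'
    exact hb1

/-- The transfer leg of `R f` is an identity, so compatibility forces the section of a lift to be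
`P.r`; a lift is then its base point. -/
theorem R_comp_iso (f : X →[G] Y) (P : Bispan X Z) :
    Iso ⟨P.A, P.B, f.comp P.r, P.n, P.t⟩ ((R f).comp P) := by
  have key : ∀ b b' : P.B, (⟨b, fun c => P.r c.1, fun _ => rfl⟩ : Lift (R f) P) =
      ⟨b', fun c => P.r c.1, fun _ => rfl⟩ → b = b' := fun b b' h => congrArg Lift.base h
  refine Iso.of_bijective (Q := (R f).comp P)
    { toFun := fun a => (⟨⟨P.n a, fun c => P.r c.1, fun _ => rfl⟩, a, rfl, P.r a, rfl⟩ :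
        LiftPt (R f) P)
      map_smul' := fun h a => LiftPt.ext' (Lift.ext' (map_smul P.n h a) fun c _ _ => ?_) rfl
        (map_smul P.r h a) }
    { toFun := fun b => (⟨b, fun c => P.r c.1, fun _ => rfl⟩ : Lift (R f) P)
      map_smul' := fun h b => Lift.ext' rfl fun c _ _ => ?_ }
    ⟨fun a a' h => congrArg LiftPt.pt h, fun w => ?_⟩ ⟨fun b b' h => key b b' h, fun e => ?_⟩
    (fun _ => rfl) (fun _ => rfl) (fun _ => rfl)
  · exact ((map_smul P.r h (h⁻¹ • c)).symm.trans (congrArg P.r (smul_inv_smul h c))).symm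
  · exact ((map_smul P.r h (h⁻¹ • c)).symm.trans (congrArg P.r (smul_inv_smul h c))).symm
  · obtain ⟨⟨d, s, hs⟩, c, hc, a, ha⟩ := w
    refine ⟨c, LiftPt.ext' (Lift.ext' hc fun c' _ h' => ?_) rfl ?_⟩
    · exact (hs ⟨c', h'⟩).symm
    · exact ((ha : a = _).trans (hs ⟨c, hc⟩)).symm
  · obtain ⟨d, s, hs⟩ := e
    exact ⟨d, Lift.ext' rfl fun c' _ h' => (hs ⟨c', h'⟩).symm⟩

/-- The bispan `[X ← A → Y = Y]`. -/
def NR {A : FinGSet G} (r : A →[G] X) (n : A →[G] Y) : Bispan X Y := ⟨A, Y, r, n, .id G⟩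

/-- As in `R_comp_iso`, a trivial transfer leg leaves only the tautological section, so no
distributivity occurs and norms compose. -/
theorem NR_comp_N_iso {A : FinGSet G} (r : A →[G] X) (n : A →[G] Y) (m : Y →[G] Z) :
    Iso (NR r (m.comp n)) ((NR r n).comp (N m)) := by
  refine Iso.of_bijective (P := NR r (m.comp n)) (Q := (NR r n).comp (N m))
    { toFun := fun a => (⟨⟨m (n a), fun c => c.1, fun _ => rfl⟩, n a, rfl, a, rfl⟩ :
        LiftPt (NR r n) (N m))
      map_smul' := fun h a => LiftPt.ext' (Lift.ext' ?_ fun c _ _ => ?_) (map_smul n h a) rfl }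
    { toFun := fun d => (⟨d, fun c => c.1, fun _ => rfl⟩ : Lift (NR r n) (N m))
      map_smul' := fun h b => Lift.ext' rfl fun c _ _ => ?_ }
    ⟨fun a a' h => congrArg LiftPt.elt h, fun w => ?_⟩ ⟨fun b b' h => congrArg Lift.base h,
      fun e => ?_⟩ (fun _ => rfl) (fun _ => rfl) (fun _ => rfl)
  · exact (congrArg m (map_smul n h a)).trans (map_smul m _ _)
  · exact (smul_inv_smul h (c : Y)).symm
  · exact (smul_inv_smul h (c : Y)).symm
  · obtain ⟨⟨d, s, hs⟩, c, hc, a, ha⟩ := w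
    have h1 : n a = c := ha.trans (hs ⟨c, hc⟩)
    refine ⟨a, LiftPt.ext' (Lift.ext' ?_ fun c' _ h' => ?_) h1 rfl⟩
    · exact (congrArg m h1).trans hc
    · exact (hs ⟨c', h'⟩).symm
  · obtain ⟨d, s, hs⟩ := e
    exact ⟨d, Lift.ext' rfl fun c' _ h' => (hs ⟨c', h'⟩).symm⟩

/-- The disjoint union of two bispans. -/
def add (P Q : Bispan X Y) : Bispan X Y :=
  ⟨sum P.A Q.A, sum P.B Q.B, elim P.r Q.r, sumMap P.n Q.n, elim P.t Q.t⟩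

end Bispan

/-! ### Calculus of bispans acting on a Tambara functor -/

namespace TambaraFunctor

variable {G : Type} [Group G] (T : TambaraFunctor.{u} G) {X Y Z V W : FinGSet G}

open Bispan

theorem map_res (f : X →[G] Y) (P : Bispan X Z) (y : T.obj Y) :
    T.map P (T.res f y) = T.map ⟨P.A, P.B, f.comp P.r, P.n, P.t⟩ y := by
  rw [res, ← T.map_comp, T.map_iso (R_comp_iso f P)]

theorem tr_map (P : Bispan X Y) (g : Y →[G] Z) (x : T.obj X) :
    T.tr g (T.map P x) = T.map ⟨P.A, P.B, P.r, P.n, g.comp P.t⟩ x := by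
  rw [tr, ← T.map_comp, T.map_iso (comp_T_iso P g)]

theorem nm_map_NR {A : FinGSet G} (r : A →[G] X) (n : A →[G] Y) (m : Y →[G] Z) (x : T.obj X) :
    T.nm m (T.map (NR r n) x) = T.map (NR r (m.comp n)) x := by
  rw [nm, ← T.map_comp, T.map_iso (NR_comp_N_iso r n m)]

theorem res_map (P : Bispan X W) (f : V →[G] W) (P' : Bispan X V)
    (α : P'.A →[G] P.A) (β : P'.B →[G] P.B) (hr : ∀ a, P.r (α a) = P'.r a)
    (hn : ∀ a, P.n (α a) = β (P'.n a)) (ht : ∀ b, P.t (β b) = f (P'.t b))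
    (hB : ∀ b v, P.t b = f v → ∃! b', β b' = b ∧ P'.t b' = v)
    (hA : ∀ a b', P.n a = β b' → ∃! a', α a' = a ∧ P'.n a' = b') (x : T.obj X) :
    T.res f (T.map P x) = T.map P' x := by
  rw [res, ← T.map_comp, T.map_iso (comp_R_iso P f P' α β hr hn ht hB hA)]

theorem nm_res {A : FinGSet G} (r : A →[G] X) (n : A →[G] Y) (x : T.obj X) :
    T.nm n (T.res r x) = T.map (NR r n) x :=
  T.map_res r (N n) x

theorem res_comp (f : X →[G] Y) (g : Y →[G] Z) (z : T.obj Z) :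
    T.res (g.comp f) z = T.res f (T.res g z) :=
  (T.map_res g (R f) z).symm

theorem res_id (x : T.obj X) : T.res (.id G) x = x := T.map_id X x

/-- The disjoint union factors as a bispan into `Y ⨿ Y`, whose restrictions to the two summands are
`P` and `Q`, followed by the transfer along the fold map, which is addition. `map_NR_elim` is the
same argument with the norm along the fold map. -/
theorem map_add_bispan (P Q : Bispan X Y) (x : T.obj X) :
    T.map (P.add Q) x = T.map P x + T.map Q x := by
  let S : Bispan X (sum Y Y) :=
    ⟨sum P.A Q.A, sum P.B Q.B, elim P.r Q.r, sumMap P.n Q.n, sumMap P.t Q.t⟩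
  have h1 : Iso (P.add Q) (S.comp (Bispan.T (fold Y))) := by
    have : P.add Q = ⟨S.A, S.B, S.r, S.n, (fold Y).comp S.t⟩ := by
      unfold add
      congr 1
      ext b
      change P.B ⊕ Q.B at b
      cases b <;> rfl
    rw [this]
    exact comp_T_iso S (fold Y)
  have h2 : P.Iso (S.comp (Bispan.R (inl Y Y))) := by
    refine comp_R_iso S _ P (inl _ _) (inl _ _) (fun _ => rfl) (fun _ => rfl) (fun _ => rfl) ?_ ?_
    · rintro (b | b) v h
      · exact ⟨b, ⟨rfl, Sum.inl_injective h⟩, fun b' h' => Sum.inl_injective h'.1⟩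
      · exact absurd h Sum.inr_ne_inl
    · rintro (a | a) b h
      · exact ⟨a, ⟨rfl, Sum.inl_injective h⟩, fun b' h' => Sum.inl_injective h'.1⟩
      · exact absurd h Sum.inr_ne_inl
  have h3 : Q.Iso (S.comp (Bispan.R (inr Y Y))) := by
    refine comp_R_iso S _ Q (inr _ _) (inr _ _) (fun _ => rfl) (fun _ => rfl) (fun _ => rfl) ?_ ?_
    · rintro (b | b) v h
      · exact absurd h Sum.inl_ne_inr
      · exact ⟨b, ⟨rfl, Sum.inr_injective h⟩, fun b' h' => Sum.inr_injective h'.1⟩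
    · rintro (a | a) b h
      · exact absurd h Sum.inl_ne_inr
      · exact ⟨a, ⟨rfl, Sum.inr_injective h⟩, fun b' h' => Sum.inr_injective h'.1⟩
  rw [T.map_iso h1, T.map_comp, T.map_add, T.map_iso h2, T.map_comp, T.map_iso h3, T.map_comp]

theorem map_NR_elim {A A' : FinGSet G} (r : A →[G] X) (n : A →[G] Y) (r' : A' →[G] X)
    (n' : A' →[G] Y) (x : T.obj X) :
    T.map (NR (elim r r') (elim n n')) x = T.map (NR r n) x * T.map (NR r' n') x := by
  let S : Bispan X (sum Y Y) := NR (elim r r') (sumMap n n')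
  have h1 : Iso (NR (elim r r') (elim n n')) (S.comp (Bispan.N (fold Y))) := by
    have : elim n n' = (fold Y).comp (sumMap n n') := by
      ext b
      change A ⊕ A' at b
      cases b <;> rfl
    rw [this]
    exact NR_comp_N_iso _ _ _
  have h2 : (NR r n).Iso (S.comp (Bispan.R (inl Y Y))) := by
    refine comp_R_iso S _ (NR r n) (inl _ _) (inl _ _) (fun _ => rfl) (fun _ => rfl)
      (fun _ => rfl) ?_ ?_
    · rintro (b | b) v h
      · exact ⟨b, ⟨rfl, Sum.inl_injective h⟩, fun b' h' => Sum.inl_injective h'.1⟩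
      · exact absurd h Sum.inr_ne_inl
    · rintro (a | a) b h
      · exact ⟨a, ⟨rfl, Sum.inl_injective h⟩, fun b' h' => Sum.inl_injective h'.1⟩
      · exact absurd h Sum.inr_ne_inl
  have h3 : (NR r' n').Iso (S.comp (Bispan.R (inr Y Y))) := by
    refine comp_R_iso S _ (NR r' n') (inr _ _) (inr _ _) (fun _ => rfl) (fun _ => rfl)
      (fun _ => rfl) ?_ ?_
    · rintro (b | b) v h
      · exact absurd h Sum.inl_ne_inr
      · exact ⟨b, ⟨rfl, Sum.inr_injective h⟩, fun b' h' => Sum.inr_injective h'.1⟩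
    · rintro (a | a) b h
      · exact absurd h Sum.inl_ne_inr
      · exact ⟨a, ⟨rfl, Sum.inr_injective h⟩, fun b' h' => Sum.inr_injective h'.1⟩
  rw [T.map_iso h1, T.map_comp, T.map_mul, T.map_iso h2, T.map_comp, T.map_iso h3, T.map_comp]

theorem map_of_isEmpty (P : Bispan X Y) [IsEmpty P.B] (x : T.obj X) : T.map P x = 0 := by
  have : IsEmpty P.A := ⟨fun a => isEmptyElim (P.n a)⟩
  have h : Iso P ⟨empty G, empty G, (fromEmpty X).comp (.id G), .id G, fromEmpty Y⟩ :=
    ⟨Equiv.equivOfIsEmpty _ _, Equiv.equivOfIsEmpty _ _, fun _ a => isEmptyElim a,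
      fun _ b => isEmptyElim b, fun a => isEmptyElim a, fun a => isEmptyElim a,
      fun b => isEmptyElim b⟩
  rw [T.map_iso h]
  erw [← T.map_res (fromEmpty X) (Bispan.T (fromEmpty Y)), T.map_zero]

theorem map_NR_of_isEmpty {A : FinGSet G} [IsEmpty A] (r : A →[G] X) (n : A →[G] Y)
    (x : T.obj X) : T.map (NR r n) x = 1 := by
  have h : Iso (NR r n) ⟨empty G, Y, (fromEmpty X).comp (.id G), fromEmpty Y, .id G⟩ :=
    ⟨Equiv.equivOfIsEmpty A (empty G), Equiv.refl _, fun _ a => isEmptyElim (α := A) a,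
      fun _ b => rfl, fun a => isEmptyElim (α := A) a, fun a => isEmptyElim (α := A) a,
      fun b => rfl⟩
  rw [T.map_iso h]
  erw [← T.map_res (fromEmpty X) (Bispan.N (fromEmpty Y)), T.map_one]

end TambaraFunctor

/-! ### Restriction, transfer, norm and Frobenius reciprocity -/

namespace TambaraFunctor

variable {G : Type} [Group G] (T : TambaraFunctor.{u} G) {X Y Z V W : FinGSet G}

open Bispan

theorem exists_pair (a : T.obj X) (b : T.obj Y) :
    ∃ z : T.obj (sum X Y), T.res (inl X Y) z = a ∧ T.res (inr X Y) z = b := by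
  obtain ⟨z, hz⟩ := (T.bijective_sum X Y).2 (a, b)
  exact ⟨z, congrArg Prod.fst hz, congrArg Prod.snd hz⟩

/-- Two elements are handled as one element over a disjoint union; addition is the transfer along a
fold map, and fold maps are stable under base change. -/
theorem res_add (f : X →[G] Y) (a b : T.obj Y) : T.res f (a + b) = T.res f a + T.res f b := by
  obtain ⟨z, rfl, rfl⟩ := T.exists_pair a b
  have h : T.map (Bispan.T (fold Y)) z = T.res (inl Y Y) z + T.res (inr Y Y) z := T.map_add Y z
  rw [← h, ← res_comp, ← res_comp]
  refine Eq.trans ?_ (T.map_add_bispan (R ((inl Y Y).comp f)) (R ((inr Y Y).comp f)) z)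
  refine T.res_map _ f (add (R ((inl Y Y).comp f)) (R ((inr Y Y).comp f)))
    (sumMap f f) (sumMap f f) ?_ ?_ ?_ ?_ ?_ z
  · rintro (b | b) <;> rfl
  · rintro (b | b) <;> rfl
  · rintro (b | b) <;> rfl
  · rintro (b | b) v h
    · obtain rfl : b = f v := h
      refine ⟨(Sum.inl v : X ⊕ X), ⟨rfl, rfl⟩, ?_⟩
      rintro (b' | b') ⟨h1, h2⟩
      · exact congrArg Sum.inl h2
      · exact absurd h1 Sum.inr_ne_inl
    · obtain rfl : b = f v := h
      refine ⟨(Sum.inr v : X ⊕ X), ⟨rfl, rfl⟩, ?_⟩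
      rintro (b' | b') ⟨h1, h2⟩
      · exact absurd h1 Sum.inl_ne_inr
      · exact congrArg Sum.inr h2
  · rintro a b' h
    refine ⟨b', ⟨h.symm, ?_⟩, ?_⟩
    · revert b'
      rintro (b' | b') - <;> rfl
    · rintro (b'' | b'') ⟨h1, rfl⟩ <;> rfl

theorem res_mul (f : X →[G] Y) (a b : T.obj Y) : T.res f (a * b) = T.res f a * T.res f b := by
  obtain ⟨z, rfl, rfl⟩ := T.exists_pair a b
  have h : T.map (Bispan.N (fold Y)) z = T.res (inl Y Y) z * T.res (inr Y Y) z := T.map_mul Y z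
  rw [← h, ← res_comp, ← res_comp]
  have h' := T.map_NR_elim ((inl Y Y).comp f) (.id G) ((inr Y Y).comp f) (.id G) z
  refine Eq.trans ?_ h'
  refine T.res_map _ f (NR (elim ((inl Y Y).comp f) ((inr Y Y).comp f)) (elim (.id G) (.id G)))
    (sumMap f f) f ?_ ?_ (fun _ => rfl) ?_ ?_ z
  · rintro (b | b) <;> rfl
  · rintro (b | b) <;> rfl
  · rintro b v h
    exact ⟨v, ⟨h.symm, rfl⟩, fun _ h => h.2⟩
  · rintro (b | b) v h
    · obtain rfl : b = f v := h
      refine ⟨(Sum.inl v : X ⊕ X), ⟨rfl, rfl⟩, ?_⟩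
      rintro (b' | b') ⟨h1, h2⟩
      · exact congrArg Sum.inl h2
      · exact absurd h1 Sum.inr_ne_inl
    · obtain rfl : b = f v := h
      refine ⟨(Sum.inr v : X ⊕ X), ⟨rfl, rfl⟩, ?_⟩
      rintro (b' | b') ⟨h1, h2⟩
      · exact absurd h1 Sum.inl_ne_inr
      · exact congrArg Sum.inr h2

theorem res_zero (f : X →[G] Y) : T.res f 0 = 0 :=
  T.map_zero_of_surjective _ Function.surjective_id

theorem res_one (f : X →[G] Y) : T.res f 1 = 1 := by
  obtain ⟨z⟩ := T.nonempty_empty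
  rw [← T.map_one Y z, ← T.map_NR_of_isEmpty (.id G) (fromEmpty X) z]
  refine T.res_map _ f (NR (.id G) (fromEmpty X)) (.id G) f (fun _ => rfl)
    (fun a => isEmptyElim (α := empty G) a) (fun _ => rfl) ?_ ?_ z
  · rintro b v h
    exact ⟨v, ⟨h.symm, rfl⟩, fun _ h => h.2⟩
  · intro a
    exact isEmptyElim (α := empty G) a

/-- Restriction as a ring homomorphism. -/
def resHom (f : X →[G] Y) : T.obj Y →+* T.obj X where
  toFun := T.res f
  map_one' := T.res_one f
  map_mul' := T.res_mul f
  map_zero' := T.res_zero f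
  map_add' := T.res_add f

theorem resHom_apply (f : X →[G] Y) (y : T.obj Y) : T.resHom f y = T.res f y := rfl

theorem tr_zero (f : X →[G] Y) : T.tr f 0 = 0 :=
  T.map_zero_of_surjective _ Function.surjective_id

theorem tr_add (f : X →[G] Y) (a b : T.obj X) : T.tr f (a + b) = T.tr f a + T.tr f b := by
  obtain ⟨z, rfl, rfl⟩ := T.exists_pair a b
  have h : T.map (Bispan.T (fold X)) z = T.res (inl X X) z + T.res (inr X X) z := T.map_add X z
  rw [← h, tr_map]
  refine Eq.trans ?_ (congrArg₂ (· + ·) (T.map_res (inl X X) (Bispan.T f) z)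
    (T.map_res (inr X X) (Bispan.T f) z)).symm
  refine Eq.trans ?_ (T.map_add_bispan _ _ z)
  congr 1
  unfold add
  congr 1 <;>
  · ext b
    change X ⊕ X at b
    cases b <;> rfl

/-- Transfer as an additive homomorphism. -/
def trHom (f : X →[G] Y) : T.obj X →+ T.obj Y where
  toFun := T.tr f
  map_zero' := T.tr_zero f
  map_add' := T.tr_add f

theorem nm_one (f : X →[G] Y) : T.nm f 1 = 1 := by
  obtain ⟨z⟩ := T.nonempty_empty
  rw [← T.map_one X z]
  exact (T.nm_map_NR (.id G) (fromEmpty X) f z).trans (T.map_NR_of_isEmpty _ _ z)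

theorem nm_mul (f : X →[G] Y) (a b : T.obj X) : T.nm f (a * b) = T.nm f a * T.nm f b := by
  obtain ⟨z, rfl, rfl⟩ := T.exists_pair a b
  have h : T.map (Bispan.N (fold X)) z = T.res (inl X X) z * T.res (inr X X) z := T.map_mul X z
  rw [← h, nm_res, nm_res, ← map_NR_elim]
  refine (T.nm_map_NR (.id G) (fold X) f z).trans ?_
  congr 2 <;>
  · ext b
    change X ⊕ X at b
    cases b <;> rfl

/-- Frobenius reciprocity. With `a` and `b` combined into one element over `X ⨿ Y`, both sides are
the action of the bispan `X ⨿ Y ← X ⨿ X → X → Y`. -/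
theorem tr_mul_res (f : X →[G] Y) (a : T.obj X) (b : T.obj Y) :
    T.tr f (a * T.res f b) = T.tr f a * b := by
  obtain ⟨z, rfl, rfl⟩ := T.exists_pair a b
  have h1 : T.tr f (T.res (inl X Y) z * T.res f (T.res (inr X Y) z)) =
      T.map ⟨sum X X, X, elim (inl X Y) ((inr X Y).comp f), elim (.id G) (.id G), f⟩ z := by
    rw [← res_comp, res, res]
    refine (congrArg (T.tr f) (T.map_NR_elim (inl X Y) (.id G) ((inr X Y).comp f) (.id G)
      z).symm).trans ?_
    exact T.tr_map _ f z
  -- Transferring along `f ⨿ id` and then multiplying along the fold map computes the right-hand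
  -- side.
  let S : Bispan (sum X Y) (sum Y Y) := Bispan.T (sumMap f (.id G))
  have h2 : T.tr f (T.res (inl X Y) z) = T.res (inl Y Y) (T.map S z) := by
    rw [tr, map_res]
    refine (T.res_map S _ _ (inl _ _) (inl _ _) (fun _ => rfl) (fun _ => rfl) (fun _ => rfl)
      ?_ ?_ z).symm
    · rintro (b | b) v h
      · exact ⟨b, ⟨rfl, Sum.inl_injective h⟩, fun b' h' => Sum.inl_injective h'.1⟩
      · exact absurd h Sum.inr_ne_inl
    · rintro a b h
      exact ⟨b, ⟨h.symm, rfl⟩, fun _ h => h.2⟩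
  have h3 : T.res (inr X Y) z = T.res (inr Y Y) (T.map S z) := by
    refine (T.res_map S _ (R (inr X Y)) (inr _ _) (inr _ _) (fun _ => rfl) (fun _ => rfl)
      (fun _ => rfl) ?_ ?_ z).symm
    · rintro (b | b) v h
      · exact absurd h Sum.inl_ne_inr
      · exact ⟨b, ⟨rfl, Sum.inr_injective h⟩, fun b' h' => Sum.inr_injective h'.1⟩
    · rintro a b h
      exact ⟨b, ⟨h.symm, rfl⟩, fun _ h => h.2⟩
  rw [h1, h2, h3]
  refine Eq.trans ?_ (T.map_mul Y (T.map S z))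
  rw [← T.map_comp]
  refine congrFun (T.map_iso ?_) z
  -- Lifts are parametrised by `X`: over `f x` the section takes the value `x` on the left copy of
  -- `f x`, and on the right copy its only possible value. On the points over these lifts, `κ` gives
  -- the point of the fibre, `ε` its value and `ν` the lift.
  let σ : X → Lift S (Bispan.N (fold Y)) := fun x =>
    ⟨f x, fun c => Sum.elim (fun _ => (Sum.inl x : X ⊕ Y)) (fun y => Sum.inr y) c.1, by
      rintro ⟨c | c, hc⟩
      · exact congrArg (Sum.inl (β := Y)) (show f x = c from (hc : c = f x).symm)
      · rfl⟩
  let κ : X ⊕ X → Y ⊕ Y := Sum.map f f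
  let ε : X ⊕ X → X ⊕ Y := Sum.elim Sum.inl fun x => Sum.inr (f x)
  let ν : X ⊕ X → X := Sum.elim _root_.id _root_.id
  have hσ : ∀ (g : G) x, σ (g • x) = g • σ x := by
    intro g x
    refine Lift.ext' (map_smul f g x) ?_
    rintro (c | c) hc hc'
    · rfl
    · exact congrArg (Sum.inr (α := X)) (smul_inv_smul g c).symm
  have hν : ∀ (g : G) x, ν (g • x) = g • ν x := by
    rintro g (x | x) <;> rfl
  have hκ : ∀ x, (Bispan.N (fold Y)).n (κ x) = (σ (ν x)).base := by
    rintro (x | x) <;> rfl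
  have hε : ∀ x, S.n (ε x) = (σ (ν x)).sec ⟨κ x, hκ x⟩ := by
    rintro (x | x) <;> rfl
  have hsurj : Function.Surjective σ := by
    rintro ⟨d, s, hs⟩
    have h1 : ∀ a : X ⊕ Y, S.t a = (Sum.inl d : Y ⊕ Y) → ∃ x : X, a = Sum.inl x ∧ f x = d := by
      rintro (a | a) h
      · exact ⟨a, rfl, Sum.inl_injective h⟩
      · exact absurd h Sum.inr_ne_inl
    have h2 : ∀ a : X ⊕ Y, S.t a = (Sum.inr d : Y ⊕ Y) → a = Sum.inr d := by
      rintro (a | a) h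
      · exact absurd h Sum.inl_ne_inr
      · exact congrArg Sum.inr (Sum.inr_injective h)
    obtain ⟨x, hx, hd⟩ := h1 (s ⟨(Sum.inl d : Y ⊕ Y), rfl⟩) (hs _)
    refine ⟨x, Lift.ext' hd ?_⟩
    rintro (c | c) hc (hc' : c = d)
    · subst hc'
      exact hx.symm
    · subst hc'
      exact (h2 (s ⟨(Sum.inr c : Y ⊕ Y), rfl⟩) (hs _)).symm
  refine Iso.of_bijective (Q := S.comp (Bispan.N (fold Y)))
    { toFun := fun x : X ⊕ X => (⟨σ (ν x), κ x, hκ x, ε x, hε x⟩ : LiftPt S (Bispan.N (fold Y)))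
      map_smul' := fun g x => LiftPt.ext' ((congrArg σ (hν g x)).trans (hσ g (ν x))) ?_ ?_ }
    { toFun := σ
      map_smul' := hσ }
    ⟨fun a a' h => ?_, fun w => ?_⟩ ⟨fun x x' h => ?_, fun e => ?_⟩
    ?_ ?_ (fun _ => rfl)
  · revert x
    rintro (x | x)
    · exact congrArg (Sum.inl (β := Y)) (map_smul f g x)
    · exact congrArg (Sum.inr (α := Y)) (map_smul f g x)
  · revert x
    rintro (x | x)
    · rfl
    · exact congrArg (Sum.inr (α := X)) (map_smul f g x)
  · have h1 : σ (ν a) = σ (ν a') := congrArg LiftPt.lift h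
    have h2 : κ a = κ a' := congrArg LiftPt.pt h
    have h4 : ν a = ν a' := Sum.inl_injective (Lift.sec_eq h1 (Sum.inl (f (ν a))) rfl
      (congrArg Lift.base h1))
    revert a a'
    rintro (a | a) (a' | a') _ _ h2 h4
    · exact congrArg Sum.inl h4
    · exact absurd h2 Sum.inl_ne_inr
    · exact absurd h2 Sum.inr_ne_inl
    · exact congrArg Sum.inr h4
  · obtain ⟨e, c, hc, a, ha⟩ := w
    obtain ⟨x, rfl⟩ := hsurj e
    change X ⊕ Y at a
    change Y ⊕ Y at c
    rcases c with c | c <;> rcases a with a | a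
    · obtain rfl : a = x := Sum.inl_injective ha
      obtain rfl : c = f a := hc
      exact ⟨Sum.inl a, rfl⟩
    · exact absurd ha Sum.inr_ne_inl
    · exact absurd ha Sum.inl_ne_inr
    · obtain rfl : a = c := Sum.inr_injective ha
      obtain rfl : a = f x := hc
      exact ⟨Sum.inr x, rfl⟩
  · exact Sum.inl_injective (Lift.sec_eq h (Sum.inl (f x)) rfl (congrArg Lift.base h))
  · exact hsurj e
  · rintro (x | x) <;> rfl
  · rintro (x | x) <;> rfl

end TambaraFunctor

/-! ### Splitting bispans, and restriction to `G/e` -/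

namespace FinGSet

variable {G : Type} [Group G]

noncomputable instance (X : FinGSet G) (p : X → Prop) : Fintype {x : X // p x} := Fintype.ofFinite _

/-- The inclusion between invariant subsets. -/
def subMap (X : FinGSet G) {p q : X → Prop} (hp : ∀ (g : G) (x : X), p x → p (g • x))
    (hq : ∀ (g : G) (x : X), q x → q (g • x)) (h : ∀ x, p x → q x) : sub X p hp →[G] sub X q hq where
  toFun x := (⟨Subtype.val (p := p) x, h _ (Subtype.prop (p := p) x)⟩ : {x : X // q x})
  map_smul' _ _ := rfl

theorem bijective_elim_subMap (X : FinGSet G) {p q r : X → Prop}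
    (hp : ∀ (g : G) (x : X), p x → p (g • x)) (hq : ∀ (g : G) (x : X), q x → q (g • x))
    (hr : ∀ (g : G) (x : X), r x → r (g • x)) (hpr : ∀ x, p x → r x) (hqr : ∀ x, q x → r x)
    (hd : ∀ x, p x → ¬ q x) (hu : ∀ x, r x → p x ∨ q x) :
    Function.Bijective (elim (subMap X hp hr hpr) (subMap X hq hr hqr)) := by
  constructor
  · rintro (⟨a, ha⟩ | ⟨a, ha⟩) (⟨b, hb⟩ | ⟨b, hb⟩) h
    · obtain rfl : a = b := congrArg (Subtype.val (p := r)) h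
      rfl
    · obtain rfl : a = b := congrArg (Subtype.val (p := r)) h
      exact absurd hb (hd _ ha)
    · obtain rfl : a = b := congrArg (Subtype.val (p := r)) h
      exact absurd ha (hd _ hb)
    · obtain rfl : a = b := congrArg (Subtype.val (p := r)) h
      rfl
  · rintro ⟨x, hx⟩
    rcases hu x hx with h | h
    · exact ⟨Sum.inl ⟨x, h⟩, rfl⟩
    · exact ⟨Sum.inr ⟨x, h⟩, rfl⟩

/-- The product of `X` with a finite set on which `G` acts trivially. -/
def copies (X : FinGSet G) (ι : Type) [Finite ι] : FinGSet G :=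
  letI : MulAction G (X × ι) :=
    { smul := fun g x => (g • x.1, x.2)
      one_smul := fun x => Prod.ext (one_smul G x.1) rfl
      mul_smul := fun g h x => Prod.ext (mul_smul g h x.1) rfl }
  ⟨X × ι⟩

/-- The map out of `X × ι` with given restrictions to the copies of `X`. -/
def ofCopies {X Y : FinGSet G} {ι : Type} [Finite ι] (f : ι → X →[G] Y) : copies X ι →[G] Y where
  toFun z := f (Prod.snd (α := X) z) (Prod.fst (β := ι) z)
  map_smul' g z := map_smul (f (Prod.snd (α := X) z)) g (Prod.fst (β := ι) z)

variable [Finite G]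

/-- The equivariant map `G/e → X` sending the identity coset to `x`. -/
def ptMap {X : FinGSet G} (x : X) : orbit (⊥ : Subgroup G) →[G] X where
  toFun := Quotient.lift (s := QuotientGroup.leftRel (⊥ : Subgroup G)) (fun g : G => g • x) (by
    intro a b hab
    have h : a⁻¹ * b = 1 := QuotientGroup.leftRel_apply.mp hab
    rw [inv_mul_eq_one.mp h])
  map_smul' g y := by
    change G ⧸ (⊥ : Subgroup G) at y
    induction y using QuotientGroup.induction_on with
    | H y => exact mul_smul g y x

/-- The identity coset. -/
def base (H : Subgroup G) : orbit H := ((1 : G) : G ⧸ H)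

theorem ptMap_base {X : FinGSet G} (x : X) : ptMap x (base ⊥) = x := one_smul G x

theorem exists_smul_base {H : Subgroup G} (y : orbit H) : ∃ g : G, g • base H = y := by
  change G ⧸ H at y
  induction y using QuotientGroup.induction_on with
  | H y => exact ⟨y, congrArg (QuotientGroup.mk (s := H)) (mul_one y)⟩

theorem hom_ext {H : Subgroup G} {X : FinGSet G} {f f' : orbit H →[G] X}
    (h : f (base H) = f' (base H)) : f = f' := by
  ext y
  obtain ⟨g, rfl⟩ := exists_smul_base y
  rw [map_smul, map_smul, h]

theorem comp_ptMap {X Y : FinGSet G} (f : X →[G] Y) (x : X) : f.comp (ptMap x) = ptMap (f x) :=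
  hom_ext ((congrArg f (ptMap_base x)).trans (ptMap_base (f x)).symm)

theorem eq_ptMap {X : FinGSet G} (f : orbit (⊥ : Subgroup G) →[G] X) : f = ptMap (f (base ⊥)) :=
  hom_ext (ptMap_base _).symm

theorem smul_base_injective {g h : G} (e : g • base (⊥ : Subgroup G) = h • base ⊥) : g = h := by
  have e' : ((g * 1 : G) : G ⧸ (⊥ : Subgroup G)) = ((h * 1 : G) : G ⧸ (⊥ : Subgroup G)) := e
  have := QuotientGroup.eq.mp e'
  rw [mul_one, mul_one] at this
  exact inv_mul_eq_one.mp this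

end FinGSet

namespace Bispan

variable {G : Type} [Group G] {X Y : FinGSet G}

/-- The part of a bispan lying over an invariant subset of the middle right set. -/
def restrict (P : Bispan X Y) (p : P.B → Prop) (hp : ∀ (g : G) (b : P.B), p b → p (g • b)) :
    Bispan X Y where
  A := sub P.A (fun a => p (P.n a)) fun g a h => by
    rw [map_smul]
    exact hp g _ h
  B := sub P.B p hp
  r := P.r.comp (subIncl _ _ _)
  n :=
    { toFun := fun a => (⟨P.n (Subtype.val (p := fun a => p (P.n a)) a),
        Subtype.prop (p := fun a => p (P.n a)) a⟩ : {b : P.B // p b})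
      map_smul' := fun g a => Subtype.ext (map_smul P.n g _) }
  t := P.t.comp (subIncl _ _ _)

theorem add_restrict_iso (P : Bispan X Y) {p q r : P.B → Prop}
    (hp : ∀ (g : G) (x : P.B), p x → p (g • x)) (hq : ∀ (g : G) (x : P.B), q x → q (g • x))
    (hr : ∀ (g : G) (x : P.B), r x → r (g • x)) (hpr : ∀ x, p x → r x) (hqr : ∀ x, q x → r x)
    (hd : ∀ x, p x → ¬ q x) (hu : ∀ x, r x → p x ∨ q x) :
    ((P.restrict p hp).add (P.restrict q hq)).Iso (P.restrict r hr) := by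
  have hP : ∀ {p : P.B → Prop}, (∀ (g : G) b, p b → p (g • b)) →
      ∀ (g : G) a, p (P.n a) → p (P.n (g • a)) := fun h g a ha => by
    rw [map_smul]
    exact h g _ ha
  refine Iso.of_bijective (P := (P.restrict p hp).add (P.restrict q hq))
    (elim (subMap P.A (hP hp) (hP hr) fun _ => hpr _) (subMap P.A (hP hq) (hP hr) fun _ => hqr _))
    (elim (subMap P.B hp hr hpr) (subMap P.B hq hr hqr))
    (bijective_elim_subMap _ (hP hp) (hP hq) (hP hr) _ _ (fun _ => hd _) (fun _ => hu _))
    (bijective_elim_subMap _ hp hq hr _ _ hd hu) ?_ ?_ ?_ <;>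
  rintro (_ | _) <;> rfl

end Bispan

namespace TambaraFunctor

variable {G : Type} [Group G] (T : TambaraFunctor.{u} G) {X Y Z V W : FinGSet G}

open Bispan

/-- An invariant colouring splits the middle set into a disjoint union, and disjoint unions act as
sums; the induction adds one colour at a time. -/
theorem map_eq_sum (P : Bispan X Y) {ι : Type} [Fintype ι] (c : P.B → ι)
    (hc : ∀ (g : G) b, c (g • b) = c b) (x : T.obj X) :
    T.map P x = ∑ i, T.map (P.restrict (fun b => c b = i) fun g b h => (hc g b).trans h) x := by
  classical
  have key : ∀ s : Finset ι, T.map (P.restrict (fun b => c b ∈ s) fun g b h => by rwa [hc]) x =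
      ∑ i ∈ s, T.map (P.restrict (fun b => c b = i) fun g b h => (hc g b).trans h) x := by
    intro s
    induction s using Finset.induction_on with
    | empty =>
      have : IsEmpty (P.restrict (fun b => c b ∈ (∅ : Finset ι)) fun g b h => by rwa [hc]).B :=
        ⟨fun b => absurd (Subtype.prop (p := fun b => c b ∈ (∅ : Finset ι)) b)
          (Finset.notMem_empty _)⟩
      rw [T.map_of_isEmpty, Finset.sum_empty]
    | insert i s hi ih =>
      rw [Finset.sum_insert hi, ← ih, ← map_add_bispan]
      refine congrFun (T.map_iso (add_restrict_iso P _ _ _ ?_ ?_ ?_ ?_)) x |>.symm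
      · rintro b rfl
        exact Finset.mem_insert_self _ _
      · exact fun b h => Finset.mem_insert_of_mem h
      · rintro b rfl h
        exact hi h
      · exact fun b h => Finset.mem_insert.mp h
  rw [← key]
  refine congrFun (T.map_iso (Iso.of_bijective
    (P := P.restrict (fun b => c b ∈ Finset.univ) fun g b h => by rwa [hc])
    (subIncl _ _ _) (subIncl _ _ _) ?_ ?_
    (fun _ => rfl) (fun _ => rfl) (fun _ => rfl))) x |>.symm
  · exact ⟨Subtype.val_injective, fun a => ⟨⟨a, Finset.mem_univ _⟩, rfl⟩⟩
  · exact ⟨Subtype.val_injective, fun a => ⟨⟨a, Finset.mem_univ _⟩, rfl⟩⟩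

theorem map_NR_eq_prod {A : FinGSet G} (r : A →[G] X) (n : A →[G] Y) {ι : Type} [Fintype ι]
    (c : A → ι) (hc : ∀ (g : G) b, c (g • b) = c b) (x : T.obj X) :
    T.map (NR r n) x = ∏ i, T.map (NR
      (r.comp (subIncl A (fun a => c a = i) fun g b h => (hc g b).trans h))
      (n.comp (subIncl A (fun a => c a = i) fun g b h => (hc g b).trans h))) x := by
  classical
  have hs : ∀ s : Finset ι, ∀ (g : G) a, c a ∈ s → c (g • a) ∈ s := fun s g a h => by rwa [hc]
  have key : ∀ s : Finset ι, T.map (NR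
      (r.comp (subIncl A (fun a => c a ∈ s) (hs s)))
      (n.comp (subIncl A (fun a => c a ∈ s) (hs s)))) x =
      ∏ i ∈ s, T.map (NR
      (r.comp (subIncl A (fun a => c a = i) fun g b h => (hc g b).trans h))
      (n.comp (subIncl A (fun a => c a = i) fun g b h => (hc g b).trans h))) x := by
    intro s
    induction s using Finset.induction_on with
    | empty =>
      have : IsEmpty (sub A (fun a => c a ∈ (∅ : Finset ι)) (hs ∅)) :=
        ⟨fun b => absurd (Subtype.prop (p := fun b => c b ∈ (∅ : Finset ι)) b)
          (Finset.notMem_empty _)⟩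
      rw [T.map_NR_of_isEmpty, Finset.prod_empty]
    | insert i s hi ih =>
      rw [Finset.prod_insert hi, ← ih, ← map_NR_elim]
      have h1 : ∀ b, c b = i → c b ∈ insert i s := by
        rintro b rfl
        exact Finset.mem_insert_self _ _
      have h2 : ∀ b, c b ∈ s → c b ∈ insert i s := fun b h => Finset.mem_insert_of_mem h
      have h3 : ∀ b, c b = i → ¬ c b ∈ s := by
        rintro b rfl h
        exact hi h
      have hi' : ∀ (g : G) a, c a = i → c (g • a) = i := fun g a h => (hc g a).trans h
      refine congrFun (T.map_iso (Iso.of_bijective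
        (P := NR (elim (r.comp (subIncl A _ hi')) (r.comp (subIncl A _ (hs s))))
          (elim (n.comp (subIncl A _ hi')) (n.comp (subIncl A _ (hs s)))))
        (Q := NR (r.comp (subIncl A _ (hs (insert i s)))) (n.comp (subIncl A _ (hs (insert i s)))))
        (elim (subMap A hi' (hs _) h1) (subMap A (hs s) (hs _) h2)) (.id G)
        (bijective_elim_subMap A hi' (hs s) (hs _) h1 h2 h3 fun b h => Finset.mem_insert.mp h)
        Function.bijective_id ?_ ?_ fun _ => rfl)) x |>.symm
      · rintro (_ | _) <;> rfl
      · rintro (_ | _) <;> rfl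
  rw [← key]
  refine congrFun (T.map_iso (Iso.of_bijective
    (P := NR (r.comp (subIncl A _ (hs Finset.univ))) (n.comp (subIncl A _ (hs Finset.univ))))
    (Q := NR r n) (subIncl _ _ _) (.id G) ?_ Function.bijective_id
    (fun _ => rfl) (fun _ => rfl) (fun _ => rfl))) x |>.symm
  exact ⟨Subtype.val_injective, fun a => ⟨⟨a, Finset.mem_univ _⟩, rfl⟩⟩

variable [Finite G]

/-- The double coset formula for `G/e`. Over the free orbit `G/e` every equivariant family is a
product with its fibre, so the pulled back bispan consists of trivial copies of `G/e`, and such a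
bispan acts by sums of products. -/
theorem res_ptMap_map (P : Bispan X Y) (y : Y) (x : T.obj X) :
    T.res (ptMap y) (T.map P x) =
      ∑ b : {b : P.B // P.t b = y}, ∏ a : {a : P.A // P.n a = b.1}, T.res (ptMap (P.r a.1)) x := by
  classical
  -- The pullback of `P` along `ptMap y`, trivialised by `(g, b) ↦ g • b`.
  let P' : Bispan X (orbit (⊥ : Subgroup G)) :=
    { A := copies (orbit ⊥) {a : P.A // P.t (P.n a) = y}
      B := copies (orbit ⊥) {b : P.B // P.t b = y}
      r := ofCopies fun a => ptMap (P.r a.1)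
      n :=
        { toFun := fun z : orbit ⊥ × {a : P.A // P.t (P.n a) = y} =>
            ((z.1, ⟨P.n z.2.1, z.2.2⟩) : orbit ⊥ × {b : P.B // P.t b = y})
          map_smul' := fun _ _ => rfl }
      t := ofCopies fun _ => .id G }
  have h1 : T.res (ptMap y) (T.map P x) = T.map P' x := by
    refine T.res_map P (ptMap y) P' (ofCopies fun a => ptMap a.1) (ofCopies fun b => ptMap b.1)
      ?_ ?_ ?_ ?_ ?_ x
    · rintro ⟨v, a, ha⟩
      exact DFunLike.congr_fun (comp_ptMap P.r a) v
    · rintro ⟨v, a, ha⟩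
      exact DFunLike.congr_fun (comp_ptMap P.n a) v
    · rintro ⟨v, b, hb⟩
      exact (DFunLike.congr_fun (comp_ptMap P.t b) v).trans (by rw [hb]; rfl)
    · rintro b v hv
      obtain ⟨g, rfl⟩ := exists_smul_base v
      rw [map_smul, ptMap_base] at hv
      have hb : P.t (g⁻¹ • b) = y := by rw [map_smul, hv, inv_smul_smul]
      refine ⟨((g • base ⊥, ⟨g⁻¹ • b, hb⟩) : orbit ⊥ × {b : P.B // P.t b = y}), ⟨?_, rfl⟩, ?_⟩
      · exact (map_smul (ptMap (g⁻¹ • b)) g (base ⊥)).trans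
          (by rw [ptMap_base, smul_inv_smul])
      · rintro ⟨v, b', hb'⟩ ⟨h1, h2⟩
        obtain rfl : v = g • base ⊥ := h2
        have h3 : ptMap b' (g • base ⊥) = b := h1
        rw [map_smul, ptMap_base] at h3
        subst h3
        refine Prod.ext rfl (Subtype.ext ?_)
        exact (inv_smul_smul g b').symm
    · rintro a ⟨v, b, hb⟩ h
      obtain ⟨g, rfl⟩ := exists_smul_base v
      have h : P.n a = ptMap b (g • base ⊥) := h
      rw [map_smul, ptMap_base] at h
      have hb' : P.n (g⁻¹ • a) = b := by rw [map_smul, h, inv_smul_smul]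
      refine ⟨((g • base ⊥, ⟨g⁻¹ • a, by rw [hb', hb]⟩) :
        orbit ⊥ × {a : P.A // P.t (P.n a) = y}), ⟨?_, ?_⟩, ?_⟩
      · exact (map_smul (ptMap (g⁻¹ • a)) g (base ⊥)).trans
          (by rw [ptMap_base, smul_inv_smul])
      · exact Prod.ext rfl (Subtype.ext hb')
      · rintro ⟨v, a', ha'⟩ ⟨h1, h2⟩
        obtain rfl : v = g • base ⊥ := congrArg (Prod.fst (β := {b : P.B // P.t b = y})) h2
        have h3 : ptMap a' (g • base ⊥) = a := h1
        rw [map_smul, ptMap_base] at h3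
        subst h3
        refine Prod.ext rfl (Subtype.ext ?_)
        exact (inv_smul_smul g a').symm
  -- The second coordinate is invariant, so it splits the middle set into its copies of `G/e`;
  -- below, the same is done for the norm leg.
  rw [h1, T.map_eq_sum P' (fun z => Prod.snd (α := orbit (⊥ : Subgroup G)) z) fun _ _ => rfl]
  refine Finset.sum_congr rfl fun b _ => ?_
  have h2 : (NR (ofCopies fun a : {a : P.A // P.n a = b.1} => ptMap (P.r a.1))
      (ofCopies fun a => .id G)).Iso (P'.restrict (fun z => Prod.snd z = b) fun _ _ h => h) := by
    refine Iso.of_bijective (P := NR (ofCopies fun a : {a : P.A // P.n a = b.1} => ptMap (P.r a.1))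
      (ofCopies fun a => .id G)) (Q := P'.restrict (fun z => Prod.snd z = b) fun _ _ h => h)
      { toFun := fun z => (⟨((Prod.fst z, ⟨(Prod.snd z).1, by rw [(Prod.snd z).2, b.2]⟩) :
          orbit ⊥ × {a : P.A // P.t (P.n a) = y}), Subtype.ext (Prod.snd z).2⟩ :
            {z : orbit ⊥ × {a : P.A // P.t (P.n a) = y} // Prod.snd (P'.n z) = b})
        map_smul' := fun _ _ => rfl }
      { toFun := fun v => (⟨(v, b), rfl⟩ : {z : orbit ⊥ × {b : P.B // P.t b = y} // z.2 = b})
        map_smul' := fun _ _ => rfl } ⟨?_, ?_⟩ ⟨?_, ?_⟩ (fun _ => rfl) ?_ (fun _ => rfl)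
    · rintro ⟨v, a, ha⟩ ⟨v', a', ha'⟩ h
      have h0 := congrArg (Subtype.val (p := fun z : orbit (⊥ : Subgroup G) ×
        {a : P.A // P.t (P.n a) = y} => Prod.snd (P'.n z) = b)) h
      obtain rfl : v = v' := congrArg Prod.fst h0
      obtain rfl : a = a' := congrArg (fun z => z.2.1) h0
      rfl
    · rintro ⟨⟨v, a, ha⟩, h⟩
      exact ⟨(v, ⟨a, congrArg Subtype.val h⟩), rfl⟩
    · intro v v' h
      exact congrArg (fun z => (Subtype.val (p := fun z : orbit (⊥ : Subgroup G) ×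
        {b : P.B // P.t b = y} => z.2 = b) z).1) h
    · rintro ⟨⟨v, b'⟩, rfl⟩
      exact ⟨v, rfl⟩
    · rintro ⟨v, a, ha⟩
      exact Subtype.ext (Prod.ext rfl (Subtype.ext ha))
  rw [← T.map_iso h2, T.map_NR_eq_prod _ _ (fun z => Prod.snd (α := orbit (⊥ : Subgroup G)) z)
    fun _ _ => rfl]
  refine Finset.prod_congr rfl fun a _ => ?_
  let κ := {a : P.A // P.n a = b.1}
  let r : copies (orbit (⊥ : Subgroup G)) κ →[G] X := ofCopies fun a => ptMap (P.r a.1)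
  let n : copies (orbit (⊥ : Subgroup G)) κ →[G] orbit ⊥ := ofCopies fun _ => .id G
  let i : sub (copies (orbit (⊥ : Subgroup G)) κ)
    (fun z => Prod.snd (α := orbit (⊥ : Subgroup G)) z = a) (fun _ _ h => h) →[G] _ :=
    subIncl _ _ _
  refine (congrFun (T.map_iso (Iso.of_bijective (P := R (ptMap (P.r a.1)))
    (Q := NR (r.comp i) (n.comp i))
    { toFun := fun v => (⟨(v, a), rfl⟩ : {z : orbit (⊥ : Subgroup G) × κ // z.2 = a})
      map_smul' := fun _ _ => rfl } (.id G) ⟨fun v v' h => ?_, ?_⟩ Function.bijective_id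
    (fun _ => rfl) (fun _ => rfl) (fun _ => rfl))) x).symm
  · exact congrArg (fun z => (Subtype.val (p := fun z : orbit (⊥ : Subgroup G) × κ => z.2 = a) z).1)
      h
  · rintro ⟨⟨v, a'⟩, rfl⟩
    exact ⟨v, rfl⟩

end TambaraFunctor

/-! ### Fixed points and orbit representatives -/

namespace FinGSet

variable {G : Type} [Group G]

/-- The points fixed by all of `G`. -/
def IsFixed {X : FinGSet G} (x : X) : Prop := ∀ g : G, g • x = x

theorem IsFixed.map {X Y : FinGSet G} (f : X →[G] Y) {x : X} (h : IsFixed x) : IsFixed (f x) :=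
  fun g => by rw [← map_smul, h g]

theorem IsFixed.of_map {X Y : FinGSet G} (f : X →[G] Y) (hf : Function.Injective f) {x : X}
    (h : IsFixed (f x)) : IsFixed x := fun g => hf (by rw [map_smul, h g])

theorem IsFixed.of_smul {X : FinGSet G} {g : G} {x : X} (h : IsFixed (g • x)) : IsFixed x := by
  have : x = g • x := by
    have := h g⁻¹
    rwa [inv_smul_smul] at this
  rw [this]
  exact h

/-- The stabiliser is a proper subgroup, hence trivial: the action is free away from the fixed
points. -/
theorem eq_one_of_not_isFixed (hS : ∀ H : Subgroup G, H = ⊥ ∨ H = ⊤) {X : FinGSet G} {x : X}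
    (hx : ¬ IsFixed x) {g : G} (h : g • x = x) : g = 1 := by
  rcases hS (MulAction.stabilizer G x) with h' | h'
  · have : g ∈ MulAction.stabilizer G x := h
    rwa [h', Subgroup.mem_bot] at this
  · refine absurd (fun k => ?_) hx
    have : k ∈ MulAction.stabilizer G x := h' ▸ Subgroup.mem_top k
    exact this

/-- The chosen point of the orbit of `x`. -/
noncomputable def orbRep {X : FinGSet G} (x : X) : X :=
  (Quotient.mk (MulAction.orbitRel G X) x).out

theorem exists_smul_orbRep {X : FinGSet G} (x : X) : ∃ g : G, g • orbRep x = x := by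
  have h : MulAction.orbitRel G X (orbRep x) x :=
    Quotient.exact (s := MulAction.orbitRel G X) (Quotient.out_eq _)
  obtain ⟨g, hg⟩ := MulAction.orbitRel_apply.mp h
  exact ⟨g⁻¹, by rw [← hg]; exact inv_smul_smul g x⟩

theorem orbRep_smul {X : FinGSet G} (g : G) (x : X) : orbRep (g • x) = orbRep x :=
  congrArg Quotient.out (Quotient.sound (s := MulAction.orbitRel G X)
    (MulAction.orbitRel_apply.mpr ⟨g, rfl⟩))

theorem orbRep_orbRep {X : FinGSet G} (x : X) : orbRep (orbRep x) = orbRep x := by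
  obtain ⟨g, hg⟩ := exists_smul_orbRep x
  conv_rhs => rw [← hg]
  rw [orbRep_smul]

theorem IsFixed.orbRep_eq {X : FinGSet G} {x : X} (h : IsFixed x) : orbRep x = x := by
  obtain ⟨g, hg⟩ := exists_smul_orbRep x
  have := h g⁻¹
  rw [← hg, inv_smul_smul] at this
  rw [this, hg]

theorem exists_smul_of_orbRep_eq {X : FinGSet G} {x y : X} (h : orbRep x = orbRep y) :
    ∃ g : G, g • x = y := by
  obtain ⟨g, hg⟩ := exists_smul_orbRep x
  obtain ⟨k, hk⟩ := exists_smul_orbRep y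
  refine ⟨k * g⁻¹, ?_⟩
  rw [← hk, ← h]
  conv_lhs => rw [← hg]
  rw [mul_smul, inv_smul_smul]

variable [Finite G]

instance : Subsingleton (orbit (⊤ : Subgroup G)) :=
  QuotientGroup.subsingleton_quotient_top

/-- The unique equivariant map to the one-point set `G/G`. -/
def toTop (X : FinGSet G) : X →[G] orbit (⊤ : Subgroup G) where
  toFun _ := base ⊤
  map_smul' _ _ := Subsingleton.elim _ _

theorem eq_toTop {X : FinGSet G} (f : X →[G] orbit (⊤ : Subgroup G)) : f = toTop X := by
  ext x
  exact Subsingleton.elim _ _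

/-- The equivariant map `G/G → X` with value the fixed point `x`. -/
def fixMap {X : FinGSet G} (x : X) (hx : IsFixed x) : orbit (⊤ : Subgroup G) →[G] X where
  toFun _ := x
  map_smul' g _ := (hx g).symm

theorem isFixed_top (x : orbit (⊤ : Subgroup G)) : IsFixed x := fun _ => Subsingleton.elim _ _

theorem comp_fixMap {X Y : FinGSet G} (f : X →[G] Y) (x : X) (hx : IsFixed x) :
    f.comp (fixMap x hx) = fixMap (f x) (hx.map f) := rfl

theorem eq_fixMap {X : FinGSet G} (f : orbit (⊤ : Subgroup G) →[G] X) :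
    f = fixMap (f (base ⊤)) ((isFixed_top _).map f) :=
  hom_ext rfl

/-- In a free `G`-set the group element carrying the chosen representative to a point is unique, so
it depends equivariantly on the point. -/
theorem nonempty_hom_bot {X : FinGSet G} (h : ∀ (g : G) (x : X), g • x = x → g = 1) :
    Nonempty (X →[G] orbit (⊥ : Subgroup G)) := by
  choose γ hγ using exists_smul_orbRep (X := X)
  refine ⟨⟨fun x => γ x • base ⊥, fun g x => ?_⟩⟩
  have : (γ (g • x))⁻¹ * (g * γ x) = 1 := by
    refine h _ (orbRep x) ?_
    rw [mul_smul, mul_smul, hγ, inv_smul_eq_iff, ← orbRep_smul g x, hγ]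
  rw [_root_.id, ← mul_smul, inv_mul_eq_one.mp this]

end FinGSet

/-! ### The action of bispans modulo transfers -/

namespace TambaraFunctor

variable {G : Type} [Group G] [Finite G] (T : TambaraFunctor.{u} G) {X Y Z V W : FinGSet G}

open Bispan

open Classical in
/-- The value of an element of `T(X)` at the orbit of a point, in the geometric fixed points:
the restriction at a fixed point, and the norm of the restriction at any other point. -/
noncomputable def phiVal (z : T.obj X) (a : X) : T.GeomFixedPoints :=
  if h : IsFixed a then Ideal.Quotient.mk _ (T.res (fixMap a h) z)
  else T.nmPhi (T.res (ptMap a) z)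

theorem phiVal_of_isFixed (z : T.obj X) {a : X} (h : IsFixed a) :
    T.phiVal z a = Ideal.Quotient.mk _ (T.res (fixMap a h) z) := dif_pos h

theorem phiVal_of_not_isFixed (z : T.obj X) {a : X} (h : ¬ IsFixed a) :
    T.phiVal z a = T.nmPhi (T.res (ptMap a) z) := dif_neg h

theorem phiVal_res (f : X →[G] Y) (z : T.obj Y) (a : X) (h : IsFixed (f a) → IsFixed a) :
    T.phiVal (T.res f z) a = T.phiVal z (f a) := by
  by_cases ha : IsFixed a
  · rw [T.phiVal_of_isFixed _ ha, T.phiVal_of_isFixed _ (ha.map f), ← res_comp]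
    rfl
  · rw [T.phiVal_of_not_isFixed _ ha, T.phiVal_of_not_isFixed _ (mt h ha), ← res_comp, comp_ptMap]

/-- A transitive set is a copy of `G/G` or of `G/e`. In the first case the norm leg is an
isomorphism and only the restriction remains; in the second it is the norm from `G/e`. -/
theorem mk_map_NR_of_transitive (hS : ∀ H : Subgroup G, H = ⊥ ∨ H = ⊤) {A : FinGSet G}
    (r : A →[G] X) (n : A →[G] orbit (⊤ : Subgroup G)) (a : A) (ha : ∀ a', ∃ g : G, g • a = a')
    (z : T.obj X) : Ideal.Quotient.mk T.transferIdeal (T.map (NR r n) z) =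
      T.phiVal (T.res r z) a := by
  by_cases h : IsFixed a
  · rw [T.phiVal_of_isFixed _ h, ← res_comp]
    congr 1
    refine (congrFun (T.map_iso (Iso.of_bijective (P := R (r.comp (fixMap a h))) (Q := NR r n)
      (fixMap a h) (.id G) ⟨fun _ _ _ => Subsingleton.elim (α := orbit (⊤ : Subgroup G)) _ _,
      fun a' => ?_⟩ Function.bijective_id (fun _ => rfl)
      (fun _ => Subsingleton.elim (α := orbit (⊤ : Subgroup G)) _ _) (fun _ => rfl))) z).symm
    obtain ⟨g, rfl⟩ := ha a'
    exact ⟨base ⊤, (h g).symm⟩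
  · rw [T.phiVal_of_not_isFixed _ h, ← res_comp, nmPhi, nmTop, nm_res]
    congr 1
    refine (congrFun (T.map_iso (Iso.of_bijective (P := NR (r.comp (ptMap a)) _) (Q := NR r n)
      (ptMap a) (.id G) ⟨fun v v' hv => ?_, fun a' => ?_⟩ Function.bijective_id (fun _ => rfl)
      (fun _ => Subsingleton.elim (α := orbit (⊤ : Subgroup G)) _ _) (fun _ => rfl))) z).symm
    · obtain ⟨g, rfl⟩ := exists_smul_base v
      obtain ⟨g', rfl⟩ := exists_smul_base v'
      replace hv : ptMap a (g • base ⊥) = ptMap a (g' • base ⊥) := hv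
      rw [map_smul, map_smul, ptMap_base] at hv
      have : g'⁻¹ * g = 1 := eq_one_of_not_isFixed hS h (by rw [mul_smul, hv, inv_smul_smul])
      rw [inv_mul_eq_one.mp this]
    · obtain ⟨g, rfl⟩ := ha a'
      exact ⟨g • base ⊥, (map_smul (ptMap a) g _).trans (by rw [ptMap_base])⟩

/-- The non-fixed part of the middle set is free, hence maps to `G/e`, and its contribution is a
transfer. A fixed point contributes the norm along its fibre, which is the product of the norms
along the orbits in that fibre. -/
theorem mk_map (hS : ∀ H : Subgroup G, H = ⊥ ∨ H = ⊤) (P : Bispan X (orbit (⊤ : Subgroup G)))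
    (z : T.obj X) : Ideal.Quotient.mk T.transferIdeal (T.map P z) =
      ∑ b : {b : P.B // IsFixed b}, ∏ a : {a : P.A // orbRep a = a ∧ P.n a = b.1},
        T.phiVal (T.res P.r z) a.1 := by
  classical
  -- Each fixed point gets its own colour, and `none` collects the free part.
  let c : P.B → Option {b : P.B // IsFixed b} := fun b => if h : IsFixed b then some ⟨b, h⟩ else none
  have hc : ∀ (g : G) b, c (g • b) = c b := by
    intro g b
    by_cases h : IsFixed b
    · rw [h g]
    · have h' : ¬ IsFixed (g • b) := fun h' => h h'.of_smul
      simp only [c, dif_neg h, dif_neg h']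
  rw [T.map_eq_sum P c hc, Fintype.sum_option, _root_.map_add, _root_.map_sum]
  have h0 : Ideal.Quotient.mk T.transferIdeal (T.map (P.restrict (fun b => c b = none)
      fun g b h => (hc g b).trans h) z) = 0 := by
    rw [Ideal.Quotient.eq_zero_iff_mem]
    -- The transfer leg of the free part factors through `G/e`.
    obtain ⟨s⟩ := nonempty_hom_bot (X := (P.restrict (fun b => c b = none)
      fun g b h => (hc g b).trans h).B) (by
      rintro g ⟨b, hb⟩ h
      have hb' : ¬ IsFixed b := fun h' => by simp [c, h'] at hb
      exact eq_one_of_not_isFixed hS hb' (congrArg (Subtype.val (p := fun b => c b = none)) h))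
    refine Ideal.subset_span ⟨T.map ⟨_, _, (P.restrict (fun b => c b = none)
      fun g b h => (hc g b).trans h).r, (P.restrict (fun b => c b = none)
      fun g b h => (hc g b).trans h).n, s⟩ z, ?_⟩
    rw [trTop, tr_map]
    congr 2
    exact (eq_toTop _).trans (eq_toTop _).symm
  rw [h0, zero_add]
  refine Finset.sum_congr rfl fun b _ => ?_
  have hb : ∀ (g : G) (a : P.A), P.n a = b.1 → P.n (g • a) = b.1 := fun g a h => by
    rw [map_smul, h, b.2 g]
  let i : sub P.A (fun a => P.n a = b.1) hb →[G] P.A := subIncl _ _ _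
  have hcb : c b.1 = some b := dif_pos b.2
  have hcb' : ∀ b', c b' = some b → b' = b.1 := by
    intro b' h
    by_cases h' : IsFixed b'
    · rw [show c b' = some ⟨b', h'⟩ from dif_pos h'] at h
      exact congrArg Subtype.val (Option.some.inj h)
    · rw [show c b' = none from dif_neg h'] at h
      exact absurd h (by simp)
  have h1 : T.map (P.restrict (fun b' => c b' = some b) fun g b h => (hc g b).trans h) z =
      T.map (NR (P.r.comp i) (toTop _)) z := by
    refine (congrFun (T.map_iso (Iso.of_bijective (P := NR (P.r.comp i) (toTop _))
      (Q := P.restrict (fun b' => c b' = some b) fun g b h => (hc g b).trans h)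
      (subMap P.A hb (fun g a (h : c (P.n a) = some b) => by rw [map_smul, hc, h]) ?_)
      (fixMap (X := sub P.B (fun b' => c b' = some b) fun g b h => (hc g b).trans h)
        (⟨b.1, hcb⟩ : {b' : P.B // c b' = some b}) fun g => Subtype.ext (b.2 g))
      ⟨fun a a' h => Subtype.ext (congrArg (Subtype.val (p := fun a => c (P.n a) = some b)) h), ?_⟩
      ⟨fun _ _ _ => Subsingleton.elim (α := orbit (⊤ : Subgroup G)) _ _, ?_⟩
      (fun _ => rfl) ?_ (fun _ => Subsingleton.elim (α := orbit (⊤ : Subgroup G)) _ _))) z).symm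
    · intro a h
      rw [h, hcb]
    · rintro ⟨a, ha⟩
      exact ⟨⟨a, hcb' _ ha⟩, rfl⟩
    · rintro ⟨b', hb'⟩
      exact ⟨base ⊤, Subtype.ext (hcb' _ hb').symm⟩
    · rintro ⟨a, ha⟩
      exact Subtype.ext ha
  have hrep : ∀ a, P.n a = b.1 → P.n (orbRep a) = b.1 := by
    intro a ha
    obtain ⟨g, hg⟩ := exists_smul_orbRep a
    rw [← hg, map_smul] at ha
    have := IsFixed.of_smul (g := g) (x := P.n (orbRep a)) (ha ▸ b.2)
    rw [← ha, this g]
  -- Colours the fibre over `b` by orbits; each colour class is then transitive.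
  let κ : sub P.A (fun a => P.n a = b.1) hb → {a : P.A // orbRep a = a ∧ P.n a = b.1} := fun a =>
    ⟨orbRep (i a), orbRep_orbRep _, hrep _ (Subtype.prop (p := fun a => P.n a = b.1) a)⟩
  have hκ : ∀ (g : G) a, κ (g • a) = κ a := fun g a => Subtype.ext (orbRep_smul g (i a))
  rw [h1, T.map_NR_eq_prod _ _ κ hκ, _root_.map_prod]
  refine Finset.prod_congr rfl fun a _ => ?_
  let j := subIncl _ (fun a' => κ a' = a) fun g b h => (hκ g b).trans h
  have hi : Function.Injective i := Subtype.val_injective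
  have hj : Function.Injective j := Subtype.val_injective
  let a₁ : sub P.A (fun a => P.n a = b.1) hb := (⟨a.1, a.2.2⟩ : {a : P.A // P.n a = b.1})
  have ha₁ : κ a₁ = a := Subtype.ext a.2.1
  refine (T.mk_map_NR_of_transitive hS ((P.r.comp i).comp j) _
    (⟨a₁, ha₁⟩ : {a' : sub P.A (fun a => P.n a = b.1) hb // κ a' = a}) ?_ z).trans ?_
  · rintro ⟨a', ha'⟩
    have : orbRep (i a₁) = orbRep (i a') := congrArg Subtype.val (ha₁.trans ha'.symm)
    obtain ⟨g, hg⟩ := exists_smul_of_orbRep_eq this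
    exact ⟨g, Subtype.ext (hi ((map_smul i g a₁).trans hg))⟩
  · rw [res_comp, res_comp]
    exact (T.phiVal_res j _ _ fun h => h.of_map j hj).trans
      (T.phiVal_res i _ a₁ fun h => h.of_map i hi)

end TambaraFunctor

/-! ### The norm to geometric fixed points as a ring homomorphism -/

namespace FinGSet

variable {G : Type} [Group G] [Finite G]

theorem not_isFixed_bot [Nontrivial G] (y : orbit (⊥ : Subgroup G)) : ¬ IsFixed y := by
  intro h
  obtain ⟨g, rfl⟩ := exists_smul_base y
  obtain ⟨k, hk⟩ := exists_ne (1 : G)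
  have h' := h k
  rw [← mul_smul] at h'
  exact hk (mul_eq_right.mp (smul_base_injective h'))

theorem ptMap_bot_bijective (y : orbit (⊥ : Subgroup G)) : Function.Bijective (ptMap y) := by
  obtain ⟨k, rfl⟩ := exists_smul_base y
  constructor
  · intro v v' h
    obtain ⟨g, rfl⟩ := exists_smul_base v
    obtain ⟨g', rfl⟩ := exists_smul_base v'
    rw [map_smul, map_smul, ptMap_base, ← mul_smul, ← mul_smul] at h
    rw [mul_right_cancel (smul_base_injective h)]
  · intro v
    obtain ⟨g, rfl⟩ := exists_smul_base v
    refine ⟨(g * k⁻¹) • base ⊥, ?_⟩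
    rw [map_smul, ptMap_base, ← mul_smul, inv_mul_cancel_right]

theorem quot_eq_toTop : quot (bot_le : (⊥ : Subgroup G) ≤ ⊤) = toTop _ := eq_toTop _

theorem card_orbit_bot : Fintype.card (orbit (⊥ : Subgroup G)) = Nat.card G := by
  rw [← Nat.card_eq_fintype_card]
  refine (Nat.card_congr (Equiv.ofBijective (fun g : G => g • base (⊥ : Subgroup G)) ⟨?_, ?_⟩)).symm
  · exact fun g h e => smul_base_injective e
  · exact exists_smul_base

end FinGSet

namespace TambaraFunctor

variable {G : Type} [Group G] [Finite G] (T : TambaraFunctor.{u} G) {X Y Z V W : FinGSet G}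

open Bispan

/-- An endomorphism of `G/e` is bijective and commutes with the map to the point, so it is absorbed
by an isomorphism of bispans: the norm does not see conjugation. -/
theorem nmTop_res_ptMap (y : orbit (⊥ : Subgroup G)) (c : T.obj (orbit ⊥)) :
    T.nmTop (T.res (ptMap y) c) = T.nmTop c := by
  rw [nmTop, nm_res]
  exact congrFun (T.map_iso (Iso.of_bijective (P := NR (ptMap y) _) (Q := Bispan.N _)
      (ptMap y) (.id G) (ptMap_bot_bijective y) Function.bijective_id (fun _ => rfl)
      (fun _ => Subsingleton.elim (α := orbit (⊤ : Subgroup G)) _ _) (fun _ => rfl))) c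

theorem nmPhi_res_ptMap (y : orbit (⊥ : Subgroup G)) (c : T.obj (orbit ⊥)) :
    T.nmPhi (T.res (ptMap y) c) = T.nmPhi c :=
  congrArg (Ideal.Quotient.mk _) (T.nmTop_res_ptMap y c)

/-- The norm of a sum is the composite of the fold transfer with the norm. Its lifts choose, for
every point of `G/e`, one of the two summands; only the two constant choices are fixed, and `mk_map`
discards the others. -/
theorem nmPhi_add [Nontrivial G] (hS : ∀ H : Subgroup G, H = ⊥ ∨ H = ⊤) (a b : T.obj (orbit ⊥)) :
    T.nmPhi (a + b) = T.nmPhi a + T.nmPhi b := by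
  classical
  obtain ⟨z, rfl, rfl⟩ := T.exists_pair a b
  let E := orbit (⊥ : Subgroup G)
  let q : E →[G] orbit (⊤ : Subgroup G) := quot bot_le
  let F : Bispan (sum E E) E := Bispan.T (fold E)
  let L := Lift F (Bispan.N q)
  have h : T.map F z = T.res (inl E E) z + T.res (inr E E) z := T.map_add _ z
  let ε : (E →[G] sum E E) → (L → Prop) := fun i e =>
    ∀ c hc, e.sec ⟨c, hc⟩ = i c
  -- The points over a fixed lift form a single free orbit, so its product has a single factor.
  have hone : ∀ (i : E →[G] sum E E) (e : L) (he : IsFixed (X := (F.comp (Bispan.N q)).B) e),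
      ε i e → (∏ w : {w : (F.comp (Bispan.N q)).A // orbRep w = w ∧
        (F.comp (Bispan.N q)).n w = e}, T.phiVal (T.res (F.comp (Bispan.N q)).r z) w.1) =
          T.nmPhi (T.res i z) := by
    intro i e he hi
    let w : (F.comp (Bispan.N q)).A := (⟨e, base ⊥, Subsingleton.elim (α := orbit (⊤ : Subgroup G)) _ _, i (base ⊥),
      (hi _ _).symm⟩ : LiftPt F (Bispan.N q))
    have hw : ∀ w' : (F.comp (Bispan.N q)).A, (F.comp (Bispan.N q)).n w' = e →
        ∃ g : G, g • w = w' := by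
      rintro ⟨e', c, hc, a, ha⟩ (rfl : e' = e)
      obtain ⟨g, rfl⟩ := exists_smul_base c
      refine ⟨g, LiftPt.ext' (he g) rfl ?_⟩
      exact (map_smul i g (base ⊥)).symm.trans ((hi _ _).symm.trans ha.symm)
    obtain ⟨g, hg⟩ := exists_smul_orbRep w
    have hgw : orbRep w = g⁻¹ • w := by
      conv_rhs => rw [← hg]
      rw [inv_smul_smul]
    have : Subsingleton {w : (F.comp (Bispan.N q)).A // orbRep w = w ∧
        (F.comp (Bispan.N q)).n w = e} := ⟨by
      rintro ⟨w₁, h₁, h₁'⟩ ⟨w₂, h₂, h₂'⟩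
      obtain ⟨g₁, rfl⟩ := hw w₁ h₁'
      obtain ⟨g₂, rfl⟩ := hw w₂ h₂'
      refine Subtype.ext ?_
      change g₁ • w = g₂ • w
      rw [← h₁, ← h₂, orbRep_smul, orbRep_smul]⟩
    rw [Fintype.prod_subsingleton _ ⟨orbRep w, orbRep_orbRep w, by
      rw [hgw, map_smul]; exact he _⟩]
    have hnf : ¬ IsFixed (orbRep w) := by
      intro hf
      rw [hgw] at hf
      exact not_isFixed_bot (base ⊥) fun k => congrArg LiftPt.pt (hf.of_smul k)
    rw [phiVal_of_not_isFixed _ _ hnf, ← res_comp, comp_ptMap]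
    have : (F.comp (Bispan.N q)).r (orbRep w) = i (g⁻¹ • base ⊥) := by
      rw [hgw, map_smul, map_smul]
      rfl
    -- The chosen representative may be a translate of `w`; invariance of the norm under conjugation
    -- removes the translation.
    rw [this, ← comp_ptMap, res_comp, nmPhi_res_ptMap]
  let e : (i : E →[G] sum E E) → (∀ c, fold E (i c) = c) → L := fun i hi =>
    ⟨base ⊤, fun c => i c.1, fun c => hi c.1⟩
  have hfix : ∀ i hi, IsFixed (X := (F.comp (Bispan.N q)).B) (e i hi) := by
    intro i hi g
    refine Lift.ext' (Subsingleton.elim (α := orbit (⊤ : Subgroup G)) _ _) fun c _ _ => ?_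
    exact (map_smul i g (g⁻¹ • c)).symm.trans (congrArg i (smul_inv_smul g c))
  let e₁ : {e : (F.comp (Bispan.N q)).B // IsFixed e} := ⟨e (inl E E) fun _ => rfl, hfix _ _⟩
  let e₂ : {e : (F.comp (Bispan.N q)).B // IsFixed e} := ⟨e (inr E E) fun _ => rfl, hfix _ _⟩
  have hne : e₁ ≠ e₂ := by
    intro h12
    exact Sum.inl_ne_inr (Lift.sec_eq (congrArg Subtype.val h12) (base ⊥) rfl rfl)
  -- A fixed lift is an equivariant section of the fold map, determined by its value at the base
  -- point, for which there are two possibilities.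
  have huniv : (Finset.univ : Finset {e : (F.comp (Bispan.N q)).B // IsFixed e}) = {e₁, e₂} := by
    refine (Finset.eq_univ_iff_forall.mpr ?_).symm
    rintro ⟨⟨d, s, hs⟩, he⟩
    rw [Finset.mem_insert, Finset.mem_singleton]
    have hall : ∀ c : E, (Bispan.N q).n c = d := fun c =>
      Subsingleton.elim (α := orbit (⊤ : Subgroup G)) _ _
    have hsec : ∀ g : G, s ⟨g • base ⊥, hall _⟩ = g • s ⟨base ⊥, hall _⟩ := by
      intro g
      refine (Lift.sec_eq (he g) (g • base ⊥)
        (Subsingleton.elim (α := orbit (⊤ : Subgroup G)) _ _) (hall _)).symm.trans ?_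
      exact congrArg (g • ·) (Lift.sec_congr (⟨d, s, hs⟩ : L) (inv_smul_smul g _) _ _)
    have hext : ∀ i hi, s ⟨base ⊥, hall _⟩ = i (base ⊥) → (⟨d, s, hs⟩ : L) = e i hi := by
      intro i hi h0
      refine Lift.ext' (Subsingleton.elim (α := orbit (⊤ : Subgroup G)) _ _) fun c hc hc' => ?_
      obtain ⟨g, rfl⟩ := exists_smul_base c
      exact (hsec g).trans ((congrArg (g • ·) h0).trans (map_smul i g _).symm)
    have h0 : fold E (s ⟨base ⊥, hall _⟩) = base ⊥ := hs ⟨base ⊥, hall _⟩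
    rcases hv : (s ⟨base ⊥, hall _⟩ : E ⊕ E) with v | v
    · left
      rw [hv] at h0
      obtain rfl : v = base ⊥ := h0
      exact Subtype.ext (hext _ _ hv)
    · right
      rw [hv] at h0
      obtain rfl : v = base ⊥ := h0
      exact Subtype.ext (hext _ _ hv)
  rw [← h, nmPhi, nmTop, nm, ← T.map_comp, T.mk_map hS, huniv, Finset.sum_pair hne]
  exact congrArg₂ (· + ·) (hone _ _ e₁.2 fun _ _ => rfl) (hone _ _ e₂.2 fun _ _ => rfl)

/-- The norm `T(G/e) → Φ T` as a ring homomorphism. -/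
def nmPhiHom [Nontrivial G] (hS : ∀ H : Subgroup G, H = ⊥ ∨ H = ⊤) :
    T.obj (orbit (⊥ : Subgroup G)) →+* T.GeomFixedPoints where
  toFun := T.nmPhi
  map_one' := by rw [nmPhi, nmTop, nm_one, _root_.map_one]
  map_mul' a b := by rw [nmPhi, nmTop, nm_mul, _root_.map_mul]; rfl
  map_zero' := by
    rw [nmPhi, nmTop, nm, T.map_zero_of_surjective _ (quot_surjective _), _root_.map_zero]
  map_add' := T.nmPhi_add hS

theorem mem_transferIdeal_iff (x : T.obj (orbit (⊤ : Subgroup G))) :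
    x ∈ T.transferIdeal ↔ ∃ c, T.trTop c = x := by
  refine ⟨fun h => ?_, fun h => Ideal.subset_span h⟩
  induction h using Submodule.span_induction with
  | mem x h => exact h
  | zero => exact ⟨0, T.tr_zero _⟩
  | add x y _ _ hx hy =>
    obtain ⟨a, rfl⟩ := hx
    obtain ⟨b, rfl⟩ := hy
    exact ⟨a + b, T.tr_add _ a b⟩
  | smul r x _ hx =>
    obtain ⟨a, rfl⟩ := hx
    exact ⟨a * T.resTop r, (T.tr_mul_res _ a r).trans (mul_comm _ _)⟩

/-- Restricting a transfer gives the sum of the conjugates of `c` over the points of `G/e`; here all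
of them equal `c`. -/
theorem resTop_trTop (c : T.obj (orbit (⊥ : Subgroup G)))
    (h : ∀ y, T.res (ptMap y) c = c) : T.resTop (T.trTop c) = Nat.card G • c := by
  have h1 : quot (bot_le : (⊥ : Subgroup G) ≤ ⊤) = ptMap (base ⊤) :=
    (eq_toTop _).trans (eq_toTop _).symm
  rw [resTop, h1, trTop, tr, res_ptMap_map]
  have h2 : ∀ b : orbit (⊥ : Subgroup G), ∏ a : {a : (Bispan.T (quot
      (bot_le : (⊥ : Subgroup G) ≤ ⊤))).A // (Bispan.T (quot bot_le)).n a = b},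
        T.res (ptMap ((Bispan.T (quot bot_le)).r a.1)) c = c := by
    intro b
    have : Subsingleton {a : (Bispan.T (quot (bot_le : (⊥ : Subgroup G) ≤ ⊤))).A //
      (Bispan.T (quot bot_le)).n a = b} := ⟨fun a a' => Subtype.ext (a.2.trans a'.2.symm)⟩
    rw [Fintype.prod_subsingleton _ ⟨b, rfl⟩]
    exact h _
  refine (Finset.sum_congr rfl fun b _ => h2 b.1).trans ?_
  rw [Finset.sum_const, Finset.card_univ, ← card_orbit_bot]
  congr 1
  exact Fintype.card_congr (Equiv.subtypeUnivEquiv fun b =>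
    Subsingleton.elim (α := orbit (⊤ : Subgroup G)) _ _)

/-! ### Products of ideals and part (a) -/

namespace TIdeal

variable {T}

theorem mem_generatedBy {S : ∀ H : Subgroup G, Set (T.obj (orbit H))} {H : Subgroup G}
    {x : T.obj (orbit H)} : x ∈ (generatedBy S).level H ↔
      ∀ K : TIdeal T, (∀ H, S H ⊆ K.level H) → x ∈ K.level H := by
  rw [generatedBy, Submodule.mem_iInf]
  exact Subtype.forall

theorem mul_def (I J : TIdeal T) : I * J =
    generatedBy fun H => ((I.level H * J.level H : Ideal (T.obj (orbit H))) : Set _) := rfl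

theorem mem_bot_level {H : Subgroup G} {x : T.obj (orbit H)} :
    x ∈ (⊥ : TIdeal T).level H ↔ x = 0 := Ideal.mem_bot

/-- The zero family is already an ideal, so the ideal generated by the levelwise products vanishes
as soon as they do. -/
theorem mul_le_bot_iff {I J : TIdeal T} : I * J ≤ ⊥ ↔
    ∀ (H : Subgroup G), ∀ x ∈ I.level H, ∀ y ∈ J.level H, x * y = 0 := by
  constructor
  · intro h H x hx y hy
    refine mem_bot_level.mp (h H ?_)
    rw [mul_def, mem_generatedBy]
    exact fun K hK => hK H (Ideal.mul_mem_mul hx hy)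
  · intro h H x hx
    rw [mul_def, mem_generatedBy] at hx
    refine hx ⊥ fun H => ?_
    exact Ideal.mul_le.mpr fun x hx y hy => mem_bot_level.mpr (h H x hx y hy)

end TIdeal

/-- A nonzero ideal is detected by a nonzero class in `Φ T` of one of its elements at `G/G`, and `Φ
T` has no zero divisors. -/
theorem isTambaraDomain_of_injective [Nontrivial G] (hS : ∀ H : Subgroup G, H = ⊥ ∨ H = ⊤)
    (hinj : Function.Injective T.nmPhi) [IsDomain T.GeomFixedPoints]
    (htors : ∀ x : T.obj (orbit (⊤ : Subgroup G)), (Nat.card G : T.obj _) * x = 0 → x = 0) :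
    T.IsTambaraDomain := by
  -- Conjugate elements have equal norms, so injectivity makes conjugation trivial.
  have htriv : ∀ y (c : T.obj (orbit (⊥ : Subgroup G))), T.res (ptMap y) c = c :=
    fun y c => hinj (T.nmPhi_res_ptMap y c)
  -- If `x = tr c` restricts to zero, then `|G| • c = 0`, so `|G| • x = tr (|G| • c) = 0`, and `x =
  -- 0` by absence of torsion.
  have hkey : ∀ x : T.obj (orbit (⊤ : Subgroup G)), Ideal.Quotient.mk T.transferIdeal x = 0 →
      T.resTop x = 0 → x = 0 := by
    intro x h1 h2
    obtain ⟨c, rfl⟩ := (T.mem_transferIdeal_iff x).mp (Ideal.Quotient.eq_zero_iff_mem.mp h1)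
    rw [T.resTop_trTop c fun y => htriv y c] at h2
    refine htors _ ?_
    rw [← nsmul_eq_mul]
    refine (_root_.map_nsmul (T.trHom (quot bot_le)) (Nat.card G) c).symm.trans ?_
    rw [h2]
    exact T.tr_zero _
  have hbot : ∀ (I : TIdeal T) (x : T.obj (orbit (⊥ : Subgroup G))), x ∈ I.level ⊥ → x ≠ 0 →
      ∃ y ∈ I.level ⊤, Ideal.Quotient.mk T.transferIdeal y ≠ 0 := by
    intro I x hx h0
    refine ⟨T.nmTop x, I.nm_mem _ x hx, fun h => h0 ?_⟩
    exact (injective_iff_map_eq_zero (T.nmPhiHom hS)).mp hinj x h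
  have hI : ∀ I : TIdeal T, ¬ I ≤ ⊥ → ∃ y ∈ I.level ⊤, Ideal.Quotient.mk T.transferIdeal y ≠ 0 := by
    intro I hI
    obtain ⟨H, hH⟩ := not_forall.mp hI
    obtain ⟨x, hx, h0⟩ := SetLike.not_le_iff_exists.mp hH
    replace h0 : x ≠ 0 := h0
    rcases hS H with rfl | rfl
    · exact hbot I x hx h0
    · by_cases h1 : Ideal.Quotient.mk T.transferIdeal x = 0
      · exact hbot I (T.resTop x) (I.res_mem _ x hx) fun h2 => h0 (hkey x h1 h2)
      · exact ⟨x, hx, h1⟩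
  have hnt : Nontrivial (T.obj (orbit (⊤ : Subgroup G))) :=
    (Ideal.Quotient.mk T.transferIdeal).domain_nontrivial
  refine ⟨⟨⊤, bot_ne_top⟩, fun I J hIJ => ?_⟩
  by_contra hne
  rw [not_or] at hne
  obtain ⟨x, hx, hx0⟩ := hI I hne.1
  obtain ⟨y, hy, hy0⟩ := hI J hne.2
  refine mul_ne_zero hx0 hy0 ?_
  rw [← _root_.map_mul, TIdeal.mul_le_bot_iff.mp hIJ _ x hx y hy, _root_.map_zero]

/-! ### Two annihilating ideals and part (b) -/

/-- Surjectivity of the norm leg makes every product in the double coset formula nonempty, so each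
has a vanishing factor. Restrictions, transfers, and norms along surjections all qualify, which
gives every closure property of the ideals below. -/
theorem res_map_eq_zero (P : Bispan X Y) (hP : Function.Surjective P.n) (x : T.obj X)
    (hx : ∀ f : orbit (⊥ : Subgroup G) →[G] X, T.res f x = 0)
    (f : orbit (⊥ : Subgroup G) →[G] Y) : T.res f (T.map P x) = 0 := by
  rw [eq_ptMap f, res_ptMap_map]
  refine Finset.sum_eq_zero fun b _ => ?_
  obtain ⟨a, ha⟩ := hP b.1
  exact Finset.prod_eq_zero (Finset.mem_univ ⟨a, ha⟩) (hx _)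

/-- The levelwise kernel of all restrictions to `G/e`. -/
def resKernel : TIdeal T where
  level H := ⨅ f : orbit (⊥ : Subgroup G) →[G] orbit H, RingHom.ker (T.resHom f)
  tr_mem h x hx := by
    rw [Ideal.mem_iInf] at hx ⊢
    exact T.res_map_eq_zero _ Function.surjective_id x hx
  nm_mem h x hx := by
    rw [Ideal.mem_iInf] at hx ⊢
    exact T.res_map_eq_zero _ (quot_surjective h) x hx
  res_mem h x hx := by
    rw [Ideal.mem_iInf] at hx ⊢
    exact T.res_map_eq_zero _ Function.surjective_id x hx
  conj_mem h H x hx := by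
    rw [Ideal.mem_iInf] at hx ⊢
    exact T.res_map_eq_zero _ Function.surjective_id x hx

theorem nmPhi_res_map_eq_zero [Nontrivial G] (hS : ∀ H : Subgroup G, H = ⊥ ∨ H = ⊤)
    (P : Bispan X Y) (hP : Function.Surjective P.n) (x : T.obj X)
    (hx : ∀ f : orbit (⊥ : Subgroup G) →[G] X, T.nmPhi (T.res f x) = 0)
    (f : orbit (⊥ : Subgroup G) →[G] Y) : T.nmPhi (T.res f (T.map P x)) = 0 := by
  rw [eq_ptMap f, res_ptMap_map]
  change T.nmPhiHom hS _ = 0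
  rw [_root_.map_sum]
  refine Finset.sum_eq_zero fun b _ => ?_
  obtain ⟨a, ha⟩ := hP b.1
  rw [_root_.map_prod]
  exact Finset.prod_eq_zero (Finset.mem_univ ⟨a, ha⟩) (hx _)

/-- By `mk_map`, a fixed lift contributes a product over orbits, which is nonempty by surjectivity;
a fixed orbit vanishes by `hx'` and a free one by `hx`. -/
theorem mk_res_map_eq_zero (hS : ∀ H : Subgroup G, H = ⊥ ∨ H = ⊤)
    (P : Bispan X Y) (hP : Function.Surjective P.n) (x : T.obj X)
    (hx : ∀ f : orbit (⊥ : Subgroup G) →[G] X, T.nmPhi (T.res f x) = 0)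
    (hx' : ∀ f : orbit (⊤ : Subgroup G) →[G] X, Ideal.Quotient.mk T.transferIdeal (T.res f x) = 0)
    (f : orbit (⊤ : Subgroup G) →[G] Y) :
    Ideal.Quotient.mk T.transferIdeal (T.res f (T.map P x)) = 0 := by
  rw [res, ← T.map_comp, T.mk_map hS]
  refine Finset.sum_eq_zero fun e _ => ?_
  obtain ⟨w, hw⟩ : ∃ w, (P.comp (R f)).n w = e.1 := by
    obtain ⟨⟨d, s, hs⟩, he⟩ := e
    obtain ⟨a, ha⟩ := hP (s ⟨d, rfl⟩)
    exact ⟨(⟨⟨d, s, hs⟩, d, rfl, a, ha⟩ : LiftPt P (R f)), rfl⟩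
  obtain ⟨g, hg⟩ := exists_smul_orbRep w
  have hrep : (P.comp (R f)).n (orbRep w) = e.1 := by
    rw [← hg, map_smul] at hw
    have := IsFixed.of_smul (g := g) (hw ▸ e.2)
    rw [← hw, this g]
  refine Finset.prod_eq_zero (Finset.mem_univ ⟨orbRep w, orbRep_orbRep w, hrep⟩) ?_
  by_cases h : IsFixed (orbRep w)
  · rw [phiVal_of_isFixed _ _ h, ← res_comp, hx']
  · rw [phiVal_of_not_isFixed _ _ h, ← res_comp, hx]

/-- The largest ideal contained in the kernel of `nmPhi` and in the transfer ideal. -/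
def phiKernel [Nontrivial G] (hS : ∀ H : Subgroup G, H = ⊥ ∨ H = ⊤) : TIdeal T where
  level H := (⨅ f : orbit (⊥ : Subgroup G) →[G] orbit H,
      RingHom.ker ((T.nmPhiHom hS).comp (T.resHom f))) ⊓
    ⨅ f : orbit (⊤ : Subgroup G) →[G] orbit H,
      RingHom.ker ((Ideal.Quotient.mk T.transferIdeal).comp (T.resHom f))
  tr_mem h x hx := by
    rw [Ideal.mem_inf, Ideal.mem_iInf, Ideal.mem_iInf] at hx ⊢
    exact ⟨T.nmPhi_res_map_eq_zero hS _ Function.surjective_id x hx.1,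
      T.mk_res_map_eq_zero hS _ Function.surjective_id x hx.1 hx.2⟩
  nm_mem h x hx := by
    rw [Ideal.mem_inf, Ideal.mem_iInf, Ideal.mem_iInf] at hx ⊢
    exact ⟨T.nmPhi_res_map_eq_zero hS _ (quot_surjective h) x hx.1,
      T.mk_res_map_eq_zero hS _ (quot_surjective h) x hx.1 hx.2⟩
  res_mem h x hx := by
    rw [Ideal.mem_inf, Ideal.mem_iInf, Ideal.mem_iInf] at hx ⊢
    exact ⟨T.nmPhi_res_map_eq_zero hS _ Function.surjective_id x hx.1,
      T.mk_res_map_eq_zero hS _ Function.surjective_id x hx.1 hx.2⟩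
  conj_mem g H x hx := by
    rw [Ideal.mem_inf, Ideal.mem_iInf, Ideal.mem_iInf] at hx ⊢
    exact ⟨T.nmPhi_res_map_eq_zero hS _ Function.surjective_id x hx.1,
      T.mk_res_map_eq_zero hS _ Function.surjective_id x hx.1 hx.2⟩

/-- The ideals `resKernel` and `phiKernel` are nonzero and annihilate each other. -/
theorem not_isTambaraDomain_of_not_injective [Nontrivial G]
    (hS : ∀ H : Subgroup G, H = ⊥ ∨ H = ⊤) (hnm : ¬ Function.Injective T.nmPhi)
    (hres : ¬ Function.Injective T.resTop) : ¬ T.IsTambaraDomain := by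
  have hmul : ∀ (H : Subgroup G), ∀ x ∈ T.resKernel.level H, ∀ y ∈ (T.phiKernel hS).level H,
      x * y = 0 := by
    intro H x hx y hy
    have hx' := Ideal.mem_iInf.mp hx
    rw [phiKernel, Ideal.mem_inf, Ideal.mem_iInf, Ideal.mem_iInf] at hy
    rcases hS H with rfl | rfl
    · have : x = 0 := (T.res_id x).symm.trans (hx' (.id G))
      rw [this, zero_mul]
    -- At `G/G` the element `y` is a transfer `tr c`, while `x` restricts to zero, so Frobenius
    -- reciprocity gives `tr c * x = tr (c * res x) = 0`.
    · have h1 : Ideal.Quotient.mk T.transferIdeal y = 0 :=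
        (congrArg _ (T.res_id y).symm).trans (hy.2 (.id G))
      obtain ⟨c, rfl⟩ := (T.mem_transferIdeal_iff y).mp (Ideal.Quotient.eq_zero_iff_mem.mp h1)
      rw [mul_comm]
      refine (T.tr_mul_res _ c x).symm.trans ?_
      have h2 : T.res (quot bot_le) x = 0 := hx' _
      rw [h2, mul_zero, tr_zero]
  rintro ⟨-, h⟩
  rcases h T.resKernel (T.phiKernel hS) (TIdeal.mul_le_bot_iff.mpr hmul) with h | h
  · refine hres ((injective_iff_map_eq_zero (T.resHom (quot bot_le))).mpr fun x hx => ?_)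
    refine Ideal.mem_bot.mp (h ⊤ ?_)
    refine Ideal.mem_iInf.mpr fun f => ?_
    rw [RingHom.mem_ker, eq_toTop f, ← quot_eq_toTop]
    exact hx
  · refine hnm ((injective_iff_map_eq_zero (T.nmPhiHom hS)).mpr fun x hx => ?_)
    refine Ideal.mem_bot.mp (h ⊥ (Ideal.mem_inf.mpr ⟨?_, ?_⟩))
    · refine Ideal.mem_iInf.mpr fun f => ?_
      rw [RingHom.mem_ker, eq_ptMap f]
      exact (T.nmPhi_res_ptMap _ x).trans hx
    -- The condition on maps from `G/G` is vacuous at level `G/e`, which has no fixed points.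
    · exact Ideal.mem_iInf.mpr fun f => absurd ((isFixed_top (base ⊤)).map f) (not_isFixed_bot _)

end TambaraFunctor

/-! ### Tambara functors from ghost data -/

namespace FinGSet

variable {G : Type} [Group G]

/-- A product over chosen orbit representatives may be computed with any system of
representatives. -/
theorem prod_orbRep {M : Type*} [CommMonoid M] {A : FinGSet G} (v : A → M)
    (hv : ∀ (g : G) a, v (g • a) = v a) (p : A → Prop) (hp : ∀ (g : G) a, p a → p (g • a))
    {ι : Type*} [Fintype ι] (k : ι → A) (hk : ∀ i, p (k i))
    (hsurj : ∀ a, p a → ∃ i, ∃ g : G, g • k i = a) (hinj : ∀ i j (g : G), g • k i = k j → i = j) :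
    ∏ a : {a : A // orbRep a = a ∧ p a}, v a.1 = ∏ i, v (k i) := by
  have hrep : ∀ a : A, ∃ g : G, orbRep a = g • a := fun a => by
    obtain ⟨g, hg⟩ := exists_smul_orbRep a
    exact ⟨g⁻¹, by rw [eq_inv_smul_iff, hg]⟩
  symm
  refine Fintype.prod_bijective (fun i => (⟨orbRep (k i), orbRep_orbRep _, ?_⟩ :
    {a : A // orbRep a = a ∧ p a})) ⟨?_, ?_⟩ _ _ ?_
  · obtain ⟨g, hg⟩ := hrep (k i)
    rw [hg]
    exact hp g _ (hk i)
  · intro i j h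
    obtain ⟨g, hg⟩ := exists_smul_of_orbRep_eq (show orbRep (k i) = orbRep (k j) from
      congrArg Subtype.val h)
    exact hinj i j g hg
  · rintro ⟨a, ha, hpa⟩
    obtain ⟨i, g, rfl⟩ := hsurj a hpa
    exact ⟨i, Subtype.ext ((orbRep_smul g (k i)).symm.trans ha)⟩
  · intro i
    obtain ⟨g, hg⟩ := hrep (k i)
    change v (k i) = v (orbRep (k i))
    rw [hg, hv]

/-- This is the condition for `x ↦ y` to extend equivariantly over the orbit of `x`; since
stabilisers are trivial or everything, it reduces to fixedness. -/
theorem smul_eq_of_smul_eq (hS : ∀ H : Subgroup G, H = ⊥ ∨ H = ⊤) {X Y : FinGSet G} {x : X} {y : Y}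
    (h : IsFixed x → IsFixed y) {g : G} (hg : g • x = x) : g • y = y := by
  by_cases hx : IsFixed x
  · exact h hx g
  · rw [eq_one_of_not_isFixed hS hx hg, one_smul]

end FinGSet

section

open Bispan

variable {G : Type} [Group G]

/-- Rings `R` and `Q`, operators of `G` on `R` and an invariant homomorphism `R → Q`. -/
structure GhostData (G : Type) [Group G] where
  R : Type
  Q : Type
  [commRingR : CommRing R]
  [commRingQ : CommRing Q]
  ρ : G → R →+* R
  φ : R →+* Q
  φ_ρ : ∀ g r, φ (ρ g r) = φ r

namespace GhostData

variable (D : GhostData G)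

instance : CommRing D.R := D.commRingR

instance : CommRing D.Q := D.commRingQ

/-- The values of the Tambara functor attached to `D`: an equivariant function to `R` and a function
on the fixed points to `Q`. -/
@[ext]
structure Obj (X : FinGSet G) : Type u where
  f : X → D.R
  q : {x : X // IsFixed x} → D.Q
  f_smul : ∀ (g : G) x, f (g • x) = D.ρ g (f x)

variable {D} {X Y Z : FinGSet G}

namespace Obj

/-- Composition with an equivariant map. -/
def res (r : X →[G] Y) (w : Obj.{u} D Y) : Obj.{u} D X where
  f x := w.f (r x)
  q x := w.q ⟨r x.1, x.2.map r⟩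
  f_smul g x := by rw [map_smul, w.f_smul]

open Classical in
/-- The value at the orbit of a point. -/
noncomputable def val (w : Obj.{u} D X) (x : X) : D.Q :=
  if h : IsFixed x then w.q ⟨x, h⟩ else D.φ (w.f x)

theorem val_of_isFixed (w : Obj.{u} D X) {x : X} (h : IsFixed x) : w.val x = w.q ⟨x, h⟩ := dif_pos h

theorem val_of_not_isFixed (w : Obj.{u} D X) {x : X} (h : ¬ IsFixed x) : w.val x = D.φ (w.f x) :=
  dif_neg h

theorem val_smul (w : Obj.{u} D X) (g : G) (x : X) : w.val (g • x) = w.val x := by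
  by_cases h : IsFixed x
  · rw [h g]
  · rw [w.val_of_not_isFixed h, w.val_of_not_isFixed fun h' => h h'.of_smul, w.f_smul, D.φ_ρ]

theorem f_map_smul (w : Obj.{u} D X) (P : Bispan X Y) (g : G) (y : Y) :
    ∑ b : {b : P.B // P.t b = g • y}, ∏ a : {a : P.A // P.n a = b.1}, w.f (P.r a.1) =
      D.ρ g (∑ b : {b : P.B // P.t b = y}, ∏ a : {a : P.A // P.n a = b.1}, w.f (P.r a.1)) := by
  rw [map_sum]
  symm
  refine Fintype.sum_bijective (fun b => (⟨g • b.1, by rw [map_smul, b.2]⟩ :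
    {b : P.B // P.t b = g • y})) ⟨?_, ?_⟩ _ _ ?_
  · intro b b' h
    exact Subtype.ext (smul_left_cancel g (congrArg Subtype.val h))
  · rintro ⟨b, hb⟩
    exact ⟨⟨g⁻¹ • b, by rw [map_smul, hb, inv_smul_smul]⟩, Subtype.ext (smul_inv_smul g b)⟩
  rintro ⟨b, hb⟩
  rw [map_prod]
  refine Fintype.prod_bijective (fun a => (⟨g • a.1, by rw [map_smul, a.2]⟩ :
    {a : P.A // P.n a = g • b})) ⟨?_, ?_⟩ _ _ ?_
  · intro b b' h
    exact Subtype.ext (smul_left_cancel g (congrArg Subtype.val h))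
  · rintro ⟨a, ha⟩
    exact ⟨⟨g⁻¹ • a, by rw [map_smul, ha, inv_smul_smul]⟩, Subtype.ext (smul_inv_smul g a)⟩
  · intro a
    rw [map_smul, w.f_smul]

/-- The action of a bispan. -/
noncomputable def map (P : Bispan X Y) (w : Obj.{u} D X) : Obj.{u} D Y where
  f y := ∑ b : {b : P.B // P.t b = y}, ∏ a : {a : P.A // P.n a = b.1}, w.f (P.r a.1)
  q y := ∑ b : {b : P.B // IsFixed b ∧ P.t b = y.1},
    ∏ a : {a : P.A // orbRep a = a ∧ P.n a = b.1}, (w.res P.r).val a.1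
  f_smul := w.f_map_smul P

theorem val_res (w : Obj.{u} D Y) (r : X →[G] Y) (x : X) (h : IsFixed (r x) → IsFixed x) :
    (w.res r).val x = w.val (r x) := by
  by_cases hx : IsFixed x
  · rw [val_of_isFixed _ hx, val_of_isFixed _ (hx.map r)]
    rfl
  · rw [val_of_not_isFixed _ hx, val_of_not_isFixed _ (mt h hx)]
    rfl

/-- An isomorphism need not preserve the chosen orbit representatives, so the products over orbits
are compared through `prod_orbRep`. -/
theorem map_iso (w : Obj.{u} D X) {P Q : Bispan X Y} (h : P.Iso Q) : w.map P = w.map Q := by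
  obtain ⟨e, e', he, he', hr, hn, ht⟩ := h
  ext y
  · refine Fintype.sum_equiv (e'.subtypeEquiv fun b => by rw [ht]) _ _ fun b => ?_
    refine Fintype.prod_equiv (e.subtypeEquiv fun a => ?_) _ _ fun a => ?_
    · rw [hn]
      exact e'.injective.eq_iff.symm
    · exact congrArg w.f (hr a.1).symm
  · have hfix : ∀ b, IsFixed b ↔ IsFixed (e' b) := fun b =>
      forall_congr' fun g => by rw [← he', e'.injective.eq_iff]
    have hfix' : ∀ a, IsFixed (e a) → IsFixed a := fun a h g =>
      e.injective (by rw [he, h g])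
    refine Fintype.sum_equiv (e'.subtypeEquiv fun b => by rw [ht, hfix]) _ _ fun b => ?_
    symm
    refine (prod_orbRep _ (w.res Q.r).val_smul (fun a => Q.n a = e' b.1) (fun g a h => ?_)
      (fun a : {a : P.A // orbRep a = a ∧ P.n a = b.1} => e a.1) (fun a => ?_) (fun a ha => ?_)
      fun a a' g h => ?_).trans (Finset.prod_congr rfl fun a _ => ?_)
    · rw [map_smul, h, ← he', b.2.1 g]
    · rw [hn, a.2.2]
    · obtain ⟨a, rfl⟩ := e.surjective a
      rw [hn, e'.injective.eq_iff] at ha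
      obtain ⟨g, hg⟩ := exists_smul_orbRep a
      refine ⟨⟨orbRep a, orbRep_orbRep a, ?_⟩, g, by rw [← he, hg]⟩
      rw [← hg, map_smul] at ha
      have := IsFixed.of_smul (g := g) (ha ▸ b.2.1)
      rw [← ha, this g]
    · rw [← he, e.injective.eq_iff] at h
      refine Subtype.ext ?_
      rw [← a.2.1, ← a'.2.1, ← h, orbRep_smul]
    · let e₁ : P.A →[G] Q.A := ⟨e, he⟩
      refine ((w.res Q.r).val_res e₁ a.1 (hfix' a.1)).symm.trans ?_
      congr 1
      ext x
      · exact congrArg w.f (hr x)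
      · exact congrArg w.q (Subtype.ext (hr x.1))

theorem map_R (w : Obj.{u} D Y) (r : X →[G] Y) : w.map (Bispan.R r) = w.res r := by
  ext y
  · have : Subsingleton {b : (Bispan.R r).B // (Bispan.R r).t b = y} :=
      ⟨fun a a' => Subtype.ext (a.2.trans a'.2.symm)⟩
    have : Subsingleton {a : (Bispan.R r).A // (Bispan.R r).n a = y} :=
      ⟨fun a a' => Subtype.ext (a.2.trans a'.2.symm)⟩
    refine (Fintype.sum_subsingleton _ (⟨y, rfl⟩ :
      {b : (Bispan.R r).B // (Bispan.R r).t b = y})).trans ?_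
    exact Fintype.prod_subsingleton _ (⟨y, rfl⟩ : {a : (Bispan.R r).A // (Bispan.R r).n a = y})
  · have : Subsingleton {b : (Bispan.R r).B // IsFixed b ∧ (Bispan.R r).t b = y.1} :=
      ⟨fun a a' => Subtype.ext (a.2.2.trans a'.2.2.symm)⟩
    have : Subsingleton {a : (Bispan.R r).A // orbRep a = a ∧ (Bispan.R r).n a = y.1} :=
      ⟨fun a a' => Subtype.ext (a.2.2.trans a'.2.2.symm)⟩
    refine (Fintype.sum_subsingleton _ (⟨y.1, y.2, rfl⟩ :
      {b : (Bispan.R r).B // IsFixed b ∧ (Bispan.R r).t b = y.1})).trans ?_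
    refine (Fintype.prod_subsingleton _ (⟨y.1, y.2.orbRep_eq, rfl⟩ :
      {a : (Bispan.R r).A // orbRep a = a ∧ (Bispan.R r).n a = y.1})).trans ?_
    exact val_of_isFixed _ y.2

end Obj

end GhostData

end

/-! ### Functoriality of the ghost construction -/

section

open Bispan

variable {G : Type} [Group G]

namespace GhostData

variable {D : GhostData G} {X Y Z : FinGSet G}

namespace Obj

/-- Expanding a product of sums over a fibre gives a sum over choices of a summand for each point of
the fibre, and such choices are exactly the sections of lifts. -/
theorem map_comp_f (w : Obj.{u} D X) (P : Bispan X Y) (Q : Bispan Y Z) (z : Z) :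
    (w.map (P.comp Q)).f z = ((w.map P).map Q).f z := by
  classical
  have h1 : ∀ d : {d : Q.B // Q.t d = z},
      (∏ c : {c : Q.A // Q.n c = d.1}, ∑ b : {b : P.B // P.t b = Q.r c.1},
        ∏ a : {a : P.A // P.n a = b.1}, w.f (P.r a.1)) =
      ∑ x : (c : {c : Q.A // Q.n c = d.1}) → {b : P.B // P.t b = Q.r c.1},
        ∏ c, ∏ a : {a : P.A // P.n a = (x c).1}, w.f (P.r a.1) := by
    intro d
    exact Fintype.prod_sum _
  refine Eq.trans ?_ (Finset.sum_congr rfl fun d _ => (h1 d).symm)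
  rw [← Fintype.sum_sigma']
  symm
  refine Fintype.sum_bijective (fun p : (d : {d : Q.B // Q.t d = z}) ×
    ((c : {c : Q.A // Q.n c = d.1}) → {b : P.B // P.t b = Q.r c.1}) =>
      (⟨⟨p.1.1, fun c => (p.2 c).1, fun c => (p.2 c).2⟩, p.1.2⟩ :
        {e : (P.comp Q).B // (P.comp Q).t e = z})) ⟨?_, ?_⟩ _ _ ?_
  · rintro ⟨⟨d, hd⟩, x⟩ ⟨⟨d', hd'⟩, x'⟩ h
    have h0 := congrArg Subtype.val h
    obtain rfl : d = d' := congrArg Lift.base h0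
    obtain rfl : x = x' := funext fun c => Subtype.ext (Lift.sec_eq h0 c.1 c.2 c.2)
    rfl
  · rintro ⟨⟨d, s, hs⟩, hd⟩
    exact ⟨⟨⟨d, hd⟩, fun c => ⟨s c, hs c⟩⟩, rfl⟩
  · rintro ⟨⟨d, hd⟩, x⟩
    rw [← Fintype.prod_sigma']
    refine Fintype.prod_bijective (fun p : (c : {c : Q.A // Q.n c = d}) ×
      {a : P.A // P.n a = (x c).1} => (⟨⟨⟨d, fun c => (x c).1, fun c => (x c).2⟩, p.1.1, p.1.2, p.2.1,
        p.2.2⟩, rfl⟩ : {w : (P.comp Q).A // (P.comp Q).n w =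
          (⟨d, fun c => (x c).1, fun c => (x c).2⟩ : Lift P Q)})) ⟨?_, ?_⟩ _ _ fun _ => rfl
    · rintro ⟨⟨c, hc⟩, ⟨a, ha⟩⟩ ⟨⟨c', hc'⟩, ⟨a', ha'⟩⟩ h
      have h0 := congrArg Subtype.val h
      obtain rfl : c = c' := congrArg LiftPt.pt h0
      obtain rfl : a = a' := congrArg LiftPt.elt h0
      rfl
    · rintro ⟨⟨e, c, hc, a, ha⟩, (rfl : e = _)⟩
      exact ⟨⟨⟨c, hc⟩, ⟨a, ha⟩⟩, rfl⟩

/-- The cases of a fixed and of a free point `c` are written as one sum of products, so that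
distributivity can be applied to a product over both kinds of orbits. -/
theorem val_map (w : Obj.{u} D X) (P : Bispan X Y) {C : FinGSet G} (r : C →[G] Y) (c : C) :
    ((w.map P).res r).val c =
      ∑ b : {b : P.B // (IsFixed c → IsFixed b) ∧ P.t b = r c},
        ∏ a : {a : P.A // (IsFixed c → orbRep a = a) ∧ P.n a = b.1},
          open Classical in if IsFixed c then (w.res P.r).val a.1 else D.φ (w.f (P.r a.1)) := by
  by_cases h : IsFixed c
  · rw [val_of_isFixed _ h]
    refine Fintype.sum_equiv (Equiv.subtypeEquivRight fun b => ?_) _ _ fun b => ?_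
    · simp only [h, true_imp_iff]
    refine Fintype.prod_equiv (Equiv.subtypeEquivRight fun a => ?_) _ _ fun a => ?_
    · simp only [h, true_imp_iff]
      rfl
    · rw [if_pos h]
      rfl
  · rw [val_of_not_isFixed _ h]
    change D.φ (∑ b : {b : P.B // P.t b = r c}, ∏ a : {a : P.A // P.n a = b.1}, w.f (P.r a.1)) = _
    rw [map_sum]
    refine Fintype.sum_equiv (Equiv.subtypeEquivRight fun b => ?_) _ _ fun b => ?_
    · simp only [h, false_imp_iff, true_and]
    rw [map_prod]
    refine Fintype.prod_equiv (Equiv.subtypeEquivRight fun a => ?_) _ _ fun a => ?_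
    · simp only [h, false_imp_iff, true_and]
      rfl
    · rw [if_neg h]
      rfl

/-- Over a fixed lift, a point is fixed exactly when `pt` and `elt` both are. If `pt` is free, the
orbit is free even when `elt` is fixed, so the value goes through `φ`. -/
theorem val_res_comp (w : Obj.{u} D X) (P : Bispan X Y)
    (Q : Bispan Y Z) (v : LiftPt P Q) (hv : IsFixed (X := (P.comp Q).B) v.lift) :
    (w.res (P.comp Q).r).val v =
      open Classical in if IsFixed v.pt then (w.res P.r).val v.elt else D.φ (w.f (P.r v.elt)) := by
  have hpt : IsFixed (X := (P.comp Q).A) v → IsFixed v.pt := fun h g => congrArg LiftPt.pt (h g)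
  have helt : IsFixed (X := (P.comp Q).A) v → IsFixed v.elt := fun h g => congrArg LiftPt.elt (h g)
  by_cases h : IsFixed v.pt
  · rw [if_pos h]
    by_cases h' : IsFixed v.elt
    · have hw : IsFixed (X := (P.comp Q).A) v := fun g => LiftPt.ext' (hv g) (h g) (h' g)
      rw [val_of_isFixed _ h', val_of_isFixed _ hw]
      rfl
    · rw [val_of_not_isFixed _ h', val_of_not_isFixed _ (mt helt h')]
      rfl
  · rw [if_neg h, val_of_not_isFixed _ (mt hpt h)]
    rfl

theorem fixed_sec_smul {P : Bispan X Y} {Q : Bispan Y Z} {e : Lift P Q}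
    (he : IsFixed (X := (P.comp Q).B) e) (g : G) (c : Q.A) (hc : Q.n c = e.base)
    (hc' : Q.n (g • c) = e.base) : e.sec ⟨g • c, hc'⟩ = g • e.sec ⟨c, hc⟩ := by
  have h := Lift.sec_eq (he g) (g • c) (by rw [he g]; exact hc') hc'
  rw [← h]
  exact congrArg (g • ·) (Lift.sec_congr e (inv_smul_smul g c) _ _)

/-- A fixed lift is an equivariant section over the fibre, so it may be prescribed freely on orbit
representatives, provided fixed representatives receive fixed values. -/
theorem exists_fixed_lift (hS : ∀ H : Subgroup G, H = ⊥ ∨ H = ⊤) {P : Bispan X Y} {Q : Bispan Y Z}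
    (d : Q.B) (hd : IsFixed d) (x : (c : {c : Q.A // orbRep c = c ∧ Q.n c = d}) →
      {b : P.B // (IsFixed c.1 → IsFixed b) ∧ P.t b = Q.r c.1}) :
    ∃ s hs, IsFixed (X := (P.comp Q).B) (⟨d, s, hs⟩ : Lift P Q) ∧
      ∀ c (hc : orbRep c = c ∧ Q.n c = d), s ⟨c, hc.2⟩ = (x ⟨c, hc⟩).1 := by
  choose γ hγ using exists_smul_orbRep (X := Q.A)
  have hn : ∀ c, Q.n c = d → Q.n (orbRep c) = d := by
    intro c hc
    rw [← hγ c, map_smul] at hc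
    have := IsFixed.of_smul (g := γ c) (hc ▸ hd)
    rw [← hc, this]
  let rep : (c : Q.A) → Q.n c = d → {c : Q.A // orbRep c = c ∧ Q.n c = d} := fun c hc =>
    ⟨orbRep c, orbRep_orbRep c, hn c hc⟩
  have hrep : ∀ (g : G) c hc hc', rep (g • c) hc' = rep c hc := fun g c hc hc' =>
    Subtype.ext (orbRep_smul g c)
  -- The translate of the prescribed value does not depend on which group element carries the
  -- representative to `c`.
  have key : ∀ (g : G) c hc, g • orbRep c = c → γ c • (x (rep c hc)).1 = g • (x (rep c hc)).1 := by
    intro g c hc h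
    have := smul_eq_of_smul_eq hS (g := g⁻¹ * γ c) (x (rep c hc)).2.1
      (show (g⁻¹ * γ c) • orbRep c = orbRep c by rw [mul_smul, hγ, inv_smul_eq_iff, h])
    rwa [mul_smul, inv_smul_eq_iff] at this
  refine ⟨fun c => γ c.1 • (x (rep c.1 c.2)).1, ?_, ?_, ?_⟩
  · rintro ⟨c, hc⟩
    rw [map_smul, (x _).2.2, ← map_smul]
    exact congrArg Q.r (hγ c)
  · intro g
    refine Lift.ext' (hd g) fun c hc hc' => ?_
    have hg1 : Q.n (g⁻¹ • c) = d := Lift.inv_smul_mem g hc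
    change g • γ (g⁻¹ • c) • (x (rep (g⁻¹ • c) hg1)).1 = γ c • (x (rep c hc')).1
    rw [hrep g⁻¹ c hc' hg1, key (g * γ (g⁻¹ • c)) c hc', mul_smul]
    rw [mul_smul, ← orbRep_smul g⁻¹ c, hγ, smul_inv_smul]
  · intro c hc
    have h1 : rep c hc.2 = ⟨c, hc⟩ := Subtype.ext hc.1
    refine (key 1 c hc.2 (by rw [one_smul, hc.1])).trans ?_
    rw [one_smul, h1]

/-- Distributivity again, over orbits instead of points: fixed lifts correspond to choices on orbit
representatives of the fibre, and the orbits of points over a fixed lift are sorted by the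
representative of their `pt`. -/
theorem map_comp_q (hS : ∀ H : Subgroup G, H = ⊥ ∨ H = ⊤) (w : Obj.{u} D X) (P : Bispan X Y)
    (Q : Bispan Y Z) (z : {z : Z // IsFixed z}) :
    (w.map (P.comp Q)).q z = ((w.map P).map Q).q z := by
  classical
  let m : (c : Q.A) → P.B → D.Q := fun c b =>
    ∏ a : {a : P.A // (IsFixed c → orbRep a = a) ∧ P.n a = b},
      if IsFixed c then (w.res P.r).val a.1 else D.φ (w.f (P.r a.1))
  have h1 : ∀ d : {d : Q.B // IsFixed d ∧ Q.t d = z.1},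
      (∏ c : {c : Q.A // orbRep c = c ∧ Q.n c = d.1}, ((w.map P).res Q.r).val c.1) =
      ∑ x : (c : {c : Q.A // orbRep c = c ∧ Q.n c = d.1}) →
        {b : P.B // (IsFixed c.1 → IsFixed b) ∧ P.t b = Q.r c.1}, ∏ c, m c.1 (x c).1 := by
    intro d
    exact (Finset.prod_congr rfl fun c _ => val_map w P Q.r c.1).trans (Fintype.prod_sum _)
  refine Eq.trans ?_ (Finset.sum_congr rfl fun d _ => (h1 d).symm)
  rw [← Fintype.sum_sigma']
  refine Fintype.sum_bijective (fun e : {e : (P.comp Q).B // IsFixed e ∧ (P.comp Q).t e = z.1} =>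
    (⟨⟨e.1.base, fun g => congrArg Lift.base (e.2.1 g), e.2.2⟩, fun c => ⟨e.1.sec ⟨c.1, c.2.2⟩,
      fun hc g => ?_, e.1.compat _⟩⟩ : (d : {d : Q.B // IsFixed d ∧ Q.t d = z.1}) ×
        ((c : {c : Q.A // orbRep c = c ∧ Q.n c = d.1}) →
          {b : P.B // (IsFixed c.1 → IsFixed b) ∧ P.t b = Q.r c.1}))) ⟨?_, ?_⟩ _ _ ?_
  · refine (fixed_sec_smul e.2.1 g c.1 c.2.2 (by rw [hc g]; exact c.2.2)).symm.trans ?_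
    exact Lift.sec_congr e.1 (hc g) _ _
  · rintro ⟨⟨d, s, hs⟩, he⟩ ⟨⟨d', s', hs'⟩, he'⟩ h
    obtain rfl : d = d' := congrArg (fun p => p.1.1) h
    have h2 := fun c => congrArg Subtype.val (congrFun (eq_of_heq (Sigma.mk.inj h).2) c)
    refine Subtype.ext (Lift.ext' rfl fun c hc _ => ?_)
    obtain ⟨g, hg⟩ := exists_smul_orbRep c
    have hc' : Q.n (orbRep c) = d := by
      rw [← hg, map_smul] at hc
      have h3 : IsFixed d := fun g => congrArg Lift.base (he.1 g)
      have := IsFixed.of_smul (g := g) (show IsFixed (g • Q.n (orbRep c)) from hc ▸ h3)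
      exact (this g).symm.trans hc
    have h4 := h2 ⟨orbRep c, orbRep_orbRep c, hc'⟩
    have h5 := fixed_sec_smul he.1 g (orbRep c) hc' (by rw [hg]; exact hc)
    have h6 := fixed_sec_smul he'.1 g (orbRep c) hc' (by rw [hg]; exact hc)
    refine (Lift.sec_congr _ hg.symm _ (by rw [hg]; exact hc)).trans (h5.trans ?_)
    refine Eq.trans ?_ (h6.symm.trans (Lift.sec_congr _ hg _ _))
    exact congrArg (g • ·) h4
  · rintro ⟨⟨d, hd, hz⟩, x⟩
    obtain ⟨s, hs, hfix, hsx⟩ := exists_fixed_lift hS d hd x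
    refine ⟨⟨⟨d, s, hs⟩, hfix, hz⟩, ?_⟩
    refine Sigma.ext rfl (heq_of_eq (funext fun c => Subtype.ext (hsx c.1 c.2)))
  · rintro ⟨e, he, hz⟩
    have hbase : IsFixed e.base := fun g => congrArg Lift.base (he g)
    rw [← Fintype.prod_sigma']
    refine (prod_orbRep _ (w.res (P.comp Q).r).val_smul (fun v => (P.comp Q).n v = e)
      (fun g v h => by rw [map_smul, h, he g])
      (fun p : (c : {c : Q.A // orbRep c = c ∧ Q.n c = e.base}) ×
        {a : P.A // (IsFixed c.1 → orbRep a = a) ∧ P.n a = e.sec ⟨c.1, c.2.2⟩} =>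
          (⟨e, p.1.1, p.1.2.2, p.2.1, p.2.2.2⟩ : LiftPt P Q)) (fun _ => rfl) ?_ ?_).trans ?_
    · rintro ⟨e', c, hc, a, ha⟩ (rfl : e' = e)
      obtain ⟨g, hg⟩ := exists_smul_orbRep c
      have hc' : Q.n (orbRep c) = e'.base := by
        rw [← hg, map_smul] at hc
        have := IsFixed.of_smul (g := g) (show IsFixed (g • Q.n (orbRep c)) from hc ▸ hbase)
        exact (this g).symm.trans hc
      have ha' : P.n (g⁻¹ • a) = e'.sec ⟨orbRep c, hc'⟩ := by
        rw [map_smul, ha, inv_smul_eq_iff]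
        refine Eq.trans ?_ (fixed_sec_smul he g (orbRep c) hc' (by rw [hg]; exact hc))
        exact Lift.sec_congr e' hg.symm _ _
      -- Over a fixed representative all of `G` remains available to move `a` to its own
      -- representative. Over a free one the translation is already determined by `c`, and `a` stays
      -- arbitrary.
      by_cases h : IsFixed (orbRep c)
      · obtain ⟨k, hk⟩ := exists_smul_orbRep (g⁻¹ • a)
        have hsf : ∀ k : G, k • e'.sec ⟨orbRep c, hc'⟩ = e'.sec ⟨orbRep c, hc'⟩ := fun k =>
          (fixed_sec_smul he k (orbRep c) hc' (by rw [h k]; exact hc')).symm.trans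
            (Lift.sec_congr e' (h k) _ _)
        refine ⟨⟨⟨orbRep c, orbRep_orbRep c, hc'⟩, ⟨orbRep (g⁻¹ • a), fun _ => orbRep_orbRep _, ?_⟩⟩,
          g * k, LiftPt.ext' (he _) ?_ ?_⟩
        · rw [← hk, map_smul, ← eq_inv_smul_iff] at ha'
          rw [ha', hsf]
        · change (g * k) • orbRep c = c
          rw [mul_smul, h k, hg]
        · change (g * k) • orbRep (g⁻¹ • a) = a
          rw [mul_smul, hk, smul_inv_smul]
      · refine ⟨⟨⟨orbRep c, orbRep_orbRep c, hc'⟩, ⟨g⁻¹ • a, fun h' => absurd h' h, ha'⟩⟩,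
          g, LiftPt.ext' (he _) hg (smul_inv_smul g a)⟩
    · rintro ⟨⟨c, hc, hc'⟩, ⟨a, ha, ha'⟩⟩ ⟨⟨c₂, hc₂, hc₂'⟩, ⟨a₂, ha₂, ha₂'⟩⟩ g h
      have h1 : g • c = c₂ := congrArg LiftPt.pt h
      have h2 : g • a = a₂ := congrArg LiftPt.elt h
      obtain rfl : c = c₂ := by rw [← hc, ← hc₂, ← h1, orbRep_smul]
      obtain rfl : a = a₂ := by
        by_cases hf : IsFixed c
        · rw [← ha hf, ← ha₂ hf, ← h2, orbRep_smul]
        · rw [← h2, eq_one_of_not_isFixed hS hf h1, one_smul]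
      rfl
    · refine Finset.prod_congr rfl fun p _ => ?_
      refine (val_res_comp w P Q _ he).trans ?_
      rfl

theorem map_comp (hS : ∀ H : Subgroup G, H = ⊥ ∨ H = ⊤) (w : Obj.{u} D X) (P : Bispan X Y)
    (Q : Bispan Y Z) : w.map (P.comp Q) = (w.map P).map Q := by
  ext z
  · exact w.map_comp_f P Q z
  · exact w.map_comp_q hS P Q z

end Obj

end GhostData

end

/-! ### The ring structure and the ghost Tambara functor -/

section

open Bispan

variable {G : Type} [Group G]

namespace FinGSet

/-- The predicate `p` is left abstract so that it can include the redundant requirement of being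
fixed or of being an orbit representative. -/
theorem sum_fiber_fold {M : Type*} [AddCommMonoid M] {X : FinGSet G} (p : sum X X → Prop) (x : X)
    (hp : ∀ z, p z ↔ fold X z = x) (v : sum X X → M) :
    ∑ z : {z : sum X X // p z}, v z.1 = v (inl X X x) + v (inr X X x) := by
  refine Fintype.sum_eq_add (⟨inl X X x, (hp _).mpr rfl⟩ : {z : sum X X // p z})
    ⟨inr X X x, (hp _).mpr rfl⟩ (fun h => Sum.inl_ne_inr (congrArg Subtype.val h)) ?_
  rintro ⟨z, hz⟩ ⟨h1, h2⟩
  have hz' := (hp z).mp hz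
  change X ⊕ X at z
  rcases z with z | z
  · obtain rfl : z = x := hz'
    exact absurd rfl h1
  · obtain rfl : z = x := hz'
    exact absurd rfl h2

theorem prod_fiber_fold {M : Type*} [CommMonoid M] {X : FinGSet G} (p : sum X X → Prop) (x : X)
    (hp : ∀ z, p z ↔ fold X z = x) (v : sum X X → M) :
    ∏ z : {z : sum X X // p z}, v z.1 = v (inl X X x) * v (inr X X x) :=
  sum_fiber_fold (M := Additive M) p x hp v

end FinGSet

namespace GhostData

variable {D : GhostData G} {X Y Z : FinGSet G}

namespace Obj

instance : Zero (Obj.{u} D X) := ⟨⟨fun _ => 0, fun _ => 0, fun _ _ => (map_zero _).symm⟩⟩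

instance : One (Obj.{u} D X) := ⟨⟨fun _ => 1, fun _ => 1, fun _ _ => (map_one _).symm⟩⟩

instance : Add (Obj.{u} D X) := ⟨fun w v => ⟨fun x => w.f x + v.f x, fun x => w.q x + v.q x,
  fun g x => by rw [w.f_smul, v.f_smul, map_add]⟩⟩

instance : Mul (Obj.{u} D X) := ⟨fun w v => ⟨fun x => w.f x * v.f x, fun x => w.q x * v.q x,
  fun g x => by rw [w.f_smul, v.f_smul, map_mul]⟩⟩

instance : Neg (Obj.{u} D X) := ⟨fun w => ⟨fun x => -w.f x, fun x => -w.q x,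
  fun g x => by rw [w.f_smul, map_neg]⟩⟩

noncomputable instance : CommRing (Obj.{u} D X) :=
  CommRing.ofMinimalAxioms
    (fun _ _ _ => Obj.ext (funext fun _ => add_assoc _ _ _) (funext fun _ => add_assoc _ _ _))
    (fun _ => Obj.ext (funext fun _ => zero_add _) (funext fun _ => zero_add _))
    (fun _ => Obj.ext (funext fun _ => neg_add_cancel _) (funext fun _ => neg_add_cancel _))
    (fun _ _ _ => Obj.ext (funext fun _ => mul_assoc _ _ _) (funext fun _ => mul_assoc _ _ _))
    (fun _ _ => Obj.ext (funext fun _ => mul_comm _ _) (funext fun _ => mul_comm _ _))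
    (fun _ => Obj.ext (funext fun _ => one_mul _) (funext fun _ => one_mul _))
    (fun _ _ _ => Obj.ext (funext fun _ => mul_add _ _ _) (funext fun _ => mul_add _ _ _))

/-- Evaluation of the second component at a fixed point. -/
def qHom (x : {x : X // IsFixed x}) : Obj.{u} D X →+* D.Q where
  toFun w := w.q x
  map_one' := rfl
  map_mul' _ _ := rfl
  map_zero' := rfl
  map_add' _ _ := rfl

instance : Subsingleton (Obj.{u} D (empty G)) :=
  ⟨fun _ _ => Obj.ext (funext fun x => isEmptyElim x)
    (funext fun x => isEmptyElim (α := empty G) x.1)⟩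

end Obj

variable (D)

/-- The Tambara functor attached to `D`, for `G` of prime order. -/
noncomputable def functor (hS : ∀ H : Subgroup G, H = ⊥ ∨ H = ⊤) : TambaraFunctor.{u} G where
  obj X := Obj.{u} D X
  map P w := w.map P
  map_iso h := funext fun w => w.map_iso h
  map_id X w := w.map_R (.id G)
  map_comp P Q w := w.map_comp hS P Q
  nonempty_empty := ⟨0⟩
  subsingleton_empty := inferInstance
  bijective_sum X Y := by
    simp only [Obj.map_R]
    constructor
    · intro w v h
      have h1 := congrArg Prod.fst h
      have h2 := congrArg Prod.snd h
      refine Obj.ext (funext ?_) (funext ?_)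
      · rintro (x | y)
        · exact congrFun (congrArg Obj.f h1) x
        · exact congrFun (congrArg Obj.f h2) y
      · rintro ⟨x | y, hz⟩
        · exact congrFun (congrArg Obj.q h1) ⟨x, fun g => Sum.inl_injective (hz g)⟩
        · exact congrFun (congrArg Obj.q h2) ⟨y, fun g => Sum.inr_injective (hz g)⟩
    · rintro ⟨w, v⟩
      refine ⟨⟨fun z => Sum.elim w.f v.f z, fun z => match z with
        | ⟨Sum.inl x, hx⟩ => w.q ⟨x, fun g => Sum.inl_injective (hx g)⟩
        | ⟨Sum.inr y, hy⟩ => v.q ⟨y, fun g => Sum.inr_injective (hy g)⟩, ?_⟩, ?_⟩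
      · rintro g (x | y)
        · exact w.f_smul g x
        · exact v.f_smul g y
      · rfl
  ring X := inferInstance
  map_zero X z := by
    refine Obj.ext (funext fun y => ?_) (funext fun y => ?_)
    · exact Finset.sum_eq_zero fun b _ => isEmptyElim (α := empty G) b.1
    · exact Finset.sum_eq_zero fun b _ => isEmptyElim (α := empty G) b.1
  map_one X z := by
    refine Obj.ext (funext fun y => ?_) (funext fun y => ?_)
    · have : Subsingleton {b : (Bispan.N (fromEmpty X)).B // (Bispan.N (fromEmpty X)).t b = y} :=
        ⟨fun a a' => Subtype.ext (a.2.trans a'.2.symm)⟩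
      refine (Fintype.sum_subsingleton _ (⟨y, rfl⟩ : {b : (Bispan.N (fromEmpty X)).B //
        (Bispan.N (fromEmpty X)).t b = y})).trans ?_
      exact Finset.prod_eq_one fun a _ => isEmptyElim (α := empty G) a.1
    · have : Subsingleton {b : (Bispan.N (fromEmpty X)).B // IsFixed b ∧
          (Bispan.N (fromEmpty X)).t b = y.1} :=
        ⟨fun a a' => Subtype.ext (a.2.2.trans a'.2.2.symm)⟩
      refine (Fintype.sum_subsingleton _ (⟨y.1, y.2, rfl⟩ : {b : (Bispan.N (fromEmpty X)).B //
        IsFixed b ∧ (Bispan.N (fromEmpty X)).t b = y.1})).trans ?_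
      exact Finset.prod_eq_one fun a _ => isEmptyElim (α := empty G) a.1
  map_add X z := by
    rw [Obj.map_R, Obj.map_R]
    refine Obj.ext (funext fun y => ?_) (funext fun y => ?_)
    · refine (Finset.sum_congr rfl fun b _ => ?_).trans
        (sum_fiber_fold (fun b => fold X b = y) y (fun _ => Iff.rfl) z.f)
      have : Subsingleton {a : (Bispan.T (fold X)).A // (Bispan.T (fold X)).n a = b.1} :=
        ⟨fun a a' => Subtype.ext (a.2.trans a'.2.symm)⟩
      exact Fintype.prod_subsingleton _ (⟨b.1, rfl⟩ :
        {a : (Bispan.T (fold X)).A // (Bispan.T (fold X)).n a = b.1})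
    · have hfix : ∀ b, fold X b = y.1 → IsFixed b := by
        rintro (b | b) h g
        · exact congrArg Sum.inl (((h : b = y.1) ▸ y.2) g)
        · exact congrArg Sum.inr (((h : b = y.1) ▸ y.2) g)
      refine (Finset.sum_congr rfl fun b _ => ?_).trans
        ((sum_fiber_fold (fun b => IsFixed b ∧ fold X b = y.1) y.1
          (fun b => ⟨And.right, fun h => ⟨hfix b h, h⟩⟩) z.val).trans ?_)
      · have : Subsingleton {a : (Bispan.T (fold X)).A // orbRep a = a ∧
            (Bispan.T (fold X)).n a = b.1} :=
          ⟨fun a a' => Subtype.ext (a.2.2.trans a'.2.2.symm)⟩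
        exact Fintype.prod_subsingleton _ (⟨b.1, b.2.1.orbRep_eq, rfl⟩ :
          {a : (Bispan.T (fold X)).A // orbRep a = a ∧ (Bispan.T (fold X)).n a = b.1})
      · rw [z.val_of_isFixed (hfix _ rfl), z.val_of_isFixed (hfix _ rfl)]
        rfl
  map_mul X z := by
    rw [Obj.map_R, Obj.map_R]
    refine Obj.ext (funext fun y => ?_) (funext fun y => ?_)
    · have : Subsingleton {b : (Bispan.N (fold X)).B // (Bispan.N (fold X)).t b = y} :=
        ⟨fun a a' => Subtype.ext (a.2.trans a'.2.symm)⟩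
      refine (Fintype.sum_subsingleton _ (⟨y, rfl⟩ : {b : (Bispan.N (fold X)).B //
        (Bispan.N (fold X)).t b = y})).trans ?_
      exact prod_fiber_fold (fun b => fold X b = y) y (fun _ => Iff.rfl) z.f
    · have hfix : ∀ b, fold X b = y.1 → IsFixed b := by
        rintro (b | b) h g
        · exact congrArg Sum.inl (((h : b = y.1) ▸ y.2) g)
        · exact congrArg Sum.inr (((h : b = y.1) ▸ y.2) g)
      have : Subsingleton {b : (Bispan.N (fold X)).B // IsFixed b ∧
          (Bispan.N (fold X)).t b = y.1} :=
        ⟨fun a a' => Subtype.ext (a.2.2.trans a'.2.2.symm)⟩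
      refine (Fintype.sum_subsingleton _ (⟨y.1, y.2, rfl⟩ : {b : (Bispan.N (fold X)).B //
        IsFixed b ∧ (Bispan.N (fold X)).t b = y.1})).trans ?_
      refine (prod_fiber_fold (fun b => orbRep b = b ∧ fold X b = y.1) y.1
        (fun b => ⟨And.right, fun h => ⟨(hfix b h).orbRep_eq, h⟩⟩) z.val).trans ?_
      rw [z.val_of_isFixed (hfix _ rfl), z.val_of_isFixed (hfix _ rfl)]
      rfl

end GhostData

end

/-! ### Existence of free Tambara functors -/

section

open Bispan

variable {G : Type} [Group G]

/-- Finite `G`-sets with underlying set `Fin n`. -/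
structure SkelGSet (G : Type) [Group G] : Type where
  n : ℕ
  act : MulAction G (Fin n)

namespace SkelGSet

/-- The underlying finite `G`-set. -/
def toGSet (S : SkelGSet G) : FinGSet G :=
  letI := S.act
  ⟨Fin S.n⟩

theorem exists_iso (X : FinGSet G) : ∃ (S : SkelGSet G) (e : X →[G] S.toGSet) (e' : S.toGSet →[G] X),
    e'.comp e = .id G ∧ e.comp e' = .id G := by
  obtain ⟨n, ⟨f⟩⟩ := Finite.exists_equiv_fin X
  let act : MulAction G (Fin n) :=
    { smul := fun g i => f (g • f.symm i)
      one_smul := fun i => by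
        change f ((1 : G) • f.symm i) = i
        simp
      mul_smul := fun g h i => by
        change f ((g * h) • f.symm i) = f (g • f.symm (f (h • f.symm i)))
        simp [mul_smul] }
  refine ⟨⟨n, act⟩, ⟨f, fun g x => ?_⟩, ⟨f.symm, fun g x => ?_⟩, ?_, ?_⟩
  · change f (g • x) = f (g • f.symm (f x))
    simp
  · change f.symm (f (g • f.symm x)) = g • f.symm x
    simp
  · ext x
    exact f.symm_apply_apply x
  · ext x
    exact f.apply_symm_apply x

end SkelGSet

namespace TambaraFunctor

/-- The values `S(Y)` for all Tambara functors `S` with a chosen element of `S(X)`. -/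
abbrev Universal (X : FinGSet G) (Y : FinGSet G) : Type (u + 1) :=
  ∀ (S : TambaraFunctor.{u} G), S.obj X → S.obj Y

/-- The families generated by the chosen element. -/
inductive Generated (X : FinGSet G) : ∀ Y : FinGSet G, Universal.{u} X Y → Prop
  | var : Generated X X fun _ x => x
  | map {Y Z : FinGSet G} (P : Bispan Y Z) (w : Universal.{u} X Y) :
      Generated X Y w → Generated X Z fun S x => S.map P (w S x)
  | neg {Y : FinGSet G} (w : Universal.{u} X Y) : Generated X Y w → Generated X Y fun S x => -w S x
  | pair {Y Z : FinGSet G} (w : Universal.{u} X Y) (v : Universal.{u} X Z)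
      (z : Universal.{u} X (sum Y Z)) : Generated X Y w → Generated X Z v →
      (∀ S x, S.res (inl Y Z) (z S x) = w S x) → (∀ S x, S.res (inr Y Z) (z S x) = v S x) →
      Generated X (sum Y Z) z

/-- Formal expressions in one variable over `X`. -/
inductive Term (X : FinGSet G) : SkelGSet G → Type
  | var {Y : SkelGSet G} (f : Y.toGSet →[G] X) : Term X Y
  | map {Y Z A B : SkelGSet G} (r : A.toGSet →[G] Y.toGSet) (n : A.toGSet →[G] B.toGSet)
      (t : B.toGSet →[G] Z.toGSet) : Term X Y → Term X Z
  | neg {Y : SkelGSet G} : Term X Y → Term X Y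
  | pair {Y Z W : SkelGSet G} (f : W.toGSet →[G] sum Y.toGSet Z.toGSet) :
      Term X Y → Term X Z → Term X W

variable {X Y Z : FinGSet G}

theorem map_res_eq_of_iso (S : TambaraFunctor.{u} G) {A B Y' : FinGSet G} (P : Bispan Y Z)
    (eA : P.A →[G] A) (eA' : A →[G] P.A) (eB : P.B →[G] B) (eB' : B →[G] P.B)
    (hA : eA'.comp eA = .id G) (hA' : eA.comp eA' = .id G)
    (hB : eB'.comp eB = .id G) (hB' : eB.comp eB' = .id G) (e : Y →[G] Y') (x : S.obj Y') :
    S.map P (S.res e x) = S.map ⟨A, B, (e.comp P.r).comp eA', (eB.comp P.n).comp eA',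
      P.t.comp eB'⟩ x := by
  rw [S.map_res]
  refine congrFun (S.map_iso (Iso.of_bijective
    (P := ⟨P.A, P.B, e.comp P.r, P.n, P.t⟩) (Q := ⟨A, B, (e.comp P.r).comp eA', (eB.comp P.n).comp eA',
      P.t.comp eB'⟩) eA eB
    ⟨Function.LeftInverse.injective fun a => DFunLike.congr_fun hA a,
      Function.RightInverse.surjective fun a => DFunLike.congr_fun hA' a⟩
    ⟨Function.LeftInverse.injective fun a => DFunLike.congr_fun hB a,
      Function.RightInverse.surjective fun a => DFunLike.congr_fun hB' a⟩ ?_ ?_ ?_)) x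
  · exact fun a => congrArg (e.comp P.r) (DFunLike.congr_fun hA a)
  · exact fun a => congrArg (eB.comp P.n) (DFunLike.congr_fun hA a)
  · exact fun a => congrArg P.t (DFunLike.congr_fun hB a)

theorem exists_pairing (w : Universal.{u} X Y) (v : Universal.{u} X Z) :
    ∃ z : Universal.{u} X (sum Y Z), (∀ S x, S.res (inl Y Z) (z S x) = w S x) ∧
      ∀ S x, S.res (inr Y Z) (z S x) = v S x := by
  choose z hz hz' using fun (S : TambaraFunctor.{u} G) (x : S.obj X) =>
    S.exists_pair (w S x) (v S x)
  exact ⟨z, hz, hz'⟩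

/-- The element with given components. -/
noncomputable def pairing (w : Universal.{u} X Y) (v : Universal.{u} X Z) :
    Universal.{u} X (sum Y Z) := (exists_pairing w v).choose

theorem res_inl_pairing (w : Universal.{u} X Y) (v : Universal.{u} X Z) (S : TambaraFunctor.{u} G)
    (x : S.obj X) : S.res (inl Y Z) (pairing w v S x) = w S x :=
  (exists_pairing w v).choose_spec.1 S x

theorem res_inr_pairing (w : Universal.{u} X Y) (v : Universal.{u} X Z) (S : TambaraFunctor.{u} G)
    (x : S.obj X) : S.res (inr Y Z) (pairing w v S x) = v S x :=
  (exists_pairing w v).choose_spec.2 S x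

theorem pair_ext (S : TambaraFunctor.{u} G) {a b : S.obj (sum Y Z)}
    (h : S.res (inl Y Z) a = S.res (inl Y Z) b) (h' : S.res (inr Y Z) a = S.res (inr Y Z) b) :
    a = b := (S.bijective_sum Y Z).1 (Prod.ext h h')

/-- Evaluation of formal expressions. -/
noncomputable def Term.eval {X : FinGSet G} : ∀ {Y : SkelGSet G}, Term X Y → Universal.{u} X Y.toGSet
  | _, .var f => fun S x => S.res f x
  | _, .map r n t a => fun S x => S.map ⟨_, _, r, n, t⟩ (a.eval S x)
  | _, .neg a => fun S x => -a.eval S x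
  | _, .pair f a b => fun S x => S.res f (pairing a.eval b.eval S x)

/-- This controls size. Replacing every `G`-set in a derivation by an isomorphic one on some `Fin n`
turns a generated family into the evaluation of a formal term, and the terms over a fixed skeletal
set form a type in the lowest universe. -/
theorem Generated.exists_term {w : Universal.{u} X Y} (h : Generated X Y w) :
    ∀ (K : SkelGSet G) (e : Y →[G] K.toGSet) (e' : K.toGSet →[G] Y), e'.comp e = .id G →
      e.comp e' = .id G → ∃ a : Term X K, ∀ S x, w S x = S.res e (a.eval S x) := by
  induction h with
  | var =>
    intro K e e' he he'
    refine ⟨.var e', fun S x => ?_⟩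
    rw [Term.eval, ← res_comp, he, res_id]
  | @map Y Z P w _ ih =>
    intro K e e' he he'
    obtain ⟨Y', f, f', hf, hf'⟩ := SkelGSet.exists_iso Y
    obtain ⟨A, eA, eA', hA, hA'⟩ := SkelGSet.exists_iso P.A
    obtain ⟨B, eB, eB', hB, hB'⟩ := SkelGSet.exists_iso P.B
    obtain ⟨a, ha⟩ := ih Y' f f' hf hf'
    refine ⟨.map ((f.comp P.r).comp eA') ((eB.comp P.n).comp eA') ((e.comp P.t).comp eB') a,
      fun S x => ?_⟩
    rw [Term.eval]
    beta_reduce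
    rw [ha]
    have h1 := S.map_res_eq_of_iso ⟨P.A, P.B, P.r, P.n, e.comp P.t⟩ eA eA' eB eB' hA hA' hB hB' f
      (a.eval S x)
    refine Eq.trans ?_ (congrArg (S.res e) h1)
    rw [← tr_map]
    symm
    refine (S.res_map (Bispan.T e) e (Bispan.id Z) (.id G) (.id G) (fun _ => rfl) (fun _ => rfl)
      (fun _ => rfl) ?_ ?_ _).trans (S.map_id _ _)
    · intro b v hbv
      have h2 : b = v := (DFunLike.congr_fun he b).symm.trans
        ((congrArg e' hbv).trans (DFunLike.congr_fun he v))
      exact ⟨b, ⟨rfl, h2⟩, fun y hy => hy.1⟩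
    · intro a b hab
      exact ⟨a, ⟨rfl, hab⟩, fun y hy => hy.1⟩
  | neg w _ ih =>
    intro K e e' he he'
    obtain ⟨a, ha⟩ := ih K e e' he he'
    refine ⟨.neg a, fun S x => ?_⟩
    rw [Term.eval]
    beta_reduce
    rw [ha, ← resHom_apply, ← resHom_apply, _root_.map_neg]
  | @pair Y Z w v z _ _ hz hz' ih ih' =>
    intro K e e' he he'
    obtain ⟨Y', f, f', hf, hf'⟩ := SkelGSet.exists_iso Y
    obtain ⟨Z', k, k', hk, hk'⟩ := SkelGSet.exists_iso Z
    obtain ⟨a, ha⟩ := ih Y' f f' hf hf'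
    obtain ⟨b, hb⟩ := ih' Z' k k' hk hk'
    refine ⟨.pair ((sumMap f k).comp e') a b, fun S x => ?_⟩
    rw [Term.eval, ← res_comp]
    have h1 : ((sumMap f k).comp e').comp e = sumMap f k := by
      ext y
      exact congrArg (sumMap f k) (DFunLike.congr_fun he y)
    rw [h1]
    refine S.pair_ext ?_ ?_
    · rw [hz, ha, ← res_comp, ← res_inl_pairing a.eval b.eval S x, ← res_comp]
      rfl
    · rw [hz', hb, ← res_comp, ← res_inr_pairing a.eval b.eval S x, ← res_comp]
      rfl

/-- A family is determined by a term evaluating to it, so families inject into terms although each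
family ranges over a whole universe of Tambara functors. -/
instance (X Y : FinGSet G) : Small.{u} {w : Universal.{u} X Y // Generated X Y w} := by
  obtain ⟨K, e, e', he, he'⟩ := SkelGSet.exists_iso Y
  choose a ha using fun w : {w : Universal.{u} X Y // Generated X Y w} =>
    w.2.exists_term K e e' he he'
  have : Small.{u} (Term X K) := inferInstance
  refine small_of_injective (f := a) fun w v h => Subtype.ext ?_
  funext S x
  rw [ha w, ha v, h]

/-- The values of the free Tambara functor. -/
def FreeObj (X Y : FinGSet G) : Type u := Shrink.{u} {w : Universal.{u} X Y // Generated X Y w}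

namespace FreeObj

/-- The element given by a generated family. -/
noncomputable def mk (w : Universal.{u} X Y) (h : Generated X Y w) : FreeObj.{u} X Y :=
  equivShrink _ ⟨w, h⟩

/-- Evaluation at an element of a Tambara functor. -/
noncomputable def ev (a : FreeObj.{u} X Y) : Universal.{u} X Y := ((equivShrink _).symm a).1

theorem generated (a : FreeObj.{u} X Y) : Generated X Y a.ev := ((equivShrink _).symm a).2

theorem ev_mk (w : Universal.{u} X Y) (h : Generated X Y w) : (mk w h).ev = w := by
  rw [ev, mk, Equiv.symm_apply_apply]

theorem ext {a b : FreeObj.{u} X Y} (h : ∀ S x, a.ev S x = b.ev S x) : a = b := by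
  refine (equivShrink _).symm.injective (Subtype.ext ?_)
  funext S x
  exact h S x

/-- The action of a bispan. -/
noncomputable def map (P : Bispan Y Z) (a : FreeObj.{u} X Y) : FreeObj.{u} X Z :=
  mk _ (Generated.map P a.ev a.generated)

theorem ev_map (P : Bispan Y Z) (a : FreeObj.{u} X Y) (S : TambaraFunctor.{u} G) (x : S.obj X) :
    (a.map P).ev S x = S.map P (a.ev S x) := by
  rw [map, ev_mk]

/-- The element with given components. -/
noncomputable def pair (a : FreeObj.{u} X Y) (b : FreeObj.{u} X Z) : FreeObj.{u} X (sum Y Z) :=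
  mk _ (Generated.pair a.ev b.ev (pairing a.ev b.ev) a.generated b.generated
    (res_inl_pairing _ _) (res_inr_pairing _ _))

theorem res_inl_ev_pair (a : FreeObj.{u} X Y) (b : FreeObj.{u} X Z) (S : TambaraFunctor.{u} G)
    (x : S.obj X) : S.res (inl Y Z) ((a.pair b).ev S x) = a.ev S x := by
  rw [pair, ev_mk, res_inl_pairing]

theorem res_inr_ev_pair (a : FreeObj.{u} X Y) (b : FreeObj.{u} X Z) (S : TambaraFunctor.{u} G)
    (x : S.obj X) : S.res (inr Y Z) ((a.pair b).ev S x) = b.ev S x := by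
  rw [pair, ev_mk, res_inr_pairing]

/-- The chosen element over the empty set. -/
noncomputable def pt (X : FinGSet G) : FreeObj.{u} X (empty G) :=
  mk _ (Generated.map (R (fromEmpty X)) _ .var)

noncomputable instance : Zero (FreeObj.{u} X Y) := ⟨(pt X).map (Bispan.T (fromEmpty Y))⟩

noncomputable instance : One (FreeObj.{u} X Y) := ⟨(pt X).map (Bispan.N (fromEmpty Y))⟩

noncomputable instance : Add (FreeObj.{u} X Y) := ⟨fun a b => (a.pair b).map (Bispan.T (fold Y))⟩

noncomputable instance : Mul (FreeObj.{u} X Y) := ⟨fun a b => (a.pair b).map (Bispan.N (fold Y))⟩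

noncomputable instance : Neg (FreeObj.{u} X Y) := ⟨fun a => mk _ (Generated.neg a.ev a.generated)⟩

variable (S : TambaraFunctor.{u} G) (x : S.obj X)

theorem ev_zero : (0 : FreeObj.{u} X Y).ev S x = 0 :=
  (ev_map _ _ S x).trans (S.map_zero Y _)

theorem ev_one : (1 : FreeObj.{u} X Y).ev S x = 1 :=
  (ev_map _ _ S x).trans (S.map_one Y _)

theorem ev_add (a b : FreeObj.{u} X Y) : (a + b).ev S x = a.ev S x + b.ev S x :=
  (ev_map _ _ S x).trans ((S.map_add Y _).trans
    (congrArg₂ (· + ·) (res_inl_ev_pair a b S x) (res_inr_ev_pair a b S x)))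

theorem ev_mul (a b : FreeObj.{u} X Y) : (a * b).ev S x = a.ev S x * b.ev S x :=
  (ev_map _ _ S x).trans ((S.map_mul Y _).trans
    (congrArg₂ (· * ·) (res_inl_ev_pair a b S x) (res_inr_ev_pair a b S x)))

theorem ev_neg (a : FreeObj.{u} X Y) : (-a).ev S x = -a.ev S x :=
  congrFun (congrFun (ev_mk _ (Generated.neg a.ev a.generated)) S) x

noncomputable instance : CommRing (FreeObj.{u} X Y) :=
  CommRing.ofMinimalAxioms
    (fun a b c => ext fun S x => by simp only [ev_add, add_assoc])
    (fun a => ext fun S x => by rw [ev_add, ev_zero, zero_add])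
    (fun a => ext fun S x => by rw [ev_add, ev_neg, ev_zero, neg_add_cancel])
    (fun a b c => ext fun S x => by simp only [ev_mul, mul_assoc])
    (fun a b => ext fun S x => by simp only [ev_mul, mul_comm])
    (fun a => ext fun S x => by rw [ev_mul, ev_one, one_mul])
    (fun a b c => ext fun S x => by simp only [ev_mul, ev_add, mul_add])

end FreeObj

/-- The free Tambara functor on `X`. -/
noncomputable def free (X : FinGSet G) : TambaraFunctor.{u} G where
  obj Y := FreeObj.{u} X Y
  map P a := a.map P
  map_iso h := funext fun a => FreeObj.ext fun S x => by
    rw [FreeObj.ev_map, FreeObj.ev_map, S.map_iso h]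
  map_id Y a := FreeObj.ext fun S x => by rw [FreeObj.ev_map, S.map_id]
  map_comp P Q a := FreeObj.ext fun S x => by
    rw [FreeObj.ev_map, FreeObj.ev_map, FreeObj.ev_map, S.map_comp]
  nonempty_empty := ⟨0⟩
  subsingleton_empty := ⟨fun a b => FreeObj.ext fun S x =>
    (S.subsingleton_empty).elim _ _⟩
  bijective_sum Y Z := by
    constructor
    · intro a b h
      refine FreeObj.ext fun S x => S.pair_ext ?_ ?_
      · rw [res, ← FreeObj.ev_map, ← FreeObj.ev_map]
        exact congrArg (fun c => c.ev S x) (congrArg Prod.fst h)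
      · rw [res, ← FreeObj.ev_map, ← FreeObj.ev_map]
        exact congrArg (fun c => c.ev S x) (congrArg Prod.snd h)
    · rintro ⟨a, b⟩
      refine ⟨a.pair b, Prod.ext ?_ ?_⟩
      · exact FreeObj.ext fun S x => (FreeObj.ev_map _ _ S x).trans (FreeObj.res_inl_ev_pair a b S x)
      · exact FreeObj.ext fun S x => (FreeObj.ev_map _ _ S x).trans (FreeObj.res_inr_ev_pair a b S x)
  ring Y := inferInstance
  map_zero Y z := FreeObj.ext fun S x => by rw [FreeObj.ev_map, FreeObj.ev_zero, S.map_zero]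
  map_one Y z := FreeObj.ext fun S x => by rw [FreeObj.ev_map, FreeObj.ev_one, S.map_one]
  map_add Y z := FreeObj.ext fun S x => by
    rw [FreeObj.ev_map, FreeObj.ev_add, S.map_add, FreeObj.ev_map, FreeObj.ev_map]
  map_mul Y z := FreeObj.ext fun S x => by
    rw [FreeObj.ev_map, FreeObj.ev_mul, S.map_mul, FreeObj.ev_map, FreeObj.ev_map]

/-- The universal element. -/
noncomputable def freeVar (X : FinGSet G) : (free.{u} X).obj X := FreeObj.mk _ Generated.var

theorem Hom.app_add {S T : TambaraFunctor.{u} G} (φ : S.Hom T) (a b : S.obj Y) :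
    φ.app Y (a + b) = φ.app Y a + φ.app Y b := by
  obtain ⟨z, rfl, rfl⟩ := S.exists_pair a b
  rw [res, res, ← S.map_add, φ.naturality, φ.naturality, φ.naturality, T.map_add]

theorem Hom.app_mul {S T : TambaraFunctor.{u} G} (φ : S.Hom T) (a b : S.obj Y) :
    φ.app Y (a * b) = φ.app Y a * φ.app Y b := by
  obtain ⟨z, rfl, rfl⟩ := S.exists_pair a b
  rw [res, res, ← S.map_mul, φ.naturality, φ.naturality, φ.naturality, T.map_mul]

theorem Hom.app_zero {S T : TambaraFunctor.{u} G} (φ : S.Hom T) : φ.app Y 0 = 0 := by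
  obtain ⟨z⟩ := S.nonempty_empty
  rw [← S.map_zero Y z, φ.naturality, T.map_zero]

theorem Hom.app_one {S T : TambaraFunctor.{u} G} (φ : S.Hom T) : φ.app Y 1 = 1 := by
  obtain ⟨z⟩ := S.nonempty_empty
  rw [← S.map_one Y z, φ.naturality, T.map_one]

/-- A morphism of Tambara functors is levelwise a ring homomorphism. -/
def Hom.appHom {S T : TambaraFunctor.{u} G} (φ : S.Hom T) (Y : FinGSet G) : S.obj Y →+* T.obj Y where
  toFun := φ.app Y
  map_one' := φ.app_one
  map_mul' := φ.app_mul
  map_zero' := φ.app_zero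
  map_add' := φ.app_add

theorem Hom.app_neg {S T : TambaraFunctor.{u} G} (φ : S.Hom T) (a : S.obj Y) :
    φ.app Y (-a) = -φ.app Y a := _root_.map_neg (φ.appHom Y) a

theorem free_induction {M : ∀ Y : FinGSet G, (free.{u} X).obj Y → Prop} (hvar : M X (freeVar X))
    (hmap : ∀ {Y Z : FinGSet G} (P : Bispan Y Z) a, M Y a → M Z ((free X).map P a))
    (hneg : ∀ {Y : FinGSet G} a, M Y a → M Y (-a))
    (hpair : ∀ {Y Z : FinGSet G} (a : (free X).obj (sum Y Z)), M Y ((free X).res (inl Y Z) a) →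
      M Z ((free X).res (inr Y Z) a) → M (sum Y Z) a) (Y : FinGSet G) (a : (free.{u} X).obj Y) :
    M Y a := by
  have key : ∀ (Y : FinGSet G) (w : Universal.{u} X Y) (h : Generated X Y w),
      M Y (FreeObj.mk w h) := by
    intro Y w h
    induction h with
    | var => exact hvar
    | map P w h ih =>
      have : FreeObj.mk _ (Generated.map P w h) = (free X).map P (FreeObj.mk w h) :=
        FreeObj.ext fun S x => by
          rw [FreeObj.ev_mk]
          exact ((FreeObj.ev_map _ _ S x).trans (by rw [FreeObj.ev_mk])).symm
      rw [this]
      exact hmap P _ ih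
    | neg w h ih =>
      have : FreeObj.mk _ (Generated.neg w h) = (-FreeObj.mk w h : FreeObj.{u} X _) :=
        FreeObj.ext fun S x => by rw [FreeObj.ev_mk, FreeObj.ev_neg, FreeObj.ev_mk]
      rw [this]
      exact hneg _ ih
    | @pair Y Z w v z h h' hz hz' ih ih' =>
      refine hpair _ ?_ ?_
      · have : (free X).res (inl Y Z) (FreeObj.mk z (Generated.pair w v z h h' hz hz')) =
            FreeObj.mk w h := FreeObj.ext fun S x => by
          refine (FreeObj.ev_map _ _ S x).trans ?_
          rw [FreeObj.ev_mk, FreeObj.ev_mk]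
          exact hz S x
        rw [this]
        exact ih
      · have : (free X).res (inr Y Z) (FreeObj.mk z (Generated.pair w v z h h' hz hz')) =
            FreeObj.mk v h' := FreeObj.ext fun S x => by
          refine (FreeObj.ev_map _ _ S x).trans ?_
          rw [FreeObj.ev_mk, FreeObj.ev_mk]
          exact hz' S x
        rw [this]
        exact ih'
  have h := key Y (FreeObj.ev a) (FreeObj.generated a)
  have h2 : FreeObj.mk (FreeObj.ev a) (FreeObj.generated a) = a :=
    FreeObj.ext fun S x => by rw [FreeObj.ev_mk]
  rwa [h2] at h

/-- Evaluating families at `x ∈ S(X)` is a morphism sending the universal element to `x`; it is the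
only one because the universal element generates everything. -/
theorem isFreeOn_free (X : FinGSet G) : (free.{u} X).IsFreeOn X (freeVar X) := by
  intro S
  constructor
  · intro φ ψ h
    have : φ.app = ψ.app := by
      funext Y a
      refine free_induction (M := fun Y a => φ.app Y a = ψ.app Y a) h ?_ ?_ ?_ Y a
      · intro Y Z P a ih
        rw [φ.naturality, ψ.naturality, ih]
      · intro Y a ih
        rw [φ.app_neg, ψ.app_neg, ih]
      · intro Y Z a h1 h2
        refine S.pair_ext ?_ ?_
        · rw [res, ← φ.naturality, ← ψ.naturality]
          exact h1
        · rw [res, ← φ.naturality, ← ψ.naturality]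
          exact h2
    cases φ
    cases ψ
    cases this
    rfl
  · intro x
    refine ⟨⟨fun Y a => FreeObj.ev a S x, fun P a => FreeObj.ev_map P a S x⟩, ?_⟩
    exact congrFun (congrFun (FreeObj.ev_mk _ Generated.var) S) x

/-- By uniqueness the composite `T → free X → T` matching the universal elements is the identity, so
the induction principle passes from the constructed free functor to any other. -/
theorem IsFreeOn.induction {T : TambaraFunctor.{u} G} {x : T.obj X} (hT : T.IsFreeOn X x)
    {M : ∀ Y : FinGSet G, T.obj Y → Prop} (hvar : M X x)
    (hmap : ∀ {Y Z : FinGSet G} (P : Bispan Y Z) a, M Y a → M Z (T.map P a))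
    (hneg : ∀ {Y : FinGSet G} a, M Y a → M Y (-a))
    (hpair : ∀ {Y Z : FinGSet G} (a : T.obj (sum Y Z)), M Y (T.res (inl Y Z) a) →
      M Z (T.res (inr Y Z) a) → M (sum Y Z) a) (Y : FinGSet G) (a : T.obj Y) : M Y a := by
  obtain ⟨φ, hφ⟩ := (hT (free X)).2 (freeVar X)
  obtain ⟨ψ, hψ⟩ := (isFreeOn_free X T).2 x
  let χ : T.Hom T := ⟨fun Y a => ψ.app Y (φ.app Y a), fun P a => by
    rw [φ.naturality, ψ.naturality]⟩
  let ι : T.Hom T := ⟨fun Y a => a, fun P a => rfl⟩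
  have hχ : χ = ι := (hT T).1 ((congrArg (ψ.app X) hφ).trans hψ)
  have h1 : ψ.app Y (φ.app Y a) = a := congrFun (congrFun (congrArg Hom.app hχ) Y) a
  rw [← h1]
  refine free_induction (M := fun Y a => M Y (ψ.app Y a)) ?_ ?_ ?_ ?_ Y (φ.app Y a)
  · have hψ' : ψ.app X (freeVar X) = x := hψ
    rwa [hψ']
  · intro Y Z P a ih
    rw [ψ.naturality]
    exact hmap P _ ih
  · intro Y a ih
    rw [ψ.app_neg]
    exact hneg _ ih
  · intro Y Z a h1 h2
    refine hpair _ ?_ ?_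
    · rw [res, ← ψ.naturality]
      exact h1
    · rw [res, ← ψ.naturality]
      exact h2

theorem IsBurnside.isFreeOn {T : TambaraFunctor.{u} G} (hT : T.IsBurnside)
    (x : T.obj (empty G)) : T.IsFreeOn (empty G) x := by
  intro S
  obtain ⟨h⟩ := hT S
  refine ⟨fun φ ψ _ => Subsingleton.elim φ ψ, fun y => ⟨h.default, S.subsingleton_empty.elim _ _⟩⟩

theorem IsFreeOn.isBurnside {T : TambaraFunctor.{u} G} {x : T.obj (empty G)}
    (hT : T.IsFreeOn (empty G) x) : T.IsBurnside := by
  intro S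
  obtain ⟨y⟩ := S.nonempty_empty
  obtain ⟨φ, -⟩ := (hT S).2 y
  exact ⟨⟨⟨φ⟩, fun ψ => (hT S).1 (S.subsingleton_empty.elim _ _)⟩⟩

end TambaraFunctor

end

/-! ### The free functors of the corollary -/

section

open Bispan

variable {G : Type} [Group G] [Finite G]

namespace GhostData.Obj

variable {D : GhostData G}

theorem map_T_quot_q [Nontrivial G] (w : Obj.{u} D (orbit ⊥)) (y) :
    (w.map (Bispan.T (quot (bot_le : (⊥ : Subgroup G) ≤ ⊤)))).q y = 0 :=
  Finset.sum_eq_zero fun b _ => absurd b.2.1 (not_isFixed_bot b.1)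

theorem map_N_quot_q [Nontrivial G] (w : Obj.{u} D (orbit ⊥)) (y) :
    (w.map (Bispan.N (quot (bot_le : (⊥ : Subgroup G) ≤ ⊤)))).q y = D.φ (w.f (base ⊥)) := by
  let P := Bispan.N (quot (bot_le : (⊥ : Subgroup G) ≤ ⊤))
  have : Subsingleton {b : P.B // IsFixed b ∧ P.t b = y.1} :=
    ⟨fun a a' => Subtype.ext (a.2.2.trans a'.2.2.symm)⟩
  refine (Fintype.sum_subsingleton _ (⟨y.1, y.2, rfl⟩ :
    {b : P.B // IsFixed b ∧ P.t b = y.1})).trans ?_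
  refine (prod_orbRep (A := orbit (⊥ : Subgroup G)) w.val w.val_smul (fun a => P.n a = y.1)
    (fun _ _ _ => Subsingleton.elim (α := orbit (⊤ : Subgroup G)) _ _) (ι := Unit)
    (fun _ => base ⊥) (fun _ => Subsingleton.elim (α := orbit (⊤ : Subgroup G)) _ _)
    (fun a _ => ⟨(), exists_smul_base a⟩) (fun _ _ _ _ => rfl)).trans ?_
  rw [Fintype.prod_subsingleton _ (), val_of_not_isFixed _ (not_isFixed_bot _)]

end GhostData.Obj

namespace TambaraFunctor

section Trivial

variable {X : FinGSet G} {T : TambaraFunctor.{u} G} {x₀ : T.obj X}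

variable (T x₀) in
/-- The polynomial ring mapping to `T(G/e)`. -/
noncomputable def polyHom : MvPolynomial X ℤ →+* T.obj (orbit (⊥ : Subgroup G)) :=
  MvPolynomial.eval₂Hom (Int.castRingHom _) fun x => T.res (ptMap x) x₀

variable (T x₀) in
/-- The polynomial ring mapping to the geometric fixed points. -/
noncomputable def phiPolyHom (hX : ∀ x : X, IsFixed x) : MvPolynomial (X ⊕ X) ℤ →+* T.GeomFixedPoints :=
  MvPolynomial.eval₂Hom (Int.castRingHom _) (Sum.elim
    (fun x => Ideal.Quotient.mk T.transferIdeal (T.res (fixMap x (hX x)) x₀))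
    fun x => T.nmPhi (T.res (ptMap x) x₀))

theorem nmPhi_polyHom [Nontrivial G] (hS : ∀ H : Subgroup G, H = ⊥ ∨ H = ⊤)
    (hX : ∀ x : X, IsFixed x) (f : MvPolynomial X ℤ) :
    T.nmPhi (polyHom T x₀ f) = phiPolyHom T x₀ hX (MvPolynomial.rename Sum.inr f) := by
  have : (T.nmPhiHom hS).comp (polyHom T x₀) =
      (phiPolyHom T x₀ hX).comp (MvPolynomial.rename Sum.inr : _ →ₐ[ℤ] _).toRingHom := by
    refine MvPolynomial.ringHom_ext (fun n => ?_) fun x => ?_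
    · exact RingHom.congr_fun (RingHom.ext_int (((T.nmPhiHom hS).comp (polyHom T x₀)).comp
        MvPolynomial.C) (((phiPolyHom T x₀ hX).comp
          (MvPolynomial.rename Sum.inr : _ →ₐ[ℤ] _).toRingHom).comp MvPolynomial.C)) n
    · change T.nmPhi (MvPolynomial.eval₂Hom _ _ (MvPolynomial.X x)) =
        MvPolynomial.eval₂Hom _ _ (MvPolynomial.rename Sum.inr (MvPolynomial.X x))
      rw [MvPolynomial.rename_X, MvPolynomial.eval₂Hom_X', MvPolynomial.eval₂Hom_X', Sum.elim_inr]
  exact RingHom.congr_fun this f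

/-- By the double coset formula, the elements whose restrictions to `G/e` are polynomials in the
restrictions of `x₀` are stable under every bispan. -/
theorem IsFreeOn.polyHom_surjective (hT : T.IsFreeOn X x₀) : Function.Surjective (polyHom T x₀) := by
  intro c
  have key := hT.induction (M := fun Y a => ∀ y : Y, T.res (ptMap y) a ∈ (polyHom T x₀).range)
    (fun x => ⟨MvPolynomial.X x, MvPolynomial.eval₂Hom_X' _ _ _⟩) (fun P a h y => ?_)
    (fun a h y => ?_) (fun {Y Z} a h h' y => ?_) (orbit ⊥) c (base ⊥)
  · have h1 : ptMap (base ⊥) = .id G := (hom_ext (ptMap_base _) : ptMap (base ⊥) = .id G)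
    rw [h1, res_id] at key
    exact key
  · rw [res_ptMap_map]
    exact Subring.sum_mem _ fun b _ => Subring.prod_mem _ fun a _ => h _
  · rw [← resHom_apply, _root_.map_neg]
    exact Subring.neg_mem _ (h y)
  · change Y ⊕ Z at y
    rcases y with y | y
    · have := h y
      rwa [← res_comp, comp_ptMap] at this
    · have := h' y
      rwa [← res_comp, comp_ptMap] at this

/-- The same induction using `mk_map`: fixed orbits stay within the inductive hypothesis, and free
orbits give norms of elements of `T(G/e)`, which are polynomials in the norms of the generators. -/
theorem IsFreeOn.phiPolyHom_surjective [Nontrivial G] (hS : ∀ H : Subgroup G, H = ⊥ ∨ H = ⊤)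
    (hX : ∀ x : X, IsFixed x) (hT : T.IsFreeOn X x₀) :
    Function.Surjective (phiPolyHom T x₀ hX) := by
  intro c
  obtain ⟨c, rfl⟩ := Ideal.Quotient.mk_surjective c
  have key := hT.induction (M := fun Y a => ∀ f : orbit (⊤ : Subgroup G) →[G] Y,
    Ideal.Quotient.mk T.transferIdeal (T.res f a) ∈ (phiPolyHom T x₀ hX).range)
    (fun f => ?_) (fun P a h f => ?_) (fun a h y => ?_) (fun {Y Z} a h h' f => ?_)
    (orbit ⊤) c (.id G)
  · rw [res_id] at key
    exact key
  · rw [eq_fixMap f]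
    exact ⟨MvPolynomial.X (Sum.inl _), MvPolynomial.eval₂Hom_X' _ _ _⟩
  · rw [res, ← T.map_comp, T.mk_map hS]
    refine Subring.sum_mem _ fun b _ => Subring.prod_mem _ fun w _ => ?_
    by_cases hw : IsFixed w.1
    · rw [phiVal_of_isFixed _ _ hw, ← res_comp]
      exact h _
    · rw [phiVal_of_not_isFixed _ _ hw]
      obtain ⟨f, hf⟩ := hT.polyHom_surjective (T.res (ptMap w.1) (T.res _ a))
      rw [← hf, nmPhi_polyHom hS hX]
      exact ⟨_, rfl⟩
  · rw [← resHom_apply, _root_.map_neg, _root_.map_neg]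
    exact Subring.neg_mem _ (h y)
  · have hall : ∀ (z : sum Y Z) (hz : IsFixed z),
        Ideal.Quotient.mk T.transferIdeal (T.res (fixMap z hz) a) ∈ (phiPolyHom T x₀ hX).range := by
      rintro (y | y) hz
      · have hy : IsFixed y := fun g => Sum.inl_injective (hz g)
        have := h (fixMap y hy)
        rw [← res_comp, comp_fixMap] at this
        exact this
      · have hy : IsFixed y := fun g => Sum.inr_injective (hz g)
        have := h' (fixMap y hy)
        rw [← res_comp, comp_fixMap] at this
        exact this
    rw [eq_fixMap f]
    exact hall _ _

/-- The ghost data with both rings equal to `ℤ`. -/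
def intGhost (G : Type) [Group G] : GhostData G where
  R := ℤ
  Q := ℤ
  ρ _ := .id ℤ
  φ := .id ℤ
  φ_ρ _ _ := rfl

/-- For every integer point `v`, freeness gives a morphism to the integral ghost functor under which
a polynomial becomes its value at `v`. A polynomial in the kernel thus vanishes at all integer
points. -/
theorem IsFreeOn.phiPolyHom_injective [Nontrivial G] (hS : ∀ H : Subgroup G, H = ⊥ ∨ H = ⊤)
    (hX : ∀ x : X, IsFixed x) (hT : T.IsFreeOn X x₀) :
    Function.Injective (phiPolyHom T x₀ hX) := by
  rw [injective_iff_map_eq_zero]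
  intro f hf
  refine MvPolynomial.funext fun v => ?_
  let S : TambaraFunctor.{u} G := (intGhost G).functor hS
  let s : GhostData.Obj.{u} (intGhost G) X :=
    ⟨fun x => v (Sum.inr x), fun x => v (Sum.inl x.1), fun g x => by rw [hX x g]; rfl⟩
  obtain ⟨h, hs⟩ := (hT S).2 s
  replace hs : h.app X x₀ = s := hs
  let χ : T.obj (orbit (⊤ : Subgroup G)) →+* ℤ :=
    (GhostData.Obj.qHom (D := intGhost G) ⟨base ⊤, isFixed_top _⟩).comp (h.appHom (orbit ⊤))
  -- The second ghost coordinate of a transfer is a sum over fixed points of `G/e`, of which there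
  -- are none.
  have hχ : ∀ a ∈ T.transferIdeal, χ a = 0 := by
    intro a ha
    obtain ⟨c, rfl⟩ := (T.mem_transferIdeal_iff a).mp ha
    refine Eq.trans (congrArg (GhostData.Obj.qHom (D := intGhost G) ⟨base ⊤, isFixed_top _⟩)
      (h.naturality (Bispan.T (quot bot_le)) c)) ?_
    exact GhostData.Obj.map_T_quot_q _ _
  have key : (Ideal.Quotient.lift _ χ hχ).comp (phiPolyHom T x₀ hX) = MvPolynomial.eval v := by
    refine MvPolynomial.ringHom_ext (fun n => ?_) fun x => ?_
    · exact RingHom.congr_fun (RingHom.ext_int (((Ideal.Quotient.lift _ χ hχ).comp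
        (phiPolyHom T x₀ hX)).comp MvPolynomial.C) ((MvPolynomial.eval v).comp MvPolynomial.C)) n
    · rw [RingHom.comp_apply, phiPolyHom, MvPolynomial.eval₂Hom_X', MvPolynomial.eval_X]
      rcases x with x | x
      · rw [Sum.elim_inl, Ideal.Quotient.lift_mk]
        refine Eq.trans (congrArg (GhostData.Obj.qHom (D := intGhost G) ⟨base ⊤, isFixed_top _⟩)
          ((h.naturality (R (fixMap x (hX x))) x₀).trans
            ((congrArg (S.map _) hs).trans (s.map_R _)))) ?_
        rfl
      · rw [Sum.elim_inr, nmPhi, Ideal.Quotient.lift_mk]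
        refine Eq.trans (congrArg (GhostData.Obj.qHom (D := intGhost G) ⟨base ⊤, isFixed_top _⟩)
          ((h.naturality (Bispan.N (quot bot_le)) _).trans (congrArg (S.map _)
            ((h.naturality (R (ptMap x)) x₀).trans
              ((congrArg (S.map _) hs).trans (s.map_R _)))))) ?_
        refine (GhostData.Obj.map_N_quot_q (s.res (ptMap x)) _).trans ?_
        exact congrArg (fun x => v (Sum.inr x)) (ptMap_base x)
  have := RingHom.congr_fun key f
  rw [RingHom.comp_apply, hf, _root_.map_zero] at this
  rw [← this, _root_.map_zero]

/-- `Φ T` is a polynomial ring over `ℤ`, and the norm becomes the inclusion of a subset of the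
variables. It remains to exclude torsion at `G/G`, which is deduced from its absence in `Φ T` and
`T(G/e)`. -/
theorem IsFreeOn.isTambaraDomain [Nontrivial G] (hS : ∀ H : Subgroup G, H = ⊥ ∨ H = ⊤)
    (hX : ∀ x : X, IsFixed x) (hT : T.IsFreeOn X x₀) : T.IsTambaraDomain := by
  have hinj := hT.phiPolyHom_injective hS hX
  have hsurj := hT.phiPolyHom_surjective hS hX
  have : IsDomain T.GeomFixedPoints :=
    (RingEquiv.ofBijective _ ⟨hinj, hsurj⟩).symm.toMulEquiv.isDomain _
  have hnm : Function.Injective T.nmPhi := by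
    intro a b hab
    obtain ⟨f, rfl⟩ := hT.polyHom_surjective a
    obtain ⟨g, rfl⟩ := hT.polyHom_surjective b
    rw [nmPhi_polyHom hS hX, nmPhi_polyHom hS hX] at hab
    rw [MvPolynomial.rename_injective _ Sum.inr_injective (hinj hab)]
  have hnm0 : ∀ a, T.nmPhi a = 0 → a = 0 := (injective_iff_map_eq_zero (T.nmPhiHom hS)).mp hnm
  have hΦ : ∀ y : T.GeomFixedPoints, (Nat.card G : T.GeomFixedPoints) * y = 0 → y = 0 := by
    intro y hy
    obtain ⟨f, rfl⟩ := hsurj y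
    rw [← map_natCast (phiPolyHom T x₀ hX), ← _root_.map_mul] at hy
    have h1 := (injective_iff_map_eq_zero _).mp hinj _ hy
    rcases mul_eq_zero.mp h1 with h | h
    · exact absurd (Nat.cast_eq_zero.mp h) Nat.card_pos.ne'
    · rw [h, _root_.map_zero]
  have he : ∀ a : T.obj (orbit (⊥ : Subgroup G)), (Nat.card G : T.obj _) * a = 0 → a = 0 := by
    intro a ha
    refine hnm0 a (hΦ _ ?_)
    have h2 := congrArg (T.nmPhiHom hS) ha
    rw [_root_.map_mul, map_natCast, _root_.map_zero] at h2
    exact h2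
  refine T.isTambaraDomain_of_injective hS hnm fun x hx => ?_
  have h1 : Ideal.Quotient.mk T.transferIdeal x = 0 := by
    refine hΦ _ ?_
    rw [← map_natCast (Ideal.Quotient.mk T.transferIdeal), ← _root_.map_mul, hx, _root_.map_zero]
  -- A torsion element is a transfer `tr c`. Its restriction is torsion, hence zero, and also equals
  -- `|G| • c`, so `c = 0`.
  obtain ⟨c, rfl⟩ := (T.mem_transferIdeal_iff x).mp (Ideal.Quotient.eq_zero_iff_mem.mp h1)
  have h2 := he (T.resTop (T.trTop c)) (by
    have h3 := congrArg (T.resHom (quot bot_le)) hx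
    rw [_root_.map_mul, map_natCast, _root_.map_zero] at h3
    exact h3)
  rw [T.resTop_trTop c fun y => hnm (T.nmPhi_res_ptMap y c), nsmul_eq_mul] at h2
  rw [he c h2]
  exact T.tr_zero _

end Trivial

/-- The ghost data with `R = ℤ[x_g : g ∈ G]` and `Q = ℤ`. -/
noncomputable def mvPolynomialGhost (G : Type) [Group G] : GhostData G where
  R := MvPolynomial G ℤ
  Q := ℤ
  ρ g := (MvPolynomial.rename (g * ·) : MvPolynomial G ℤ →ₐ[ℤ] MvPolynomial G ℤ).toRingHom
  φ := MvPolynomial.constantCoeff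
  φ_ρ _ _ := MvPolynomial.constantCoeff_rename _ _

theorem IsFreeOn.not_isTambaraDomain [Nontrivial G] (hS : ∀ H : Subgroup G, H = ⊥ ∨ H = ⊤)
    {T : TambaraFunctor.{u} G} {x₀ : T.obj (orbit ⊥)} (hT : T.IsFreeOn (orbit ⊥) x₀) :
    ¬ T.IsTambaraDomain := by
  let D := mvPolynomialGhost G
  let S : TambaraFunctor.{u} G := D.functor hS
  choose γ hγ using exists_smul_base (H := (⊥ : Subgroup G))
  let s : GhostData.Obj.{u} D (orbit ⊥) :=
    ⟨fun y => (MvPolynomial.X (γ y) : MvPolynomial G ℤ), fun _ => 0, fun g y => by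
      have h1 : γ (g • y) = g * γ y := smul_base_injective (by rw [hγ, mul_smul, hγ])
      rw [h1]
      exact (MvPolynomial.rename_X _ _).symm⟩
  obtain ⟨h, hs⟩ := (hT S).2 s
  replace hs : h.app _ x₀ = s := hs
  refine T.not_isTambaraDomain_of_not_injective hS (fun hinj => ?_) fun hinj => ?_
  · obtain ⟨k, hk⟩ := exists_ne (1 : G)
    -- Injectivity of the norm would identify the generator with its conjugate by `k`, whereas the
    -- ghost functor sends these to distinct variables.
    have h1 : T.res (ptMap (k • base ⊥)) x₀ = x₀ := hinj (T.nmPhi_res_ptMap _ _)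
    have h2 : s.res (ptMap (k • base ⊥)) = s := by
      rw [← s.map_R]
      refine ((congrArg (S.map _) hs).symm.trans (h.naturality _ _).symm).trans ?_
      exact (congrArg (h.app _) h1).trans hs
    have h3 := congrFun (congrArg GhostData.Obj.f h2) (base ⊥)
    have h4 : γ (ptMap (k • base ⊥) (base ⊥)) = γ (base ⊥) := MvPolynomial.X_injective h3
    have h5 : ptMap (k • base (⊥ : Subgroup G)) (base ⊥) = base ⊥ := by
      rw [← hγ (ptMap (k • base ⊥) (base ⊥)), h4, hγ]
    rw [ptMap_base] at h5
    exact hk (smul_base_injective (h5.trans (one_smul G _).symm))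
  -- Both sides restrict to `|G|`, so they agree if restriction is injective; applying `χ`, which
  -- kills transfers, then yields `|G| = 0` in `ℤ`.
  · have h1 : T.trTop 1 = (Nat.card G : T.obj (orbit (⊤ : Subgroup G))) := by
      refine hinj ((T.resTop_trTop 1 fun y => T.res_one _).trans ?_)
      rw [nsmul_eq_mul, mul_one]
      exact (map_natCast (T.resHom (quot bot_le)) _).symm
    let χ : T.obj (orbit (⊤ : Subgroup G)) →+* ℤ :=
      (GhostData.Obj.qHom (D := D) ⟨base ⊤, isFixed_top _⟩).comp (h.appHom (orbit ⊤))
    have h2 : χ (T.trTop 1) = 0 := by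
      refine Eq.trans (congrArg (GhostData.Obj.qHom (D := D) ⟨base ⊤, isFixed_top _⟩)
        (h.naturality (Bispan.T (quot bot_le)) 1)) ?_
      exact GhostData.Obj.map_T_quot_q _ _
    rw [h1, map_natCast] at h2
    exact absurd (Nat.cast_eq_zero.mp h2) Nat.card_pos.ne'

end TambaraFunctor

end

theorem mainTheorem11 (p : ℕ) (hp : p.Prime) (G : Type) [Group G] [Finite G]
    (hG : Nat.card G = p) :
    (∀ T : TambaraFunctor.{u} G, T.IsNonzero →
      (Function.Injective T.nmPhi → IsDomain T.GeomFixedPoints →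
        (∀ x : T.obj (orbit (⊤ : Subgroup G)), (p : T.obj (orbit (⊤ : Subgroup G))) * x = 0 → x = 0) →
        T.IsTambaraDomain) ∧
      (¬ Function.Injective T.nmPhi → ¬ Function.Injective T.resTop → ¬ T.IsTambaraDomain)) ∧
    ((∃ A : TambaraFunctor.{u} G, A.IsBurnside) ∧
      ∀ A : TambaraFunctor.{u} G, A.IsBurnside → A.IsTambaraDomain) ∧
    ((∃ (A : TambaraFunctor.{u} G) (x : A.obj (orbit ⊤)), A.IsFreeOn (orbit ⊤) x) ∧
      ∀ (A : TambaraFunctor.{u} G) (x : A.obj (orbit ⊤)),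
        A.IsFreeOn (orbit ⊤) x → A.IsTambaraDomain) ∧
    ((∃ (A : TambaraFunctor.{u} G) (x : A.obj (orbit ⊥)), A.IsFreeOn (orbit ⊥) x) ∧
      ∀ (A : TambaraFunctor.{u} G) (x : A.obj (orbit ⊥)),
        A.IsFreeOn (orbit ⊥) x → ¬ A.IsTambaraDomain) := by
  subst hG
  have : Fact (Nat.card G).Prime := ⟨hp⟩
  -- Primality enters only through this and the next fact: no intermediate subgroups, and
  -- nontriviality.
  have hS : ∀ H : Subgroup G, H = ⊥ ∨ H = ⊤ := fun H => H.eq_bot_or_eq_top_of_prime_card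
  have : Nontrivial G := Finite.one_lt_card_iff_nontrivial.mp hp.one_lt
  refine ⟨fun T _ => ⟨fun hinj hdom htors => T.isTambaraDomain_of_injective hS hinj htors,
    T.not_isTambaraDomain_of_not_injective hS⟩, ⟨⟨_, (TambaraFunctor.isFreeOn_free _).isBurnside⟩, fun A hA => ?_⟩,
    ⟨⟨_, _, TambaraFunctor.isFreeOn_free _⟩, fun A x hA => hA.isTambaraDomain hS isFixed_top⟩,
    ⟨⟨_, _, TambaraFunctor.isFreeOn_free _⟩, fun A x hA => hA.not_isTambaraDomain hS⟩⟩
  obtain ⟨x⟩ := A.nonempty_empty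
  exact (hA.isFreeOn x).isTambaraDomain hS fun x => isEmptyElim x
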